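/- Let $M$ be a smooth manifold of dimension $2n$ (Hausdorff, second countable, without boundary). A locally conformal symplectic (l.c.s.) structure on $M$ is a pair $(\omega,\theta)$ of a non-degenerate $2$-form $\omega\in\Omega^2(M)$ and a closed $1$-form $\theta\in\Omega^1(M)$ (the Lee form) such that $d\omega=-\omega\wedge\theta$. For $k\in\mathbb Z$ put $d_k\alpha=d\alpha+k\,\theta\wedge\alpha$ and $d_\theta=d_1$; let $L\alpha=\omega\wedge\alpha$, and filter $\Omega^*(M)$ by $F^p=L^p\,\Omega^*(M)$ for $p\ge 0$ and $F^p=\Omega^*(M)$ for $p\le 0$. This filtration is preserved by every $d_k$. Let $(E^{p,q}_{k,r},d_{k,r})_{r\ge 0}$ denote the spectral sequence of the filtered complex $(\Omega^*(M),d_k,F^*)$, that is, $E^{p,q}_{k,r}=Z^{p,q}_r/(Z^{p+1,q-1}_{r-1}+B^{p,q}_{r-1})$ with $$Z^{p,q}_r=\{x\in F^p\cap\Omega^{p+q}(M):\ d_kx\in F^{p+r}\},\qquad B^{p,q}_r=F^p\cap\Omega^{p+q}(M)\cap d_k\bigl(F^{p-r}\cap\Omega^{p+q-1}(M)\bigr),$$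 with $d_{k,r}:E^{p,q}_{k,r}\to E^{p+r,q-r+1}_{k,r}$ induced by $d_k$, and with the usual identifications $H(E_{k,r},d_{k,r})\cong E_{k,r+1}$. An isomorphism of spectral sequences is a family of linear isomorphisms of all the terms $E^{p,q}_{k,r}$ that commute with all the differentials and are compatible with these identifications. Let $(\omega,\theta)$ and $(\omega',\theta')$ be two l.c.s. structures on $M$. 1. Suppose that $\omega$ and $\omega'$ are conformally equivalent, i.e. $\omega'=e^f\omega$ or $\omega'=-e^f\omega$ for some $f\in C^\infty(M)$; if $n=1$, suppose moreover that $\theta'=\theta-df$ (for $n\neq 1$ this holds automatically). Then for every $k\in\mathbb Z$ the spectral sequences $E^{p,q}_{k,r}$ of $(M,\omega,\theta)$ and of $(M,\omega',\theta')$ are isomorphic. 2. Suppose that $\omega'=\omega+d_\theta\rho$ for some $\rho\in\Omega^1(M)$; if $n=1$, suppose moreover that $\theta'=\theta$ (for $n\neq 1$ this holds automatically). Then for every $k\in\mathbb Z$ the $E_1$-terms of the two spectral sequences are isomorphic: for all $p,q\in\mathbb Z$ the real vector spaces $E^{p,q}_{k,1}$ of $(M,\omega,\theta)$ and of $(M,\omega',\theta')$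 are isomorphic. -/

import Mathlib

open scoped Manifold ContDiff

set_option linter.unusedSectionVars false

noncomputable section

namespace LCS

section Wedge

variable {V W : Type*} [AddCommGroup V] [Module ℝ V] [TopologicalSpace V]
  [AddCommGroup W] [Module ℝ W] [TopologicalSpace W] {k l m N : ℕ}

/-- The tensor product `(v₁, …, v_{k+l}) ↦ a (v₁, …, v_k) * b (v_{k+1}, …, v_{k+l})` of two
continuous alternating forms, as a continuous multilinear form. -/
def tensor (a : V [⋀^Fin k]→L[ℝ] ℝ) (b : V [⋀^Fin l]→L[ℝ] ℝ) :
    ContinuousMultilinearMap ℝ (fun _ : Fin (k + l) => V) ℝ where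
  toFun v := a (fun i => v (Fin.castAdd l i)) * b (fun j => v (Fin.natAdd k j))
  map_update_add' {inst} v i x y := by
    have := Subsingleton.elim inst (instDecidableEqFin (k + l)); subst this
    refine Fin.addCases (fun i => ?_) (fun j => ?_) i
    · have h (z : V) : (fun i' => Function.update v (Fin.castAdd l i) z (Fin.castAdd l i'))
          = Function.update (fun i' => v (Fin.castAdd l i')) i z := by
        ext i'; simp [Function.update_apply]
      have h' (z : V) (j : Fin l) : Function.update v (Fin.castAdd l i) z (Fin.natAdd k j)
          = v (Fin.natAdd k j) := by
        rw [Function.update_of_ne]; simp [Fin.ext_iff]; omega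
      simp only [h, h', ContinuousAlternatingMap.map_update_add, add_mul]
    · have h (z : V) : (fun i' => Function.update v (Fin.natAdd k j) z (Fin.natAdd k i'))
          = Function.update (fun i' => v (Fin.natAdd k i')) j z := by
        ext i'; simp [Function.update_apply]
      have h' (z : V) (i : Fin k) : Function.update v (Fin.natAdd k j) z (Fin.castAdd l i)
          = v (Fin.castAdd l i) := by
        rw [Function.update_of_ne]; simp [Fin.ext_iff]; omega
      simp only [h, h', ContinuousAlternatingMap.map_update_add, mul_add]
  map_update_smul' {inst} v i c x := by
    have := Subsingleton.elim inst (instDecidableEqFin (k + l)); subst this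
    refine Fin.addCases (fun i => ?_) (fun j => ?_) i
    · have h (z : V) : (fun i' => Function.update v (Fin.castAdd l i) z (Fin.castAdd l i'))
          = Function.update (fun i' => v (Fin.castAdd l i')) i z := by
        ext i'; simp [Function.update_apply]
      have h' (z : V) (j : Fin l) : Function.update v (Fin.castAdd l i) z (Fin.natAdd k j)
          = v (Fin.natAdd k j) := by
        rw [Function.update_of_ne]; simp [Fin.ext_iff]; omega
      simp only [h, h', ContinuousAlternatingMap.map_update_smul, smul_eq_mul, mul_assoc]
    · have h (z : V) : (fun i' => Function.update v (Fin.natAdd k j) z (Fin.natAdd k i'))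
          = Function.update (fun i' => v (Fin.natAdd k i')) j z := by
        ext i'; simp [Function.update_apply]
      have h' (z : V) (i : Fin k) : Function.update v (Fin.natAdd k j) z (Fin.castAdd l i)
          = v (Fin.castAdd l i) := by
        rw [Function.update_of_ne]; simp [Fin.ext_iff]; omega
      simp only [h, h', ContinuousAlternatingMap.map_update_smul, smul_eq_mul]
      ring
  cont := by
    refine Continuous.mul (a.cont.comp ?_) (b.cont.comp ?_) <;> fun_prop

/-- The wedge product of continuous alternating forms:
`(a ∧ b) (v₁, …, v_{k+l}) = 1 / (k! l!) ∑_σ sign σ a (v_{σ 1}, …, v_{σ k}) b (v_{σ (k+1)}, …)`. -/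
def wedge (a : V [⋀^Fin k]→L[ℝ] ℝ) (b : V [⋀^Fin l]→L[ℝ] ℝ) : V [⋀^Fin (k + l)]→L[ℝ] ℝ :=
  ((k.factorial : ℝ) * (l.factorial : ℝ))⁻¹ • ContinuousMultilinearMap.alternatization (tensor a b)

/-- Signed sum over all permutations of the arguments. -/
def altSum (f : (Fin N → V) → ℝ) (v : Fin N → V) : ℝ :=
  ∑ σ : Equiv.Perm (Fin N), (Equiv.Perm.sign σ : ℝ) * f (fun i => v (σ i))

theorem wedge_apply (a : V [⋀^Fin k]→L[ℝ] ℝ) (b : V [⋀^Fin l]→L[ℝ] ℝ) (v : Fin (k + l) → V) :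
    wedge a b v = ((k.factorial : ℝ) * (l.factorial : ℝ))⁻¹ *
      altSum (fun u => a (fun i => u (Fin.castAdd l i)) * b (fun j => u (Fin.natAdd k j))) v := by
  simp only [wedge, ContinuousAlternatingMap.smul_apply, smul_eq_mul,
    ContinuousMultilinearMap.alternatization_apply_apply, altSum, Units.smul_def, zsmul_eq_mul]
  rfl

theorem altSum_perm (f : (Fin N → V) → ℝ) (τ : Equiv.Perm (Fin N)) (v : Fin N → V) :
    altSum (fun u => f (fun i => u (τ i))) v = (Equiv.Perm.sign τ : ℝ) * altSum f v := by
  unfold altSum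
  rw [Finset.mul_sum, ← Equiv.sum_comp (Equiv.mulRight τ)
    (fun σ : Equiv.Perm (Fin N) => (Equiv.Perm.sign τ : ℝ) *
      ((Equiv.Perm.sign σ : ℝ) * f (fun i => v (σ i))))]
  refine Finset.sum_congr rfl fun σ _ => ?_
  have h : ((Equiv.Perm.sign τ : ℤ) : ℝ) * (Equiv.Perm.sign τ : ℤ) = 1 := by
    rw [← Int.cast_mul, ← Units.val_mul, Int.units_mul_self]; simp
  simp only [Equiv.coe_mulRight, Equiv.Perm.sign_mul, Units.val_mul, Int.cast_mul,
    Equiv.Perm.mul_apply]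
  linear_combination (-((Equiv.Perm.sign σ : ℤ) : ℝ) * f (fun i => v (σ (τ i)))) * h

theorem altSum_nested {n : ℕ} (f : (Fin N → V) → ℝ)
    (e : Equiv.Perm (Fin n) → Equiv.Perm (Fin N))
    (he : ∀ τ, Equiv.Perm.sign (e τ) = Equiv.Perm.sign τ) (v : Fin N → V) :
    altSum (fun u => ∑ τ : Equiv.Perm (Fin n),
      (Equiv.Perm.sign τ : ℝ) * f (fun i => u (e τ i))) v = (n.factorial : ℝ) * altSum f v := by
  have h1 : altSum (fun u => ∑ τ : Equiv.Perm (Fin n),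
      (Equiv.Perm.sign τ : ℝ) * f (fun i => u (e τ i))) v
      = ∑ τ : Equiv.Perm (Fin n), (Equiv.Perm.sign τ : ℝ) *
          altSum (fun u => f (fun i => u (e τ i))) v := by
    simp only [altSum, Finset.mul_sum]
    rw [Finset.sum_comm]
    refine Finset.sum_congr rfl fun σ _ => Finset.sum_congr rfl fun τ _ => ?_
    ring
  rw [h1]
  have h (τ : Equiv.Perm (Fin n)) :
      (Equiv.Perm.sign τ : ℝ) * altSum (fun u => f (fun i => u (e τ i))) v = altSum f v := by
    have h : ((Equiv.Perm.sign τ : ℤ) : ℝ) * (Equiv.Perm.sign τ : ℤ) = 1 := by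
      rw [← Int.cast_mul, ← Units.val_mul, Int.units_mul_self]; simp
    rw [altSum_perm, he]
    linear_combination (altSum f v) * h
  simp [h, Fintype.card_perm]

theorem altSum_const_mul (c : ℝ) (f : (Fin N → V) → ℝ) (v : Fin N → V) :
    altSum (fun u => c * f u) v = c * altSum f v := by
  simp only [altSum, Finset.mul_sum]
  exact Finset.sum_congr rfl fun _ _ => by ring

theorem altSum_cast {N' : ℕ} (h : N = N') (f : (Fin N → V) → ℝ) (v : Fin N' → V) :
    altSum f (fun i => v (Fin.cast h i)) = altSum (fun u => f (fun i => u (Fin.cast h i))) v := by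
  subst h; rfl

/-- A permutation of the first `k` indices. -/
def permL (l : ℕ) (τ : Equiv.Perm (Fin k)) : Equiv.Perm (Fin (k + l)) :=
  finSumFinEquiv.permCongr (Equiv.Perm.sumCongr τ 1)

/-- A permutation of the last `l` indices. -/
def permR (k : ℕ) (τ : Equiv.Perm (Fin l)) : Equiv.Perm (Fin (k + l)) :=
  finSumFinEquiv.permCongr (Equiv.Perm.sumCongr 1 τ)

@[simp] theorem permL_castAdd (τ : Equiv.Perm (Fin k)) (i : Fin k) :
    permL l τ (Fin.castAdd l i) = Fin.castAdd l (τ i) := by simp [permL, Equiv.permCongr_apply]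
@[simp] theorem permL_natAdd (τ : Equiv.Perm (Fin k)) (j : Fin l) :
    permL l τ (Fin.natAdd k j) = Fin.natAdd k j := by simp [permL, Equiv.permCongr_apply]
@[simp] theorem permR_castAdd (τ : Equiv.Perm (Fin l)) (i : Fin k) :
    permR k τ (Fin.castAdd l i) = Fin.castAdd l i := by simp [permR, Equiv.permCongr_apply]
@[simp] theorem permR_natAdd (τ : Equiv.Perm (Fin l)) (j : Fin l) :
    permR k τ (Fin.natAdd k j) = Fin.natAdd k (τ j) := by simp [permR, Equiv.permCongr_apply]
theorem sign_permL (τ : Equiv.Perm (Fin k)) :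
    Equiv.Perm.sign (permL l τ) = Equiv.Perm.sign τ := by simp [permL]
theorem sign_permR (τ : Equiv.Perm (Fin l)) :
    Equiv.Perm.sign (permR k τ) = Equiv.Perm.sign τ := by simp [permR]

theorem wedge_wedge_left (a : V [⋀^Fin k]→L[ℝ] ℝ) (b : V [⋀^Fin l]→L[ℝ] ℝ)
    (c : V [⋀^Fin m]→L[ℝ] ℝ) (v : Fin (k + l + m) → V) :
    wedge (wedge a b) c v = ((k.factorial : ℝ) * l.factorial * m.factorial)⁻¹ * altSum (fun u =>
      a (fun i => u (Fin.castAdd m (Fin.castAdd l i))) *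
      b (fun i => u (Fin.castAdd m (Fin.natAdd k i))) * c (fun i => u (Fin.natAdd (k + l) i))) v := by
  have := altSum_nested (fun u : Fin (k + l + m) → V =>
      a (fun i => u (Fin.castAdd m (Fin.castAdd l i))) *
      b (fun i => u (Fin.castAdd m (Fin.natAdd k i))) * c (fun i => u (Fin.natAdd (k + l) i)))
      (permL m) sign_permL v
  rw [wedge_apply]
  have h : (fun u : Fin (k + l + m) → V => wedge a b (fun i => u (Fin.castAdd m i)) *
      c (fun j => u (Fin.natAdd (k + l) j))) = fun u => ((k.factorial : ℝ) * l.factorial)⁻¹ *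
      ∑ τ : Equiv.Perm (Fin (k + l)), (Equiv.Perm.sign τ : ℝ) *
       (a (fun i => u (permL m τ (Fin.castAdd m (Fin.castAdd l i)))) *
       b (fun i => u (permL m τ (Fin.castAdd m (Fin.natAdd k i)))) *
       c (fun i => u (permL m τ (Fin.natAdd (k + l) i)))) := by
    funext u
    simp only [wedge_apply, altSum, permL_castAdd, permL_natAdd, mul_assoc, Finset.sum_mul]
  rw [h, altSum_const_mul, this]
  have : ((k + l).factorial : ℝ) ≠ 0 := by positivity
  field_simp

theorem wedge_wedge_right (a : V [⋀^Fin k]→L[ℝ] ℝ) (b : V [⋀^Fin l]→L[ℝ] ℝ)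
    (c : V [⋀^Fin m]→L[ℝ] ℝ) (v : Fin (k + (l + m)) → V) :
    wedge a (wedge b c) v = ((k.factorial : ℝ) * l.factorial * m.factorial)⁻¹ * altSum (fun u =>
      a (fun i => u (Fin.castAdd (l + m) i)) *
      b (fun i => u (Fin.natAdd k (Fin.castAdd m i))) *
      c (fun i => u (Fin.natAdd k (Fin.natAdd l i)))) v := by
  have := altSum_nested (fun u : Fin (k + (l + m)) → V =>
      a (fun i => u (Fin.castAdd (l + m) i)) *
      b (fun i => u (Fin.natAdd k (Fin.castAdd m i))) *
      c (fun i => u (Fin.natAdd k (Fin.natAdd l i))))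
      (permR k) sign_permR v
  rw [wedge_apply]
  have h : (fun u : Fin (k + (l + m)) → V => a (fun i => u (Fin.castAdd (l + m) i)) *
      wedge b c (fun j => u (Fin.natAdd k j))) = fun u => ((l.factorial : ℝ) * m.factorial)⁻¹ *
      ∑ τ : Equiv.Perm (Fin (l + m)), (Equiv.Perm.sign τ : ℝ) *
       (a (fun i => u (permR k τ (Fin.castAdd (l + m) i))) *
       b (fun i => u (permR k τ (Fin.natAdd k (Fin.castAdd m i)))) *
       c (fun i => u (permR k τ (Fin.natAdd k (Fin.natAdd l i))))) := by
    funext u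
    simp only [wedge_apply, altSum, permR_castAdd, permR_natAdd, mul_assoc, Finset.mul_sum]
    refine Finset.sum_congr rfl fun σ _ => ?_
    ring
  rw [h, altSum_const_mul, this]
  have : ((l + m).factorial : ℝ) ≠ 0 := by positivity
  field_simp

theorem wedge_assoc (a : V [⋀^Fin k]→L[ℝ] ℝ) (b : V [⋀^Fin l]→L[ℝ] ℝ)
    (c : V [⋀^Fin m]→L[ℝ] ℝ) (v : Fin (k + (l + m)) → V) :
    wedge (wedge a b) c (fun i => v (Fin.cast (add_assoc k l m) i)) =
      wedge a (wedge b c) v := by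
  rw [wedge_wedge_left, wedge_wedge_right, altSum_cast]
  have h (i : Fin m) : Fin.cast (add_assoc k l m) (Fin.natAdd (k + l) i) =
      Fin.natAdd k (Fin.natAdd l i) := by ext; simp [add_assoc]
  simp only [h]
  rfl

theorem wedge_one_comm (f₁ : V [⋀^Fin 1]→L[ℝ] ℝ) (a : V [⋀^Fin k]→L[ℝ] ℝ)
    (v : Fin (k + 1) → V) :
    wedge f₁ a (fun i => v (Fin.cast (add_comm 1 k) i)) = (-1) ^ k * wedge a f₁ v := by
  rw [wedge_apply, wedge_apply, altSum_cast]
  have h := altSum_perm (fun u : Fin (k + 1) → V => a (fun i => u (Fin.castAdd 1 i)) *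
    f₁ (fun j => u (Fin.natAdd k j))) (finRotate (k + 1)) v
  rw [sign_finRotate] at h
  have h1 (i : Fin k) : Fin.cast (add_comm 1 k) (Fin.natAdd 1 i) = i.succ := by
    ext; simp
  have h2 (i : Fin 1) : Fin.cast (add_comm 1 k) (Fin.castAdd k i) = 0 := by ext; simp
  have h3 (i : Fin k) : finRotate (k + 1) (Fin.castAdd 1 i) = i.succ := by
    have : Fin.castAdd 1 i = i.castSucc := rfl
    rw [finRotate_apply, this, Fin.coeSucc_eq_succ]
  have h4 (i : Fin 1) : finRotate (k + 1) (Fin.natAdd k i) = 0 := by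
    have : Fin.natAdd k i = Fin.last k := by ext; simp
    rw [this, finRotate_last]
  simp only [h3, h4] at h
  simp only [h1, h2]
  simp only [mul_comm (f₁ _), h]
  push_cast
  simp
  ring

theorem wedge_one_self (f₁ : V [⋀^Fin 1]→L[ℝ] ℝ) : wedge f₁ f₁ = 0 := by
  ext v
  have h := wedge_one_comm f₁ f₁ v
  have h' : wedge f₁ f₁ (fun i => v (Fin.cast (add_comm 1 1) i)) = wedge f₁ f₁ v := rfl
  change _ = (0 : ℝ)
  linarith

theorem wedge_add_left (a a' : V [⋀^Fin k]→L[ℝ] ℝ) (b : V [⋀^Fin l]→L[ℝ] ℝ) :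
    wedge (a + a') b = wedge a b + wedge a' b := by
  ext v
  simp only [wedge_apply, ContinuousAlternatingMap.add_apply, altSum, add_mul, mul_add,
    Finset.sum_add_distrib]

theorem wedge_add_right (a : V [⋀^Fin k]→L[ℝ] ℝ) (b b' : V [⋀^Fin l]→L[ℝ] ℝ) :
    wedge a (b + b') = wedge a b + wedge a b' := by
  ext v
  simp only [wedge_apply, ContinuousAlternatingMap.add_apply, altSum, mul_add,
    Finset.sum_add_distrib]

theorem wedge_smul_left (c : ℝ) (a : V [⋀^Fin k]→L[ℝ] ℝ) (b : V [⋀^Fin l]→L[ℝ] ℝ) :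
    wedge (c • a) b = c • wedge a b := by
  ext v
  simp only [wedge_apply, ContinuousAlternatingMap.smul_apply, altSum, smul_eq_mul, Finset.mul_sum]
  exact Finset.sum_congr rfl fun _ _ => by ring

theorem wedge_smul_right (c : ℝ) (a : V [⋀^Fin k]→L[ℝ] ℝ) (b : V [⋀^Fin l]→L[ℝ] ℝ) :
    wedge a (c • b) = c • wedge a b := by
  ext v
  simp only [wedge_apply, ContinuousAlternatingMap.smul_apply, altSum, smul_eq_mul, Finset.mul_sum]
  exact Finset.sum_congr rfl fun _ _ => by ring

theorem wedge_comp (a : V [⋀^Fin k]→L[ℝ] ℝ) (b : V [⋀^Fin l]→L[ℝ] ℝ) (g : W →L[ℝ] V) :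
    (wedge a b).compContinuousLinearMap g =
      wedge (a.compContinuousLinearMap g) (b.compContinuousLinearMap g) := by
  ext v
  simp only [wedge_apply, ContinuousAlternatingMap.compContinuousLinearMap_apply]
  rfl

end Wedge

section Calculus

variable {E : Type*} [NormedAddCommGroup E] [NormedSpace ℝ E] [FiniteDimensional ℝ E] {k l : ℕ}

instance finiteDimensional_alternating (k : ℕ) : FiniteDimensional ℝ (E [⋀^Fin k]→L[ℝ] ℝ) := by
  let g : (E [⋀^Fin k]→L[ℝ] ℝ) →ₗ[ℝ] MultilinearMap ℝ (fun _ : Fin k => E) ℝ :=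
    { toFun a := a.toContinuousMultilinearMap.toMultilinearMap
      map_add' _ _ := rfl
      map_smul' _ _ := rfl }
  refine FiniteDimensional.of_injective g fun a b h => ?_
  ext v
  exact congrArg (fun m : MultilinearMap ℝ (fun _ : Fin k => E) ℝ => m v) h

/-- The wedge product as a continuous bilinear map. -/
def wedgeL (E : Type*) [NormedAddCommGroup E] [NormedSpace ℝ E] [FiniteDimensional ℝ E]
    (k l : ℕ) : (E [⋀^Fin k]→L[ℝ] ℝ) →L[ℝ] (E [⋀^Fin l]→L[ℝ] ℝ) →L[ℝ] (E [⋀^Fin (k + l)]→L[ℝ] ℝ) :=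
  (LinearMap.mk₂ ℝ wedge wedge_add_left wedge_smul_left wedge_add_right
    wedge_smul_right).toContinuousBilinearMap

@[simp] theorem wedgeL_apply (a : E [⋀^Fin k]→L[ℝ] ℝ) (b : E [⋀^Fin l]→L[ℝ] ℝ) :
    wedgeL E k l a b = wedge a b := rfl

theorem alternatizeUncurryFin_eq_altSum (A : E →L[ℝ] E [⋀^Fin l]→L[ℝ] ℝ) (v : Fin (l + 1) → E) :
    ContinuousAlternatingMap.alternatizeUncurryFin A v =
      (l.factorial : ℝ)⁻¹ * altSum (fun u => A (u 0) (fun j => u j.succ)) v := by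
  set C := ContinuousAlternatingMap.alternatizeUncurryFin A with hC
  have h1 : altSum (fun u => C u) v = ((l + 1).factorial : ℝ) * C v := by
    have h (σ : Equiv.Perm (Fin (l + 1))) :
        ((Equiv.Perm.sign σ : ℤ) : ℝ) * C (fun i => v (σ i)) = C v := by
      have := C.toAlternatingMap.map_perm v σ
      change C (fun i => v (σ i)) = Equiv.Perm.sign σ • C v at this
      rw [this, Units.smul_def, zsmul_eq_mul, ← mul_assoc, ← Int.cast_mul, ← Units.val_mul,
        Int.units_mul_self]
      simp
    simp [altSum, h, Fintype.card_perm]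
  have h2 : altSum (fun u => C u) v =
      ((l : ℝ) + 1) * altSum (fun u => A (u 0) (fun j => u j.succ)) v := by
    have h (i : Fin (l + 1)) : (-1 : ℝ) ^ (i : ℕ) * altSum (fun u => A (u i) (i.removeNth u)) v =
        altSum (fun u => A (u 0) (fun j => u j.succ)) v := by
      have := altSum_perm (fun u => A (u 0) (fun j => u j.succ)) i.cycleRange.symm v
      simp only [Fin.cycleRange_symm_zero, Fin.cycleRange_symm_succ, Equiv.Perm.sign_symm,
        Fin.sign_cycleRange] at this
      have h' : altSum (fun u => A (u i) (i.removeNth u)) v =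
        altSum (fun u => A (u i) (fun j => u (i.succAbove j))) v := rfl
      rw [h', this, ← mul_assoc]
      push_cast
      rw [← mul_pow]; simp
    have h3 : altSum (fun u => C u) v =
        ∑ i : Fin (l + 1), (-1 : ℝ) ^ (i : ℕ) * altSum (fun u => A (u i) (i.removeNth u)) v := by
      simp only [altSum, hC, ContinuousAlternatingMap.alternatizeUncurryFin_apply, Finset.mul_sum]
      rw [Finset.sum_comm]
      refine Finset.sum_congr rfl fun i _ => Finset.sum_congr rfl fun σ _ => ?_
      simp only [zsmul_eq_mul]
      push_cast
      rw [← mul_assoc, ← mul_assoc, mul_comm ((-1 : ℝ) ^ (i : ℕ))]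
    rw [h3]
    simp [h]
  rw [h1, Nat.factorial_succ] at h2
  push_cast at h2
  have : (l.factorial : ℝ) ≠ 0 := by positivity
  have : (l : ℝ) + 1 ≠ 0 := by positivity
  field_simp
  refine mul_left_cancel₀ this ?_
  linarith

theorem alternatizeUncurryFin_wedge_left (A : E →L[ℝ] E [⋀^Fin k]→L[ℝ] ℝ)
    (b : E [⋀^Fin l]→L[ℝ] ℝ) (A' : E →L[ℝ] E [⋀^Fin (k + l)]→L[ℝ] ℝ)
    (hA' : ∀ x, A' x = wedge (A x) b) (v : Fin (k + l + 1) → E) :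
    ContinuousAlternatingMap.alternatizeUncurryFin A' v =
      wedge (ContinuousAlternatingMap.alternatizeUncurryFin A) b
        (fun i => v (Fin.cast (by omega) i)) := by
  have e1 := altSum_nested (fun u : Fin (k + l + 1) → E =>
      A (u 0) (fun i => u (Fin.castAdd l i).succ) * b (fun j => u (Fin.natAdd k j).succ))
      (fun τ : Equiv.Perm (Fin (k + l)) => Equiv.Perm.decomposeFin.symm (0, τ))
      (fun τ => by simp) v
  have e2 := altSum_nested (fun u : Fin (k + 1 + l) → E =>
      A (u (Fin.castAdd l 0)) (fun i => u (Fin.castAdd l i.succ)) *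
        b (fun j => u (Fin.natAdd (k + 1) j)))
      (permL l) sign_permL (fun i => v (Fin.cast (by omega) i))
  have h1 : (fun u : Fin (k + l + 1) → E => A' (u 0) (fun j => u j.succ)) = fun u =>
      ((k.factorial : ℝ) * l.factorial)⁻¹ * ∑ τ : Equiv.Perm (Fin (k + l)),
      (Equiv.Perm.sign τ : ℝ) * (A (u (Equiv.Perm.decomposeFin.symm (0, τ) 0))
        (fun i => u (Equiv.Perm.decomposeFin.symm (0, τ) (Fin.castAdd l i).succ)) *
        b (fun j => u (Equiv.Perm.decomposeFin.symm (0, τ) (Fin.natAdd k j).succ))) := by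
    funext u
    simp [hA', wedge_apply, altSum]
  have h2 : (fun u : Fin (k + 1 + l) → E =>
      ContinuousAlternatingMap.alternatizeUncurryFin A (fun i => u (Fin.castAdd l i)) *
      b (fun j => u (Fin.natAdd (k + 1) j))) = fun u =>
      (k.factorial : ℝ)⁻¹ * ∑ τ : Equiv.Perm (Fin (k + 1)), (Equiv.Perm.sign τ : ℝ) *
      (A (u (permL l τ (Fin.castAdd l 0))) (fun i => u (permL l τ (Fin.castAdd l i.succ))) *
        b (fun j => u (permL l τ (Fin.natAdd (k + 1) j)))) := by
    funext u
    simp only [alternatizeUncurryFin_eq_altSum, altSum, permL_castAdd, permL_natAdd, mul_assoc,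
      Finset.sum_mul]
  rw [alternatizeUncurryFin_eq_altSum, wedge_apply, h1, h2, altSum_const_mul, altSum_const_mul,
    e1, e2, altSum_cast]
  have h3 (i : Fin k) : Fin.cast (by omega : k + 1 + l = k + l + 1) (Fin.castAdd l i.succ) =
    (Fin.castAdd l i).succ := by ext; simp
  have h4 (j : Fin l) : Fin.cast (by omega : k + 1 + l = k + l + 1) (Fin.natAdd (k + 1) j) =
    (Fin.natAdd k j).succ := by ext; simp; omega
  have h5 : Fin.cast (by omega : k + 1 + l = k + l + 1) (Fin.castAdd l 0) = 0 := by ext; simp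
  simp only [h3, h4, h5]
  have : ((k + l).factorial : ℝ) ≠ 0 := by positivity
  have : ((k + 1).factorial : ℝ) ≠ 0 := by positivity
  field_simp

theorem alternatizeUncurryFin_wedge_right (a : E [⋀^Fin k]→L[ℝ] ℝ)
    (B : E →L[ℝ] E [⋀^Fin l]→L[ℝ] ℝ) (B' : E →L[ℝ] E [⋀^Fin (k + l)]→L[ℝ] ℝ)
    (hB' : ∀ x, B' x = wedge a (B x)) (v : Fin (k + l + 1) → E) :
    ContinuousAlternatingMap.alternatizeUncurryFin B' v =
      (-1) ^ k * wedge a (ContinuousAlternatingMap.alternatizeUncurryFin B) v := by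
  have e1 := altSum_nested (fun u : Fin (k + l + 1) → E =>
      a (fun i => u (Fin.castAdd l i).succ) * B (u 0) (fun j => u (Fin.natAdd k j).succ))
      (fun τ : Equiv.Perm (Fin (k + l)) => Equiv.Perm.decomposeFin.symm (0, τ))
      (fun τ => by simp) v
  have e2 := altSum_nested (fun u : Fin (k + (l + 1)) → E =>
      a (fun i => u (Fin.castAdd (l + 1) i)) * B (u (Fin.natAdd k 0))
        (fun j => u (Fin.natAdd k j.succ)))
      (permR k) sign_permR v
  have h1 : (fun u : Fin (k + l + 1) → E => B' (u 0) (fun j => u j.succ)) = fun u =>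
      ((k.factorial : ℝ) * l.factorial)⁻¹ * ∑ τ : Equiv.Perm (Fin (k + l)),
      (Equiv.Perm.sign τ : ℝ) *
        (a (fun i => u (Equiv.Perm.decomposeFin.symm (0, τ) (Fin.castAdd l i).succ)) *
        B (u (Equiv.Perm.decomposeFin.symm (0, τ) 0))
        (fun j => u (Equiv.Perm.decomposeFin.symm (0, τ) (Fin.natAdd k j).succ))) := by
    funext u
    simp [hB', wedge_apply, altSum]
  have h2 : (fun u : Fin (k + (l + 1)) → E => a (fun i => u (Fin.castAdd (l + 1) i)) *
      ContinuousAlternatingMap.alternatizeUncurryFin B (fun j => u (Fin.natAdd k j))) = fun u =>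
      (l.factorial : ℝ)⁻¹ * ∑ τ : Equiv.Perm (Fin (l + 1)), (Equiv.Perm.sign τ : ℝ) *
      (a (fun i => u (permR k τ (Fin.castAdd (l + 1) i))) *
        B (u (permR k τ (Fin.natAdd k 0))) (fun j => u (permR k τ (Fin.natAdd k j.succ)))) := by
    funext u
    simp only [alternatizeUncurryFin_eq_altSum, altSum, permR_castAdd, permR_natAdd,
      Finset.mul_sum]
    refine Finset.sum_congr rfl fun σ _ => ?_
    ring
  have e3 := altSum_perm (fun u : Fin (k + (l + 1)) → E =>
      a (fun i => u (Fin.castAdd (l + 1) i)) * B (u (Fin.natAdd k 0))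
        (fun j => u (Fin.natAdd k j.succ)))
      (Fin.cycleRange (⟨k, by omega⟩ : Fin (k + l + 1))) v
  have h3 (i : Fin k) : Fin.cycleRange (⟨k, by omega⟩ : Fin (k + l + 1))
      (Fin.castAdd (l + 1) i) = (Fin.castAdd l i).succ := by
    ext
    rw [Fin.coe_cycleRange_of_lt]
    · simp
    · simp [Fin.lt_def]
  have h4 : Fin.cycleRange (⟨k, by omega⟩ : Fin (k + l + 1)) (Fin.natAdd k (0 : Fin (l + 1))) = 0 :=
    Fin.cycleRange_self _
  have h5 (j : Fin l) : Fin.cycleRange (⟨k, by omega⟩ : Fin (k + l + 1))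
      (Fin.natAdd k j.succ) = (Fin.natAdd k j).succ := by
    rw [Fin.cycleRange_of_gt]
    · rfl
    · simp [Fin.lt_def]
  rw [Fin.sign_cycleRange] at e3
  have e3' : altSum (fun u : Fin (k + l + 1) → E =>
      a (fun i => u (Fin.castAdd l i).succ) * B (u 0) (fun j => u (Fin.natAdd k j).succ)) v =
      (-1) ^ k * altSum (fun u : Fin (k + (l + 1)) → E =>
      a (fun i => u (Fin.castAdd (l + 1) i)) * B (u (Fin.natAdd k 0))
        (fun j => u (Fin.natAdd k j.succ))) v := by
    have h6 : (((-1 : ℤˣ) ^ k : ℤˣ) : ℤ) = (-1 : ℤ) ^ k := by simp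
    have h7 : (fun u : Fin (k + l + 1) → E =>
      a (fun i => u (Fin.castAdd l i).succ) * B (u 0) (fun j => u (Fin.natAdd k j).succ)) =
      (fun u => a (fun i => u (Fin.cycleRange (⟨k, by omega⟩ : Fin (k + l + 1))
        (Fin.castAdd (l + 1) i))) *
        B (u (Fin.cycleRange (⟨k, by omega⟩ : Fin (k + l + 1)) (Fin.natAdd k (0 : Fin (l + 1)))))
        (fun j => u (Fin.cycleRange (⟨k, by omega⟩ : Fin (k + l + 1)) (Fin.natAdd k j.succ)))) := by
      funext u
      simp only [h3, h4, h5]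
    rw [h7]
    refine Eq.trans e3 ?_
    rw [h6]
    push_cast
    rfl
  rw [alternatizeUncurryFin_eq_altSum, wedge_apply, h1, h2, altSum_const_mul, e1, e3']
  have h8 := altSum_const_mul (l.factorial : ℝ)⁻¹ (fun u : Fin (k + (l + 1)) → E =>
    ∑ τ : Equiv.Perm (Fin (l + 1)), (Equiv.Perm.sign τ : ℝ) *
      (a (fun i => u (permR k τ (Fin.castAdd (l + 1) i))) *
        B (u (permR k τ (Fin.natAdd k 0))) (fun j => u (permR k τ (Fin.natAdd k j.succ))))) v
  rw [e2] at h8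
  rw [h8]
  have : ((k + l).factorial : ℝ) ≠ 0 := by positivity
  have : ((l + 1).factorial : ℝ) ≠ 0 := by positivity
  field_simp

/-- The graded Leibniz rule for the exterior derivative on a normed space. -/
theorem extDeriv_wedge {α : E → E [⋀^Fin k]→L[ℝ] ℝ} {β : E → E [⋀^Fin l]→L[ℝ] ℝ} {x : E}
    (hα : DifferentiableAt ℝ α x) (hβ : DifferentiableAt ℝ β x) (v : Fin (k + l + 1) → E) :
    extDeriv (fun y => wedge (α y) (β y)) x v =
      wedge (extDeriv α x) (β x) (fun i => v (Fin.cast (by omega) i)) +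
        (-1) ^ k * wedge (α x) (extDeriv β x) v := by
  have h := (wedgeL E k l).fderiv_of_bilinear hα hβ
  simp only [wedgeL_apply] at h
  unfold extDeriv
  rw [h, ContinuousAlternatingMap.alternatizeUncurryFin_add, ContinuousAlternatingMap.add_apply,
    alternatizeUncurryFin_wedge_left (fderiv ℝ α x) (β x)
      ((wedgeL E k l).precompL E (fderiv ℝ α x) (β x)) (fun y => by rfl),
    alternatizeUncurryFin_wedge_right (α x) (fderiv ℝ β x)
      ((wedgeL E k l).precompR E (α x) (fderiv ℝ β x)) (fun y => by rfl)]
  exact add_comm _ _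

end Calculus

section Forms

variable {E : Type*} [NormedAddCommGroup E] [NormedSpace ℝ E] {M : Type*} [TopologicalSpace M]
  [ChartedSpace E M] {k l m : ℕ}

/-- The expression of a field of alternating forms on the tangent spaces of `M` in the chart
around `c`, i.e. its pullback under the inverse of this chart. -/
def chartRep (c : M) (α : ∀ x : M, TangentSpace 𝓘(ℝ, E) x [⋀^Fin k]→L[ℝ] ℝ) (y : E) :
    E [⋀^Fin k]→L[ℝ] ℝ :=
  (α ((chartAt E c).symm y)).compContinuousLinearMap
    (mfderiv 𝓘(ℝ, E) 𝓘(ℝ, E) (chartAt E c).symm y)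

variable (E M k) in
/-- The space `Ω^k(M)` of smooth differential `k`-forms on a manifold `M` modelled on `E`. -/
def Form : Submodule ℝ (∀ x : M, TangentSpace 𝓘(ℝ, E) x [⋀^Fin k]→L[ℝ] ℝ) where
  carrier := {α | ∀ c : M, ContDiffOn ℝ ∞ (chartRep c α) (chartAt E c).target}
  add_mem' hα hβ c := (hα c).add (hβ c)
  zero_mem' _ := contDiffOn_const (c := 0)
  smul_mem' r _ hα c := (hα c).const_smul r

instance : AddCommGroup (Form E M k) := Submodule.addCommGroup _

instance : AddCommMonoid (Form E M k) := AddCommGroup.toAddCommMonoid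

instance : Module ℝ (Form E M k) := Submodule.module _

theorem chartRep_add (c : M) (α β : ∀ x : M, TangentSpace 𝓘(ℝ, E) x [⋀^Fin k]→L[ℝ] ℝ) :
    chartRep c (α + β) = chartRep c α + chartRep c β := rfl

theorem chartRep_smul (c : M) (r : ℝ) (α : ∀ x : M, TangentSpace 𝓘(ℝ, E) x [⋀^Fin k]→L[ℝ] ℝ) :
    chartRep c (r • α) = r • chartRep c α := rfl

variable [IsManifold 𝓘(ℝ, E) ∞ M]

theorem chart_symm_deriv (x : M) {w : M} (hw : w ∈ (chartAt E x).source) (v : E) :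
    mfderiv 𝓘(ℝ, E) 𝓘(ℝ, E) (chartAt E x).symm (chartAt E x w)
      (mfderiv 𝓘(ℝ, E) 𝓘(ℝ, E) (chartAt E x) w v) = v := by
  have : IsManifold 𝓘(ℝ, E) 1 M := IsManifold.of_le (n := ∞) (by norm_num)
  have h := (mdifferentiable_chart (I := 𝓘(ℝ, E)) x).symm_comp_deriv hw
  exact congrArg (fun f : E →L[ℝ] E => f v) h

/-- Coordinate expressions in different charts are related by pullback under the change of
coordinates. -/
theorem chartRep_change (α : ∀ x : M, TangentSpace 𝓘(ℝ, E) x [⋀^Fin k]→L[ℝ] ℝ) (c x : M) {z : E}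
    (hz : z ∈ (chartAt E c).target) (hz' : (chartAt E c).symm z ∈ (chartAt E x).source) :
    ContDiffAt ℝ ∞ (chartAt E x ∘ (chartAt E c).symm) z ∧
    fderiv ℝ (chartAt E x ∘ (chartAt E c).symm) z =
      (mfderiv 𝓘(ℝ, E) 𝓘(ℝ, E) (chartAt E x) ((chartAt E c).symm z)).comp
        (mfderiv 𝓘(ℝ, E) 𝓘(ℝ, E) (chartAt E c).symm z) ∧
    chartRep c α z = (chartRep x α ((chartAt E x ∘ (chartAt E c).symm) z)).compContinuousLinearMap
      (fderiv ℝ (chartAt E x ∘ (chartAt E c).symm) z) := by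
  have : IsManifold 𝓘(ℝ, E) 1 M := IsManifold.of_le (n := ∞) (by norm_num)
  have h1 : ContMDiffAt 𝓘(ℝ, E) 𝓘(ℝ, E) ∞ (chartAt E c).symm z :=
    (contMDiffOn_chart_symm (I := 𝓘(ℝ, E))).contMDiffAt ((chartAt E c).open_target.mem_nhds hz)
  have h2 : ContMDiffAt 𝓘(ℝ, E) 𝓘(ℝ, E) ∞ (chartAt E x) ((chartAt E c).symm z) :=
    (contMDiffOn_chart (I := 𝓘(ℝ, E))).contMDiffAt ((chartAt E x).open_source.mem_nhds hz')
  have h3 : ContDiffAt ℝ ∞ (chartAt E x ∘ (chartAt E c).symm) z :=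
    contMDiffAt_iff_contDiffAt.1 (h2.comp z h1)
  have h4 : fderiv ℝ (chartAt E x ∘ (chartAt E c).symm) z =
      (mfderiv 𝓘(ℝ, E) 𝓘(ℝ, E) (chartAt E x) ((chartAt E c).symm z)).comp
        (mfderiv 𝓘(ℝ, E) 𝓘(ℝ, E) (chartAt E c).symm z) := by
    rw [← mfderiv_eq_fderiv]
    exact mfderiv_comp z (h2.mdifferentiableAt (by simp)) (h1.mdifferentiableAt (by simp))
  refine ⟨h3, h4, ?_⟩
  ext v
  have h5 : (chartAt E x).symm (chartAt E x ((chartAt E c).symm z)) = (chartAt E c).symm z :=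
    (chartAt E x).left_inv hz'
  have h6 (u : Fin k → E) : (show E [⋀^Fin k]→L[ℝ] ℝ from
      α ((chartAt E x).symm (chartAt E x ((chartAt E c).symm z)))) u =
      (show E [⋀^Fin k]→L[ℝ] ℝ from α ((chartAt E c).symm z)) u := by
    have := congrArg (fun w => (show E [⋀^Fin k]→L[ℝ] ℝ from α w) u) h5
    exact this
  rw [h4]
  refine Eq.trans ?_ (h6 _).symm
  change (show E [⋀^Fin k]→L[ℝ] ℝ from α ((chartAt E c).symm z)) _ = _
  congr 1
  funext i
  exact (chart_symm_deriv x hz' _).symm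

/-- The exterior derivative of a differential form at `x`, computed in the chart around `x`. -/
def extDFun (α : ∀ x : M, TangentSpace 𝓘(ℝ, E) x [⋀^Fin k]→L[ℝ] ℝ) (x : M) :
    TangentSpace 𝓘(ℝ, E) x [⋀^Fin (k + 1)]→L[ℝ] ℝ :=
  (extDeriv (chartRep x α) (chartAt E x x)).compContinuousLinearMap
    (show TangentSpace 𝓘(ℝ, E) x →L[ℝ] E from mfderiv 𝓘(ℝ, E) 𝓘(ℝ, E) (chartAt E x) x)

theorem two_le_smooth : minSmoothness ℝ 2 ≤ (∞ : WithTop ℕ∞) := by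
  rw [minSmoothness_of_isRCLikeNormedField]
  exact WithTop.coe_le_coe.2 (le_top : (2 : ℕ∞) ≤ ⊤)

/-- The exterior derivative is given in any chart by the exterior derivative of the coordinate
expression. -/
theorem chartRep_extDFun (α : Form E M k) (c : M) {y : E} (hy : y ∈ (chartAt E c).target) :
    chartRep c (extDFun α.1) y = extDeriv (chartRep c α.1) y := by
  set x := (chartAt E c).symm y with hx
  have hxs : x ∈ (chartAt E x).source := mem_chart_source E x
  obtain ⟨h1, h2, -⟩ := chartRep_change α.1 c x hy hxs
  have h3 : chartRep c α.1 =ᶠ[nhds y] fun z =>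
      (chartRep x α.1 ((chartAt E x ∘ (chartAt E c).symm) z)).compContinuousLinearMap
      (fderiv ℝ (chartAt E x ∘ (chartAt E c).symm) z) := by
    have hc : ContinuousAt (chartAt E c).symm y := (chartAt E c).continuousAt_symm hy
    filter_upwards [(chartAt E c).open_target.mem_nhds hy,
      hc.preimage_mem_nhds ((chartAt E x).open_source.mem_nhds hxs)] with z hz hz'
    exact (chartRep_change α.1 c x hz hz').2.2
  rw [h3.extDeriv_eq, extDeriv_pullback (r := ∞) _ h1 two_le_smooth, h2]
  · rfl
  · refine ((α.2 x).contDiffAt ?_).differentiableAt (by simp)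
    exact (chartAt E x).open_target.mem_nhds (mem_chart_target E x)

theorem contDiffOn_extDeriv {s : Set E} (hs : IsOpen s) {f : E → E [⋀^Fin k]→L[ℝ] ℝ}
    (hf : ContDiffOn ℝ ∞ f s) : ContDiffOn ℝ ∞ (extDeriv f) s := by
  have h : ContDiffOn ℝ ∞ (fderiv ℝ f) s := hf.fderiv_of_isOpen hs (by simp)
  exact (ContinuousAlternatingMap.alternatizeUncurryFinCLM ℝ E ℝ).contDiff.comp_contDiffOn h

theorem differentiableAt_chartRep (α : Form E M k) (c : M) {y : E}
    (hy : y ∈ (chartAt E c).target) : DifferentiableAt ℝ (chartRep c α.1) y :=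
  ((α.2 c).contDiffAt ((chartAt E c).open_target.mem_nhds hy)).differentiableAt (by simp)

/-- The exterior derivative `d : Ω^k(M) → Ω^{k+1}(M)`. -/
def extD : Form E M k →ₗ[ℝ] Form E M (k + 1) where
  toFun α := ⟨extDFun α.1, fun c =>
    (contDiffOn_extDeriv (chartAt E c).open_target (α.2 c)).congr
      fun _ hy => chartRep_extDFun α c hy⟩
  map_add' α β := by
    ext x v
    change extDeriv (chartRep x (α.1 + β.1)) (chartAt E x x) (fun i =>
      (show TangentSpace 𝓘(ℝ, E) x →L[ℝ] E from mfderiv 𝓘(ℝ, E) 𝓘(ℝ, E) (chartAt E x) x) (v i)) = _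
    rw [chartRep_add, extDeriv_add (differentiableAt_chartRep α x (mem_chart_target E x))
      (differentiableAt_chartRep β x (mem_chart_target E x))]
    rfl
  map_smul' r α := by
    ext x v
    change extDeriv (chartRep x (r • α.1)) (chartAt E x x) (fun i =>
      (show TangentSpace 𝓘(ℝ, E) x →L[ℝ] E from mfderiv 𝓘(ℝ, E) 𝓘(ℝ, E) (chartAt E x) x) (v i)) = _
    rw [chartRep_smul, extDeriv_smul]
    rfl

/-- A field of alternating forms is determined by its coordinate expressions. -/
theorem apply_eq_chartRep (α : ∀ x : M, TangentSpace 𝓘(ℝ, E) x [⋀^Fin k]→L[ℝ] ℝ) (x : M)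
    (v : Fin k → TangentSpace 𝓘(ℝ, E) x) :
    α x v = chartRep x α (chartAt E x x)
      (fun i => (show E from mfderiv 𝓘(ℝ, E) 𝓘(ℝ, E) (chartAt E x) x (v i))) := by
  have h5 : (chartAt E x).symm (chartAt E x x) = x :=
    (chartAt E x).left_inv (mem_chart_source E x)
  have h6 (u : Fin k → E) : (show E [⋀^Fin k]→L[ℝ] ℝ from
      α ((chartAt E x).symm (chartAt E x x))) u = (show E [⋀^Fin k]→L[ℝ] ℝ from α x) u := by
    have := congrArg (fun w => (show E [⋀^Fin k]→L[ℝ] ℝ from α w) u) h5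
    exact this
  refine Eq.trans ?_ (h6 _).symm
  change (show E [⋀^Fin k]→L[ℝ] ℝ from α x) _ = _
  congr 1
  funext i
  exact (chart_symm_deriv x (mem_chart_source E x) _).symm

theorem extD_extD (α : Form E M k) : extD (extD α) = 0 := by
  ext x v
  rw [apply_eq_chartRep]
  have hy := mem_chart_target E x
  have h : chartRep x (extD (extD α)).1 (chartAt E x x) = 0 := by
    refine (chartRep_extDFun (extD α) x hy).trans ?_
    have h3 : chartRep x (extD α).1 =ᶠ[nhds (chartAt E x x)] extDeriv (chartRep x α.1) := by
      filter_upwards [(chartAt E x).open_target.mem_nhds hy] with z hz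
      exact chartRep_extDFun α x hz
    rw [h3.extDeriv_eq]
    exact extDeriv_extDeriv_apply (r := ∞)
      ((α.2 x).contDiffAt ((chartAt E x).open_target.mem_nhds hy)) two_le_smooth
  rw [h]
  rfl

variable [FiniteDimensional ℝ E]

theorem chartRep_wedge (c : M) (α : ∀ x : M, TangentSpace 𝓘(ℝ, E) x [⋀^Fin k]→L[ℝ] ℝ)
    (β : ∀ x : M, TangentSpace 𝓘(ℝ, E) x [⋀^Fin l]→L[ℝ] ℝ) (y : E) :
    chartRep c (fun x => wedge (α x) (β x)) y = wedge (chartRep c α y) (chartRep c β y) :=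
  wedge_comp _ _ _

/-- The wedge product `α ∧ β` of differential forms, as a linear map in `β`. -/
def wedgeForm (α : Form E M k) : Form E M l →ₗ[ℝ] Form E M (k + l) where
  toFun β := ⟨fun x => wedge (α.1 x) (β.1 x), fun c => by
    have h : chartRep c (fun x => wedge (α.1 x) (β.1 x)) =
        fun y => wedgeL E k l (chartRep c α.1 y) (chartRep c β.1 y) := by
      funext y; exact chartRep_wedge c _ _ y
    rw [h]
    exact (wedgeL E k l).isBoundedBilinearMap.contDiff.comp₂_contDiffOn (α.2 c) (β.2 c)⟩
  map_add' β β' := Subtype.ext (funext fun x => wedge_add_right _ _ _)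
  map_smul' r β := Subtype.ext (funext fun x => wedge_smul_right _ _ _)

/-- The graded Leibniz rule `d(α ∧ β) = dα ∧ β + (-1)^k α ∧ dβ`. -/
theorem extD_wedge (α : Form E M k) (β : Form E M l) (x : M)
    (v : Fin (k + l + 1) → TangentSpace 𝓘(ℝ, E) x) :
    (extD (wedgeForm α β)).1 x v = (wedgeForm (extD α) β).1 x (fun i => v (Fin.cast (by omega) i)) +
      (-1) ^ k * (wedgeForm α (extD β)).1 x v := by
  have hy := mem_chart_target E x
  have h1 : chartRep x (extD (wedgeForm α β)).1 (chartAt E x x) =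
      extDeriv (fun y => wedge (chartRep x α.1 y) (chartRep x β.1 y)) (chartAt E x x) := by
    refine (chartRep_extDFun (wedgeForm α β) x hy).trans ?_
    have h : chartRep x (wedgeForm α β).1 =
      fun y => wedge (chartRep x α.1 y) (chartRep x β.1 y) := funext (chartRep_wedge x α.1 β.1)
    rw [h]
  have h2 : chartRep x (wedgeForm (extD α) β).1 (chartAt E x x) =
      wedge (extDeriv (chartRep x α.1) (chartAt E x x)) (chartRep x β.1 (chartAt E x x)) :=
    (chartRep_wedge x (extD α).1 β.1 _).trans (by rw [← chartRep_extDFun α x hy]; rfl)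
  have h3 : chartRep x (wedgeForm α (extD β)).1 (chartAt E x x) =
      wedge (chartRep x α.1 (chartAt E x x)) (extDeriv (chartRep x β.1) (chartAt E x x)) :=
    (chartRep_wedge x α.1 (extD β).1 _).trans (by rw [← chartRep_extDFun β x hy]; rfl)
  have e2 := apply_eq_chartRep (wedgeForm (extD α) β).1 x (fun i => v (Fin.cast (by omega) i))
  have e3 := apply_eq_chartRep (wedgeForm α (extD β)).1 x v
  rw [h2] at e2
  rw [h3] at e3
  refine ((apply_eq_chartRep (extD (wedgeForm α β)).1 x v).trans ?_)
  rw [h1]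
  refine (extDeriv_wedge (differentiableAt_chartRep α x hy) (differentiableAt_chartRep β x hy)
    _).trans ?_
  rw [e2, e3]
  rfl

end Forms

section Total

variable {E : Type*} [NormedAddCommGroup E] [NormedSpace ℝ E] [FiniteDimensional ℝ E]
  {M : Type*} [TopologicalSpace M] [ChartedSpace E M] [IsManifold 𝓘(ℝ, E) ∞ M] {k l m : ℕ}

open DirectSum

variable (E M) in
/-- The graded vector space `Ω^*(M) = ⨁_k Ω^k(M)` of all differential forms. -/
abbrev TotalForm : Type _ := ⨁ k : ℕ, Form E M k

/-- A homogeneous form, viewed in `Ω^*(M)`. -/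
abbrev tot (k : ℕ) : Form E M k →ₗ[ℝ] TotalForm E M := DirectSum.lof ℝ ℕ (fun k => Form E M k) k

/-- The twisted differential `α ↦ dα + θ ∧ α` on `Ω^*(M)`. -/
def twistedD (θ : Form E M 1) : TotalForm E M →ₗ[ℝ] TotalForm E M :=
  DirectSum.toModule ℝ ℕ _ fun k => tot (k + 1) ∘ₗ extD + tot (1 + k) ∘ₗ wedgeForm θ

/-- The Lefschetz operator `α ↦ ω ∧ α` on `Ω^*(M)`. -/
def lefschetz (ω₀ : Form E M 2) : TotalForm E M →ₗ[ℝ] TotalForm E M :=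
  DirectSum.toModule ℝ ℕ _ fun k => tot (2 + k) ∘ₗ wedgeForm ω₀

variable (E M) in
/-- The subspace `Ω^j(M)` of `Ω^*(M)`, for an integer `j`; it is zero for `j < 0`. -/
def degreePart (j : ℤ) : Submodule ℝ (TotalForm E M) where
  carrier := {x | ∀ i : ℕ, (i : ℤ) ≠ j → x i = 0}
  add_mem' hx hy i hi := by rw [DirectSum.add_apply, hx i hi, hy i hi, add_zero]
  zero_mem' i _ := rfl
  smul_mem' r x hx i hi := by rw [DirectSum.smul_apply, hx i hi, smul_zero]

@[simp] theorem twistedD_tot (θ : Form E M 1) (α : Form E M k) :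
    twistedD θ (tot k α) = tot (k + 1) (extD α) + tot (1 + k) (wedgeForm θ α) := by
  simp [twistedD, tot]

@[simp] theorem lefschetz_tot (ω₀ : Form E M 2) (α : Form E M k) :
    lefschetz ω₀ (tot k α) = tot (2 + k) (wedgeForm ω₀ α) := by
  simp [lefschetz, tot]

theorem tot_congr {i j : ℕ} (h : j = i) (α : Form E M i) (β : Form E M j)
    (hαβ : ∀ x (v : Fin i → TangentSpace 𝓘(ℝ, E) x),
      α.1 x v = β.1 x (fun a => v (Fin.cast h a))) : tot i α = tot j β := by
  subst h
  congr 1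
  ext x v
  exact hαβ x v

theorem tot_wedge_assoc (α : Form E M k) (β : Form E M l) (γ : Form E M m) :
    tot (k + l + m) (wedgeForm (wedgeForm α β) γ) =
      tot (k + (l + m)) (wedgeForm α (wedgeForm β γ)) := by
  symm
  refine tot_congr (add_assoc k l m) _ _ fun x v => ?_
  exact (wedge_assoc (α.1 x) (β.1 x) (γ.1 x) v).symm

theorem tot_extD_wedge (α : Form E M k) (β : Form E M l) :
    tot (k + l + 1) (extD (wedgeForm α β)) =
      tot (k + 1 + l) (wedgeForm (extD α) β) +
        (-1 : ℝ) ^ k • tot (k + (l + 1)) (wedgeForm α (extD β)) := by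
  have h : tot (k + 1 + l) (wedgeForm (extD α) β) =
      tot (k + (l + 1)) (extD (wedgeForm α β) +
        (-(-1 : ℝ) ^ k) • (wedgeForm α (extD β) : Form E M (k + (l + 1)))) := by
    symm
    refine tot_congr (by omega) _ _ fun x v => ?_
    have := extD_wedge α β x v
    change (extD (wedgeForm α β)).1 x v + (-(-1) ^ k) * (wedgeForm α (extD β)).1 x v = _
    rw [this]
    ring
  have key (a b y : TotalForm E M) (r : ℝ) (hb : b = a + (-r) • y) : a = b + r • y := by
    rw [hb, add_assoc, ← add_smul, neg_add_cancel, zero_smul, add_zero]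
  exact key _ _ _ _ (h.trans (by rw [map_add, map_smul]; rfl))

theorem wedgeForm_one_self (θ : Form E M 1) : wedgeForm θ θ = 0 :=
  Subtype.ext (funext fun x => wedge_one_self (θ.1 x))

theorem wedgeForm_one_two (θ : Form E M 1) (ω₀ : Form E M 2) :
    (show Form E M (2 + 1) from wedgeForm θ ω₀) = wedgeForm ω₀ θ := by
  ext x v
  have := wedge_one_comm (θ.1 x) (ω₀.1 x) v
  rw [neg_one_sq, one_mul] at this
  exact this

@[simp] theorem wedgeForm_zero_left (β : Form E M l) : wedgeForm (0 : Form E M k) β = 0 := by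
  ext x v
  have := wedge_smul_left 0 ((0 : Form E M k).1 x) (β.1 x)
  rw [zero_smul, zero_smul] at this
  exact congrArg (fun f => f v) this

theorem wedgeForm_add_left (α α' : Form E M k) (β : Form E M l) :
    wedgeForm (α + α') β = wedgeForm α β + wedgeForm α' β :=
  Subtype.ext (funext fun x => wedge_add_left (α.1 x) (α'.1 x) (β.1 x))

theorem wedgeForm_smul_left (r : ℝ) (α : Form E M k) (β : Form E M l) :
    wedgeForm (r • α) β = r • wedgeForm α β :=
  Subtype.ext (funext fun x => wedge_smul_left r (α.1 x) (β.1 x))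

theorem neg_one_smul_cancel (y : TotalForm E M) : y + (-1 : ℝ) • y = 0 := by
  have := add_smul (1 : ℝ) (-1) y
  rw [one_smul, add_neg_cancel, zero_smul] at this
  exact this.symm

/-- `d_θ² = 0` for a closed one-form `θ`. -/
theorem twistedD_twistedD (θ : Form E M 1) (hθ : extD θ = 0) (x : TotalForm E M) :
    twistedD θ (twistedD θ x) = 0 := by
  have h : twistedD θ ∘ₗ twistedD θ = 0 := by
    refine DirectSum.linearMap_ext ℝ fun k => LinearMap.ext fun α => ?_
    change twistedD θ (twistedD θ (tot k α)) = 0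
    have h1 := tot_extD_wedge θ α
    have h2 := tot_wedge_assoc θ θ α
    rw [hθ, wedgeForm_zero_left, map_zero, zero_add] at h1
    rw [wedgeForm_one_self, wedgeForm_zero_left, map_zero] at h2
    rw [twistedD_tot, map_add, twistedD_tot, twistedD_tot, h1, ← h2, extD_extD, map_zero, zero_add,
      add_zero, pow_one]
    exact neg_one_smul_cancel _
  exact congrArg (fun f => f x) h

/-- `d_{η + θ} L = L d_η` if `dω = - ω ∧ θ`. -/
theorem twistedD_lefschetz (ω₀ : Form E M 2) (θ η : Form E M 1)
    (hω : extD ω₀ = -wedgeForm ω₀ θ) (x : TotalForm E M) :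
    twistedD (η + θ) (lefschetz ω₀ x) = lefschetz ω₀ (twistedD η x) := by
  have h : twistedD (η + θ) ∘ₗ lefschetz ω₀ = lefschetz ω₀ ∘ₗ twistedD η := by
    refine DirectSum.linearMap_ext ℝ fun k => LinearMap.ext fun α => ?_
    change twistedD (η + θ) (lefschetz ω₀ (tot k α)) = lefschetz ω₀ (twistedD η (tot k α))
    have h1 := tot_extD_wedge ω₀ α
    have h4 (ζ : Form E M 1) : tot (1 + (2 + k)) (wedgeForm ζ (wedgeForm ω₀ α)) =
        tot (2 + (1 + k)) (wedgeForm ω₀ (wedgeForm ζ α)) := by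
      rw [← tot_wedge_assoc, ← tot_wedge_assoc, ← wedgeForm_one_two]
    have h6 : extD ω₀ = (-1 : ℝ) • wedgeForm ω₀ θ := 
      hω.trans (Subtype.ext (funext fun x => (neg_one_smul ℝ ((wedgeForm ω₀ θ).1 x)).symm))
    rw [h6, wedgeForm_smul_left, map_smul, tot_wedge_assoc, neg_one_sq, one_smul] at h1
    rw [lefschetz_tot, twistedD_tot, twistedD_tot, map_add, lefschetz_tot, lefschetz_tot, h1,
      wedgeForm_add_left, LinearMap.map_add, h4, h4]
    have h7 (y z u : TotalForm E M) : (-1 : ℝ) • y + z + (u + y) = z + u := by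
      rw [show (-1 : ℝ) • y + z + (u + y) = z + u + (y + (-1 : ℝ) • y) by abel,
        neg_one_smul_cancel, add_zero]
    exact h7 _ _ _
  exact congrArg (fun f => f x) h

end Total

section Filtered

open CategoryTheory

/-- A filtered cochain complex of real vector spaces, given as a graded vector space `K` with
homogeneous components `deg j`, a differential `d` of degree one and a decreasing filtration `F`
stable under `d`. -/
structure FilteredComplex (K : Type*) [AddCommGroup K] [Module ℝ K] where
  d : K →ₗ[ℝ] K
  deg : ℤ → Submodule ℝ K
  F : ℤ → Submodule ℝ K
  d_d : ∀ x, d (d x) = 0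
  d_deg : ∀ j, ∀ x ∈ deg j, d x ∈ deg (j + 1)
  F_anti : Antitone F
  d_F : ∀ p, ∀ x ∈ F p, d x ∈ F p

namespace FilteredComplex

universe u

variable {K : Type u} [AddCommGroup K] [Module ℝ K] (C : FilteredComplex K)

/-- `Z_r^{p,q} = F^p K^{p+q} ∩ d⁻¹(F^{p+r} K^{p+q+1})`. -/
def Z (r p q : ℤ) : Submodule ℝ K := C.F p ⊓ C.deg (p + q) ⊓ (C.F (p + r)).comap C.d

/-- `B_r^{p,q} = F^p K^{p+q} ∩ d(F^{p-r} K^{p+q-1})`. -/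
def B (r p q : ℤ) : Submodule ℝ K :=
  C.F p ⊓ C.deg (p + q) ⊓ (C.F (p - r) ⊓ C.deg (p + q - 1)).map C.d

/-- `E_r^{p,q} = Z_r^{p,q} / (Z_{r-1}^{p+1,q-1} + B_{r-1}^{p,q})`. -/
abbrev E (r p q : ℤ) : Type u :=
  C.Z r p q ⧸ (C.Z (r - 1) (p + 1) (q - 1) ⊔ C.B (r - 1) p q).submoduleOf (C.Z r p q)

variable {C} in
theorem mem_Z {r p q : ℤ} {x : K} :
    x ∈ C.Z r p q ↔ x ∈ C.F p ∧ x ∈ C.deg (p + q) ∧ C.d x ∈ C.F (p + r) := by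
  simp [Z, and_assoc]

variable {C} in
theorem mem_B {r p q : ℤ} {x : K} :
    x ∈ C.B r p q ↔ x ∈ C.F p ∧ x ∈ C.deg (p + q) ∧
      ∃ y ∈ C.F (p - r), y ∈ C.deg (p + q - 1) ∧ C.d y = x := by
  simp [B, and_assoc]

variable {p q p' q' r : ℤ}

theorem d_mem_Z (hp : p' = p + r) (hq : q' = q + 1 - r) (x : K) (hx : x ∈ C.Z r p q) :
    C.d x ∈ C.Z r p' q' := by
  obtain ⟨h1, h2, h3⟩ := mem_Z.1 hx
  refine mem_Z.2 ⟨hp ▸ h3, ?_, ?_⟩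
  · rw [show p' + q' = p + q + 1 by omega]
    exact C.d_deg _ _ h2
  · rw [C.d_d]; exact zero_mem _

theorem d_den (hp : p' = p + r) (hq : q' = q + 1 - r) (x : K)
    (hx : x ∈ C.Z (r - 1) (p + 1) (q - 1) ⊔ C.B (r - 1) p q) :
    C.d x ∈ C.Z (r - 1) (p' + 1) (q' - 1) ⊔ C.B (r - 1) p' q' := by
  obtain ⟨z, hz, b, hb, rfl⟩ := Submodule.mem_sup.1 hx
  obtain ⟨h1, h2, h3⟩ := mem_Z.1 hz
  obtain ⟨-, -, y, -, -, rfl⟩ := mem_B.1 hb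
  rw [map_add, C.d_d, add_zero]
  refine Submodule.mem_sup_right (mem_B.2 ⟨?_, ?_, z, ?_, ?_, rfl⟩)
  · rwa [show p' = p + 1 + (r - 1) by omega]
  · rw [show p' + q' = p + 1 + (q - 1) + 1 by omega]
    exact C.d_deg _ _ h2
  · rwa [show p' - (r - 1) = p + 1 by omega]
  · rwa [show p' + q' - 1 = p + 1 + (q - 1) by omega]

/-- The differential `d_r : E_r^{p,q} → E_r^{p+r,q-r+1}` induced by `d`. -/
def dE (hp : p' = p + r) (hq : q' = q + 1 - r) : C.E r p q →ₗ[ℝ] C.E r p' q' :=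
  Submodule.mapQ _ _ (C.d.restrict (C.d_mem_Z hp hq)) fun x hx => C.d_den hp hq x.1 hx

/-- The class in `E_r^{p,q}` of an element of `Z_r^{p,q}`. -/
def cls (r p q : ℤ) : C.Z r p q →ₗ[ℝ] C.E r p q := Submodule.mkQ _

theorem cls_eq_zero (x : C.Z r p q) :
    C.cls r p q x = 0 ↔ x.1 ∈ C.Z (r - 1) (p + 1) (q - 1) ⊔ C.B (r - 1) p q :=
  Submodule.Quotient.mk_eq_zero _

theorem dE_cls (hp : p' = p + r) (hq : q' = q + 1 - r) (x : C.Z r p q) :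
    C.dE hp hq (C.cls r p q x) = C.cls r p' q' ⟨C.d x, C.d_mem_Z hp hq _ x.2⟩ := rfl

theorem cls_surjective (r p q : ℤ) : Function.Surjective (C.cls r p q) := Submodule.mkQ_surjective _

theorem Z_succ_le (r p q : ℤ) : C.Z (r + 1) p q ≤ C.Z r p q := fun x hx => by
  obtain ⟨h1, h2, h3⟩ := mem_Z.1 hx
  exact mem_Z.2 ⟨h1, h2, C.F_anti (by omega) h3⟩

theorem dE_dE {p'' q'' : ℤ} (hp : p' = p + r) (hq : q' = q + 1 - r) (hp' : p'' = p' + r)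
    (hq' : q'' = q' + 1 - r) (x : C.E r p q) : C.dE hp' hq' (C.dE hp hq x) = 0 := by
  obtain ⟨x, rfl⟩ := C.cls_surjective _ _ _ x
  rw [dE_cls, dE_cls, cls_eq_zero]
  simp [C.d_d]

/-- The map `Z_{r+1}^{p,q} → H(E_r)^{p,q}` sending `x` to the class of `[x]`. -/
def toHomology {p₀ q₀ p₂ q₂ : ℤ} (hp : p = p₀ + r) (hq : q = q₀ + 1 - r) (hp' : p₂ = p + r)
    (hq' : q₂ = q + 1 - r) :
    C.Z (r + 1) p q →ₗ[ℝ] (C.dE hp' hq').ker ⧸ LinearMap.range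
      ((C.dE hp hq).codRestrict (C.dE hp' hq').ker fun x => C.dE_dE hp hq hp' hq' x) :=
  Submodule.mkQ _ ∘ₗ ((C.cls r p q) ∘ₗ Submodule.inclusion (C.Z_succ_le r p q)).codRestrict _
    fun x => by
      rw [LinearMap.mem_ker, LinearMap.comp_apply, dE_cls, cls_eq_zero]
      obtain ⟨h1, h2, h3⟩ := mem_Z.1 x.2
      refine Submodule.mem_sup_left (mem_Z.2 ⟨?_, ?_, ?_⟩)
      · rw [show p₂ + 1 = p + (r + 1) by omega]; exact h3
      · rw [show p₂ + 1 + (q₂ - 1) = p + q + 1 by omega]; exact C.d_deg _ _ h2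
      · change C.d (C.d x.1) ∈ _
        rw [C.d_d]; exact zero_mem _

theorem toHomology_surjective {p₀ q₀ p₂ q₂ : ℤ} (hp : p = p₀ + r) (hq : q = q₀ + 1 - r)
    (hp' : p₂ = p + r) (hq' : q₂ = q + 1 - r) :
    Function.Surjective (C.toHomology hp hq hp' hq') := by
  intro e
  obtain ⟨⟨e, he⟩, rfl⟩ := Submodule.mkQ_surjective _ e
  obtain ⟨x, rfl⟩ := C.cls_surjective _ _ _ e
  rw [LinearMap.mem_ker, dE_cls, cls_eq_zero] at he
  obtain ⟨z, hz, b, hb, hzb⟩ := Submodule.mem_sup.1 he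
  obtain ⟨hb1, -, y, hy1, hy2, rfl⟩ := mem_B.1 hb
  obtain ⟨hz1, -, -⟩ := mem_Z.1 hz
  obtain ⟨hx1, hx2, -⟩ := mem_Z.1 x.2
  have hy1' : y ∈ C.F (p + 1) := by rwa [show p + 1 = p₂ - (r - 1) by omega]
  have hy2' : y ∈ C.deg (p + q) := by rwa [show p + q = p₂ + q₂ - 1 by omega]
  have hxy : x.1 - y ∈ C.Z (r + 1) p q := by
    refine mem_Z.2 ⟨sub_mem hx1 (C.F_anti (by omega) hy1'), sub_mem hx2 hy2', ?_⟩
    have hzb' : z + C.d y = C.d x.1 := hzb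
    rw [map_sub, ← hzb', add_sub_cancel_right, show p + (r + 1) = p₂ + 1 by omega]
    exact hz1
  refine ⟨⟨x.1 - y, hxy⟩, ?_⟩
  change Submodule.mkQ _ _ = _
  congr 1
  ext1
  change C.cls r p q ⟨x.1 - y, C.Z_succ_le _ _ _ hxy⟩ = C.cls r p q x
  rw [← sub_eq_zero, ← map_sub, cls_eq_zero]
  refine Submodule.mem_sup_left ?_
  change x.1 - y - x.1 ∈ _
  rw [show x.1 - y - x.1 = -y by abel]
  refine neg_mem (mem_Z.2 ⟨hy1', ?_, ?_⟩)
  · rwa [show p + 1 + (q - 1) = p + q by omega]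
  · rwa [show p + 1 + (r - 1) = p₂ by omega]

theorem ker_toHomology {p₀ q₀ p₂ q₂ : ℤ} (hp : p = p₀ + r) (hq : q = q₀ + 1 - r)
    (hp' : p₂ = p + r) (hq' : q₂ = q + 1 - r) :
    (C.Z (r + 1 - 1) (p + 1) (q - 1) ⊔ C.B (r + 1 - 1) p q).submoduleOf (C.Z (r + 1) p q) =
      (C.toHomology hp hq hp' hq').ker := by
  ext x
  rw [Submodule.submoduleOf, Submodule.mem_comap, Submodule.subtype_apply, LinearMap.mem_ker]
  obtain ⟨hx1, hx2, hx3⟩ := mem_Z.1 x.2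
  have h : C.toHomology hp hq hp' hq' x = 0 ↔ ∃ w : C.Z r p₀ q₀,
      x.1 - C.d w ∈ C.Z (r - 1) (p + 1) (q - 1) ⊔ C.B (r - 1) p q := by
    refine (Submodule.Quotient.mk_eq_zero _).trans ?_
    rw [LinearMap.mem_range]
    constructor
    · rintro ⟨e, he⟩
      obtain ⟨w, rfl⟩ := C.cls_surjective _ _ _ e
      have he' : C.dE hp hq (C.cls r p₀ q₀ w) = C.cls r p q ⟨x.1, C.Z_succ_le _ _ _ x.2⟩ :=
        congrArg Subtype.val he
      rw [dE_cls, eq_comm, ← sub_eq_zero, ← map_sub, cls_eq_zero] at he'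
      exact ⟨w, he'⟩
    · rintro ⟨w, hw⟩
      refine ⟨C.cls r p₀ q₀ w, Subtype.ext ?_⟩
      change C.dE hp hq (C.cls r p₀ q₀ w) = C.cls r p q ⟨x.1, C.Z_succ_le _ _ _ x.2⟩
      rw [dE_cls, eq_comm, ← sub_eq_zero, ← map_sub, cls_eq_zero]
      exact hw
  rw [h]
  constructor
  · intro hx
    obtain ⟨z, hz, b, hb, hzb⟩ := Submodule.mem_sup.1 hx
    obtain ⟨hb1, hb2, w, hw1, hw2, rfl⟩ := mem_B.1 hb
    obtain ⟨hz1, hz2, hz3⟩ := mem_Z.1 hz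
    refine ⟨⟨w, mem_Z.2 ⟨?_, ?_, ?_⟩⟩, ?_⟩
    · rwa [show p₀ = p - (r + 1 - 1) by omega]
    · rwa [show p₀ + q₀ = p + q - 1 by omega]
    · rwa [← hp]
    · change x.1 - C.d w ∈ _
      rw [← hzb, add_sub_cancel_right]
      exact Submodule.mem_sup_left (mem_Z.2 ⟨hz1, hz2, C.F_anti (by omega) hz3⟩)
  · rintro ⟨w, hw⟩
    obtain ⟨z, hz, b, hb, hzb⟩ := Submodule.mem_sup.1 hw
    obtain ⟨hb1, hb2, y, hy1, hy2, rfl⟩ := mem_B.1 hb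
    obtain ⟨hz1, hz2, -⟩ := mem_Z.1 hz
    obtain ⟨hw1, hw2, hw3⟩ := mem_Z.1 w.2
    have hx : x.1 = z + (C.d y + C.d w.1) := by rw [← add_assoc, hzb, sub_add_cancel]
    rw [hx]
    refine Submodule.add_mem_sup (mem_Z.2 ⟨hz1, hz2, ?_⟩) (add_mem (mem_B.2 ⟨hb1, hb2, y, ?_, hy2,
      rfl⟩) (mem_B.2 ⟨hp ▸ hw3, ?_, w.1, ?_, ?_, rfl⟩))
    · have : C.d z = C.d x.1 := by rw [hx]; simp [C.d_d]
      rw [this, show p + 1 + (r + 1 - 1) = p + (r + 1) by omega]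
      exact hx3
    · exact C.F_anti (by omega) hy1
    · rw [show p + q = p₀ + q₀ + 1 by omega]; exact C.d_deg _ _ hw2
    · rwa [show p - (r + 1 - 1) = p₀ by omega]
    · rwa [show p + q - 1 = p₀ + q₀ by omega]

/-- The isomorphism `E_{r+1}^{p,q} ≅ H(E_r)^{p,q}`, mapping the class of `x ∈ Z_{r+1}^{p,q}` to the
class of `[x]`. -/
def homologyEquiv {p₀ q₀ p₂ q₂ : ℤ} (hp : p = p₀ + r) (hq : q = q₀ + 1 - r) (hp' : p₂ = p + r)
    (hq' : q₂ = q + 1 - r) :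
    C.E (r + 1) p q ≃ₗ[ℝ] (C.dE hp' hq').ker ⧸ LinearMap.range
      ((C.dE hp hq).codRestrict (C.dE hp' hq').ker fun x => C.dE_dE hp hq hp' hq' x) :=
  (Submodule.quotEquivOfEq _ _ (C.ker_toHomology hp hq hp' hq')).trans
    ((C.toHomology hp hq hp' hq').quotKerEquivOfSurjective
      (C.toHomology_surjective hp hq hp' hq'))

/-- The `r`-th page `(E_r^{p,q}, d_r)`. -/
def page (r : ℤ) : HomologicalComplex (ModuleCat.{u} ℝ)
    (ComplexShape.up' ((r, 1 - r) : ℤ × ℤ)) where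
  X pq := ModuleCat.of ℝ (C.E r pq.1 pq.2)
  d pq pq' :=
    if h : pq'.1 = pq.1 + r ∧ pq'.2 = pq.2 + 1 - r then ModuleCat.ofHom (C.dE h.1 h.2) else 0
  shape pq pq' h := dif_neg fun h' => h (Prod.ext h'.1.symm (by
    change pq.2 + (1 - r) = pq'.2
    omega))
  d_comp_d' i j k hij hjk := by
    split_ifs with h h'
    · rw [← ModuleCat.ofHom_comp]
      exact congrArg ModuleCat.ofHom (LinearMap.ext fun x => C.dE_dE h.1 h.2 h'.1 h'.2 x)
    all_goals simp

theorem page_d (r : ℤ) (pq pq' : ℤ × ℤ) (hp : pq'.1 = pq.1 + r) (hq : pq'.2 = pq.2 + 1 - r) :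
    (C.page r).d pq pq' = ModuleCat.ofHom (C.dE hp hq) := dif_pos ⟨hp, hq⟩

/-- The isomorphism between the homology of the `r`-th page and the `(r+1)`-st page, which maps the
class of `[x]`, `x ∈ Z_{r+1}^{p,q}`, to the class of `x`. -/
def pageIso (r : ℤ) (pq : ℤ × ℤ) : (C.page r).homology pq ≅ (C.page (r + 1)).X pq :=
  let i : ℤ × ℤ := (pq.1 - r, pq.2 - 1 + r)
  let k : ℤ × ℤ := (pq.1 + r, pq.2 + 1 - r)
  have hp : pq.1 = i.1 + r := (sub_add_cancel pq.1 r).symm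
  have hq : pq.2 = i.2 + 1 - r := by change pq.2 = pq.2 - 1 + r + 1 - r; omega
  have hi : (ComplexShape.up' ((r, 1 - r) : ℤ × ℤ)).prev pq = i :=
    ComplexShape.prev_eq' _ (Prod.ext hp.symm (by change i.2 + (1 - r) = pq.2; omega))
  have hk : (ComplexShape.up' ((r, 1 - r) : ℤ × ℤ)).next pq = k :=
    ComplexShape.next_eq' _ (Prod.ext rfl (by change pq.2 + (1 - r) = pq.2 + 1 - r; omega))
  let S : ShortComplex (ModuleCat.{u} ℝ) := ShortComplex.moduleCatMk
    (C.dE hp hq) (C.dE (p' := k.1) (q' := k.2) rfl rfl)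
    (LinearMap.ext fun x => C.dE_dE hp hq rfl rfl x)
  let e : (C.page r).sc pq ≅ S := (C.page r).isoSc' i pq k hi hk ≪≫
    ShortComplex.isoMk (Iso.refl _) (Iso.refl _) (Iso.refl _)
      (by
        change 𝟙 _ ≫ ModuleCat.ofHom (C.dE hp hq) = (C.page r).d i pq ≫ 𝟙 _
        rw [C.page_d r i pq hp hq]
        exact (Category.id_comp _).trans (Category.comp_id _).symm)
      (by
        change 𝟙 _ ≫ ModuleCat.ofHom (C.dE (p' := k.1) (q' := k.2) rfl rfl) =
          (C.page r).d pq k ≫ 𝟙 _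
        rw [C.page_d r pq k rfl rfl]
        exact (Category.id_comp _).trans (Category.comp_id _).symm)
  ShortComplex.homologyMapIso e ≪≫ S.moduleCatHomologyIso ≪≫
    (C.homologyEquiv hp hq (p₂ := k.1) (q₂ := k.2) rfl rfl).symm.toModuleIso

/-- The spectral sequence `(E_r^{p,q}, d_r)`, `r ≥ 0`, of a filtered complex. -/
def spectralSequence : CohomologicalSpectralSequence (ModuleCat.{u} ℝ) 0 where
  page r _ := C.page r
  iso r r' pq hrr' _ := C.pageIso r pq ≪≫ eqToIso (by rw [hrr'])

end FilteredComplex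

end Filtered

section LCSManifold

open CategoryTheory

/-- A locally conformal symplectic structure on a manifold `M` modelled on `E`: a non-degenerate
two-form `ω` and a closed one-form `θ` (the Lee form) such that `dω = -ω ∧ θ`. -/
structure LCSStructure (E : Type*) [NormedAddCommGroup E] [NormedSpace ℝ E]
    [FiniteDimensional ℝ E] (M : Type*) [TopologicalSpace M] [ChartedSpace E M]
    [IsManifold 𝓘(ℝ, E) ∞ M] where
  form : Form E M 2
  lee : Form E M 1
  nondegenerate : ∀ (x : M) (v : TangentSpace 𝓘(ℝ, E) x),
    (∀ w : TangentSpace 𝓘(ℝ, E) x, form.1 x ![v, w] = 0) → v = 0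
  extD_form : extD form = -wedgeForm form lee
  extD_lee : extD lee = 0

namespace LCSStructure

variable {E : Type*} [NormedAddCommGroup E] [NormedSpace ℝ E] [FiniteDimensional ℝ E]
  {M : Type*} [TopologicalSpace M] [ChartedSpace E M] [IsManifold 𝓘(ℝ, E) ∞ M]
  (S : LCSStructure E M)

/-- The Lefschetz operator `L α = ω ∧ α`. -/
def L : TotalForm E M →ₗ[ℝ] TotalForm E M := lefschetz S.form

/-- The Lichnerowicz differential `d_k α = dα + k θ ∧ α`. -/
def dk (k : ℤ) : TotalForm E M →ₗ[ℝ] TotalForm E M := twistedD ((k : ℝ) • S.lee)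

theorem dk_dk (k : ℤ) (x : TotalForm E M) : S.dk k (S.dk k x) = 0 :=
  twistedD_twistedD _ (by rw [map_smul, S.extD_lee, smul_zero]) x

theorem dk_L (k : ℤ) (x : TotalForm E M) : S.dk (k + 1) (S.L x) = S.L (S.dk k x) := by
  have := twistedD_lefschetz S.form S.lee ((k : ℝ) • S.lee) S.extD_form x
  unfold dk L
  rw [← this, Int.cast_add, Int.cast_one, add_smul, one_smul]

theorem dk_L_pow (k : ℤ) (j : ℕ) (x : TotalForm E M) :
    S.dk (k + j) ((S.L ^ j) x) = (S.L ^ j) (S.dk k x) := by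
  induction j with
  | zero => simp
  | succ j ih =>
    rw [pow_succ', Module.End.mul_apply, Module.End.mul_apply, ← ih, ← dk_L]
    push_cast
    rw [add_assoc]

theorem dk_degree (k j : ℤ) (x : TotalForm E M) (hx : x ∈ degreePart E M j) :
    S.dk k x ∈ degreePart E M (j + 1) := by
  have ht {i : ℕ} {j : ℤ} (h : (i : ℤ) = j) (α : Form E M i) : tot i α ∈ degreePart E M j := by
    intro a ha
    exact DFinsupp.single_eq_of_ne (β := fun k => Form E M k) (fun h' => ha (by rw [h', h]))
  have hx' : x = 0 ∨ ∃ (i : ℕ) (α : Form E M i), (i : ℤ) = j ∧ x = tot i α := by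
    by_cases h : ∃ i : ℕ, (i : ℤ) = j
    · obtain ⟨i, hi⟩ := h
      refine Or.inr ⟨i, x i, hi, ?_⟩
      refine DFinsupp.ext fun a => ?_
      by_cases ha : a = i
      · subst ha
        exact (DFinsupp.single_eq_same (β := fun k => Form E M k)).symm
      · rw [hx a (fun h => ha (by exact_mod_cast h.trans hi.symm))]
        exact (DFinsupp.single_eq_of_ne (β := fun k => Form E M k) ha).symm
    · exact Or.inl (DFinsupp.ext fun a => hx a fun ha => h ⟨a, ha⟩)
  rcases hx' with rfl | ⟨i, α, hi, rfl⟩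
  · rw [map_zero]; exact zero_mem _
  · unfold dk
    rw [twistedD_tot]
    exact add_mem (ht (by push_cast; omega) _) (ht (by push_cast; omega) _)

/-- The complex `(Ω^*(M), d_k)` with the Lefschetz filtration `F^p = L^p Ω^*(M)` for `p ≥ 0`, and
`F^p = Ω^*(M)` for `p ≤ 0`. -/
def filteredComplex (k : ℤ) : FilteredComplex (TotalForm E M) where
  d := S.dk k
  deg := degreePart E M
  F p := LinearMap.range (S.L ^ p.toNat)
  d_d := S.dk_dk k
  d_deg := S.dk_degree k
  F_anti p p' h := by
    rintro _ ⟨x, rfl⟩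
    refine ⟨(S.L ^ (p'.toNat - p.toNat)) x, ?_⟩
    rw [← Module.End.mul_apply, ← pow_add]
    congr 2
    omega
  d_F p := by
    rintro _ ⟨x, rfl⟩
    have := S.dk_L_pow (k - p.toNat) p.toNat x
    rw [sub_add_cancel] at this
    exact ⟨_, this.symm⟩

/-- The spectral sequence `E^{p,q}_{k,r}`, `r ≥ 0`, of the Lefschetz filtration on
`(Ω^*(M), d_k)`. -/
def spectralSequence (k : ℤ) : CohomologicalSpectralSequence (ModuleCat ℝ) 0 :=
  (S.filteredComplex k).spectralSequence

end LCSStructure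

end LCSManifold

end LCS

end

/-! Conformal structures. If ω' = ±e^f ω and θ = θ' + df, then multiplication by e^{kf} intertwines
d_k with d'_k, and since L' = ±e^f L it carries L^p Ω^* onto L'^p Ω^*. It is thus an isomorphism of
filtered complexes (`conformalMap`), and every ingredient of the spectral sequence is natural in
such maps (`spectralSequenceIso`). For n ≠ 1 the relation between the Lee forms is forced, because η
= 0 whenever η ∧ ω = 0 for a one-form η.

Cohomologous structures. The Lee forms agree, so the differentials agree and only the filtration
changes. The link is the homotopy formula L' = L + d_m ρ + ρ d_{m-1} (`L_eq_of_cohomologous`). The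
terms E_1^{p,q} are compared one bidegree at a time, by hard Lefschetz: L^r is injective on Ω^j for
j + r ≤ n and maps onto Ω^m for r ≤ m - n. This comes pointwise from the commutator of L with the
dual contraction Λ, and passes to smooth forms because inversion of operators is smooth.

For p < 0 or q > n both terms vanish. For p ≥ 0 and q < n, powers of L cancel, and E_1^{p,q}
consists of pairs (α, β) with dα = Lβ, modulo α = Lb + dc; the shear (α, β) ↦ (α + ρ ∧ β, β)
exchanges the two structures. For q = n ≤ p the term is all of Ω^{p+n} for both structures.

For q = n and 0 ≤ p < n no natural map is used: on a non-empty M both spaces have dimension exactly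
the continuum (`lift_rank_E_one`), so they are abstractly isomorphic. The upper bound holds because
a smooth form is determined by its values on a countable dense set. For the lower bound, write L^p
dα = L^{p+1} β; then dβ depends only on the class of L^p α, and α ↦ dβ is a second order operator.
Its symbol is non-zero at some covector (`exists_symbol_ne_zero`). Applying it to α = l² e^{tμ} η,
where l vanishes at a point p₀ with that covector as differential, gives 2 e^{tμ} dl ∧ γ on {l = 0},
and the functions e^{tμ}, t ∈ ℝ, are linearly independent along a curve in {l = 0}. -/

noncomputable section

namespace LCS

/-! ### Hard Lefschetz from the commutation relation of L and Λ. -/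

section HardLefschetz

/-- A graded real vector space with operators `L` of degree two and `Λ` of degree minus two such
that `[Λ, L]` acts by `n - j` in degree `j`; the degrees are bounded by `0` and `2 n`. -/
structure LefschetzPair {K : Type*} [AddCommGroup K] [Module ℝ K] (n : ℕ) (deg : ℤ → Submodule ℝ K)
    (L Λ : K →ₗ[ℝ] K) : Prop where
  L_mem : ∀ j, ∀ x ∈ deg j, L x ∈ deg (j + 2)
  Λ_mem : ∀ j, ∀ x ∈ deg j, Λ x ∈ deg (j - 2)
  comm : ∀ j, ∀ x ∈ deg j, Λ (L x) = L (Λ x) + ((n : ℝ) - j) • x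
  eq_zero_of_neg : ∀ j < 0, ∀ x ∈ deg j, x = 0
  eq_zero_of_gt : ∀ j > 2 * (n : ℤ), ∀ x ∈ deg j, x = 0

namespace LefschetzPair

variable {K : Type*} [AddCommGroup K] [Module ℝ K] {n : ℕ} {deg : ℤ → Submodule ℝ K}
  {L Λ : K →ₗ[ℝ] K} (h : LefschetzPair n deg L Λ)

include h

theorem L_pow_mem (r : ℕ) {j : ℤ} {x : K} (hx : x ∈ deg j) : (L ^ r) x ∈ deg (j + 2 * r) := by
  induction r with
  | zero => simpa using hx
  | succ r ih =>
    rw [pow_succ', Module.End.mul_apply]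
    have := h.L_mem _ _ ih
    rwa [show j + 2 * ((r + 1 : ℕ) : ℤ) = j + 2 * r + 2 by push_cast; ring]

/-- Moving Λ past each factor L adds n minus the current degree; the sum of n - j - 2s over s ≤ r is
(r + 1)(n - j - r). Hard Lefschetz depends on when this factor vanishes. -/
theorem Λ_L_pow (r : ℕ) {j : ℤ} {x : K} (hx : x ∈ deg j) :
    Λ ((L ^ (r + 1)) x) = (L ^ (r + 1)) (Λ x) + (((r : ℝ) + 1) * ((n : ℝ) - j - r)) • (L ^ r) x := by
  induction r with
  | zero => simpa using h.comm j x hx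
  | succ r ih =>
    have h1 := h.comm _ _ (h.L_pow_mem (r + 1) hx)
    rw [pow_succ' L (r + 1), Module.End.mul_apply, h1, ih, map_add, map_smul, Module.End.mul_apply,
      ← Module.End.mul_apply L (L ^ r), ← pow_succ', add_assoc, ← add_smul]
    congr 2
    push_cast
    ring

/-- If L^{r+1} x = 0, applying Λ gives L^r (LΛx + c x) = 0 with c > 0. Induction on r yields LΛx =
-c x, hence L^{r+2} Λx = 0; induction on the degree yields Λx = 0, and then c x = 0. -/
theorem eq_zero_of_L_pow_eq_zero {j : ℤ} {x : K} (hx : x ∈ deg j) (r : ℕ) (hr : j + r ≤ n)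
    (h0 : (L ^ r) x = 0) : x = 0 := by
  -- The shift by 2 guarantees N ≥ 2 as soon as j ≥ 0, so that the call at `N - 2` really decreases.
  obtain ⟨N, hN⟩ : ∃ N : ℕ, j + 2 ≤ N := ⟨(j + 2).toNat, Int.self_le_toNat _⟩
  induction N using Nat.strong_induction_on generalizing j x r with
  | _ N ihN =>
  by_cases hj : j < 0
  · exact h.eq_zero_of_neg j hj x hx
  induction r generalizing x with
  | zero => simpa using h0
  | succ r ih =>
    have h1 := h.Λ_L_pow r hx
    rw [h0, map_zero] at h1
    set c : ℝ := ((r : ℝ) + 1) * ((n : ℝ) - j - r) with hc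
    have hc0 : c ≠ 0 := by
      refine mul_ne_zero (by positivity) ?_
      have : (0 : ℝ) < (n : ℝ) - j - r := by
        have : (0 : ℤ) < n - j - r := by push_cast at hr; omega
        exact_mod_cast this
      exact this.ne'
    have hΛ := h.Λ_mem j x hx
    have hmem : L (Λ x) + c • x ∈ deg j := by
      refine add_mem ?_ ((deg j).smul_mem _ hx)
      have := h.L_mem _ _ hΛ
      rwa [sub_add_cancel] at this
    have h2 : L (Λ x) + c • x = 0 := by
      refine ih hmem (by push_cast at hr; omega) ?_
      rw [map_add, map_smul, ← Module.End.mul_apply, ← pow_succ, ← h1]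
    have h3 : (L ^ (r + 1 + 1)) (Λ x) = 0 := by
      have := congrArg (L ^ (r + 1)) h2
      rw [map_add, map_smul, h0, smul_zero, add_zero, map_zero, ← Module.End.mul_apply,
        ← pow_succ] at this
      exact this
    have h4 : Λ x = 0 := by
      refine ihN (N - 2) (by omega) hΛ _ ?_ h3 (by omega)
      push_cast at hr ⊢
      omega
    rw [h4, map_zero, zero_add, smul_eq_zero] at h2
    exact h2.resolve_left hc0

/-- Descending induction on the degree writes Lx = L^{r+2} b, so x - L^{r+1} b is killed by L;
induction on r writes it as L^r c. As L^{r+1} c = 0, applying Λ turns L^r c into a multiple of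
L^{r+1} Λc. -/
theorem exists_L_pow_eq {m : ℤ} {x : K} (hx : x ∈ deg m) (r : ℕ) (hr : r ≤ m - n) :
    ∃ y ∈ deg (m - 2 * r), (L ^ r) y = x := by
  obtain ⟨N, hN⟩ : ∃ N : ℕ, 2 * (n : ℤ) + 2 - m ≤ N := ⟨_, Int.self_le_toNat _⟩
  induction N using Nat.strong_induction_on generalizing m x r with
  | _ N ihN =>
  by_cases hm : 2 * (n : ℤ) < m
  · exact ⟨0, zero_mem _, by rw [map_zero, h.eq_zero_of_gt m hm x hx]⟩
  induction r generalizing x with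
  | zero => exact ⟨x, by simpa using hx, rfl⟩
  | succ r ih =>
    obtain ⟨b, hb, hLb⟩ := ihN (N - 2) (by omega) (h.L_mem m x hx) (r + 1 + 1)
      (by push_cast at hr ⊢; omega) (by omega)
    have hb' : b ∈ deg (m - 2 * ((r + 1 : ℕ) : ℤ)) := by
      convert hb using 2; push_cast; ring
    have hLb' : (L ^ (r + 1)) b ∈ deg m := by
      have := h.L_pow_mem (r + 1) hb'
      rwa [sub_add_cancel] at this
    obtain ⟨c, hc, hLc⟩ := ih (sub_mem hx hLb') (by push_cast at hr; omega)
    have h0 : (L ^ (r + 1)) c = 0 := by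
      rw [pow_succ', Module.End.mul_apply, hLc, map_sub, ← Module.End.mul_apply, ← pow_succ', hLb,
        sub_self]
    have h1 := h.Λ_L_pow r hc
    rw [h0, map_zero] at h1
    -- The coefficient is negative because c has degree m - 2r and m - r ≥ n + 1.
    set d : ℝ := ((r : ℝ) + 1) * ((n : ℝ) - (m - 2 * (r : ℤ) : ℤ) - r) with hd
    have hd0 : d ≠ 0 := by
      refine mul_ne_zero (by positivity) ?_
      have : (n : ℝ) - (m - 2 * (r : ℤ) : ℤ) - r < 0 := by
        have : (n : ℤ) - (m - 2 * r) - r < 0 := by push_cast at hr; omega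
        exact_mod_cast this
      exact this.ne
    refine ⟨b + (-d⁻¹) • Λ c, add_mem hb' (Submodule.smul_mem _ _ ?_), ?_⟩
    · have := h.Λ_mem _ _ hc
      convert this using 2; push_cast; ring
    · rw [hLc] at h1
      have h2 : (L ^ (r + 1)) (Λ c) = -(d • (x - (L ^ (r + 1)) b)) :=
        eq_neg_of_add_eq_zero_left h1.symm
      rw [map_add, map_smul, h2, smul_neg, neg_smul, neg_neg, smul_smul, inv_mul_cancel₀ hd0,
        one_smul]
      abel

/-- A primitive element of degree `j` is annihilated by `L ^ (n - j + 1)`. -/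
theorem L_pow_eq_zero_of_primitive {j : ℤ} {x : K} (hx : x ∈ deg j) (hΛ : Λ x = 0) (r : ℕ)
    (hr : n - j < r) : (L ^ r) x = 0 := by
  -- Since Λx = 0, applying Λ to L^{r+s+1} x = 0 leaves a non-zero multiple of L^{r+s} x. The
  -- descent starts from a power that vanishes for degree reasons.
  have key (s : ℕ) (h0 : (L ^ (r + s)) x = 0) : (L ^ r) x = 0 := by
    induction s with
    | zero => exact h0
    | succ s ih =>
      refine ih ?_
      have h1 := h.Λ_L_pow (r + s) hx
      rw [← add_assoc] at h0
      rw [h0, hΛ, map_zero, map_zero, zero_add] at h1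
      refine (smul_eq_zero.1 h1.symm).resolve_left (mul_ne_zero (by positivity) ?_)
      have : (n : ℝ) - j - (r + s : ℕ) < 0 := by
        have : (n : ℤ) - j - (r + s : ℕ) < 0 := by push_cast; omega
        exact_mod_cast this
      exact this.ne
  obtain ⟨N, hN⟩ : ∃ N : ℕ, 2 * (n : ℤ) + 1 - j ≤ N := ⟨_, Int.self_le_toNat _⟩
  refine key N (h.eq_zero_of_gt _ ?_ _ (h.L_pow_mem _ hx))
  push_cast
  omega

end LefschetzPair

end HardLefschetz


/-! ### Exterior and interior products on alternating forms of all degrees. -/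

section Pointwise

open ContinuousAlternatingMap

variable {E : Type*} [NormedAddCommGroup E] [NormedSpace ℝ E] [FiniteDimensional ℝ E] {k : ℕ}

theorem vec_one_eq (v : Fin 1 → E) : v = ![v 0] := by
  ext i; rw [Subsingleton.elim i 0]; rfl

/-- Alternating forms with equal numbers of arguments. -/
def castForm {k l : ℕ} (h : k = l) (a : E [⋀^Fin k]→L[ℝ] ℝ) : E [⋀^Fin l]→L[ℝ] ℝ := h ▸ a

theorem castForm_apply {k l : ℕ} (h : k = l) (a : E [⋀^Fin k]→L[ℝ] ℝ) (v : Fin l → E) :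
    castForm h a v = a (fun i => v (Fin.cast h i)) := by
  subst h; rfl

/-- The exterior product with a covector, with the arguments in natural order. -/
def ext1 (θ : E [⋀^Fin 1]→L[ℝ] ℝ) : (E [⋀^Fin k]→L[ℝ] ℝ) →ₗ[ℝ] (E [⋀^Fin (k + 1)]→L[ℝ] ℝ) where
  toFun a := alternatizeUncurryFin
    (((ofSubsingleton ℝ E ℝ (0 : Fin 1)).symm θ).smulRight a)
  map_add' a b := by
    rw [← alternatizeUncurryFin_add]; congr 1; ext; simp
  map_smul' r a := by
    rw [RingHom.id_apply, ← alternatizeUncurryFin_smul]; congr 1; ext; simp [mul_left_comm]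

theorem ext1_apply (θ : E [⋀^Fin 1]→L[ℝ] ℝ) (a : E [⋀^Fin k]→L[ℝ] ℝ) (v : Fin (k + 1) → E) :
    ext1 θ a v = ∑ i : Fin (k + 1), (-1) ^ (i : ℕ) * (θ ![v i] * a (i.removeNth v)) := by
  refine (alternatizeUncurryFin_apply _ _).trans (Finset.sum_congr rfl fun i _ => ?_)
  rw [zsmul_eq_mul]
  push_cast
  congr 1
  change θ (fun _ => v i) * _ = _
  rw [vec_one_eq (fun _ => v i)]
  rfl

/-- Both sides are the same signed sum over permutations. The operator `ext1` has its values in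
degree k + 1 rather than 1 + k, which keeps casts out of the later algebra. -/
theorem wedge_eq_ext1 (θ : E [⋀^Fin 1]→L[ℝ] ℝ) (a : E [⋀^Fin k]→L[ℝ] ℝ) (v : Fin (k + 1) → E) :
    wedge θ a (fun i => v (Fin.cast (add_comm 1 k) i)) = ext1 θ a v := by
  refine Eq.trans ?_ (alternatizeUncurryFin_eq_altSum _ v).symm
  rw [wedge_apply, altSum_cast]
  simp only [Nat.factorial_one, Nat.cast_one, one_mul]
  congr 2
  funext u
  have h1 (j : Fin k) : Fin.cast (add_comm 1 k) (Fin.natAdd 1 j) = j.succ := by ext; simp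
  have h2 (i : Fin 1) : Fin.cast (add_comm 1 k) (Fin.castAdd k i) = 0 := by ext; simp
  simp only [h1, h2]
  rfl

/-- The exterior product with a two-form, with the form put last in the degree. -/
def lef (w : E [⋀^Fin 2]→L[ℝ] ℝ) : (E [⋀^Fin k]→L[ℝ] ℝ) →ₗ[ℝ] (E [⋀^Fin (k + 2)]→L[ℝ] ℝ) where
  toFun a := castForm (add_comm 2 k) (wedge w a)
  map_add' a b := by ext v; simp [castForm_apply, wedge_add_right]
  map_smul' r a := by ext v; simp [castForm_apply, wedge_smul_right]

theorem lef_apply (w : E [⋀^Fin 2]→L[ℝ] ℝ) (a : E [⋀^Fin k]→L[ℝ] ℝ) (v : Fin (k + 2) → E) :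
    lef w a v = wedge w a (fun i => v (Fin.cast (add_comm 2 k) i)) :=
  castForm_apply _ _ _

theorem ext1_add_left (θ η : E [⋀^Fin 1]→L[ℝ] ℝ) (a : E [⋀^Fin k]→L[ℝ] ℝ) :
    ext1 (θ + η) a = ext1 θ a + ext1 η a := by
  ext v; simp [ext1_apply, add_mul, mul_add, Finset.sum_add_distrib]

theorem ext1_smul_left (r : ℝ) (θ : E [⋀^Fin 1]→L[ℝ] ℝ) (a : E [⋀^Fin k]→L[ℝ] ℝ) :
    ext1 (r • θ) a = r • ext1 θ a := by
  ext v; simp [ext1_apply, mul_assoc, mul_left_comm, Finset.mul_sum]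

theorem wedge_ext1_ext1 (θ η : E [⋀^Fin 1]→L[ℝ] ℝ) (a : E [⋀^Fin k]→L[ℝ] ℝ)
    (v : Fin (k + 2) → E) :
    wedge (wedge θ η) a (fun i => v (Fin.cast (add_comm 2 k) i)) = ext1 θ (ext1 η a) v := by
  have h1 : wedge η a = castForm (add_comm k 1) (ext1 η a) := by
    ext u
    rw [castForm_apply]
    exact wedge_eq_ext1 η a (fun i => u (Fin.cast (add_comm k 1) i))
  have h2 := wedge_assoc θ η a (fun i => v (Fin.cast (by omega) i))
  refine h2.trans ?_
  rw [h1, ← wedge_eq_ext1, wedge_apply, wedge_apply]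
  have e : k + 1 = 1 + k := add_comm k 1
  -- A cast of the second factor's degree can be moved to the arguments; with the degrees as
  -- variables this is substitution.
  have key {m m' : ℕ} (e : m' = m) (b : E [⋀^Fin m']→L[ℝ] ℝ) (u : Fin (1 + m) → E) :
      ((Nat.factorial 1 : ℝ) * m.factorial)⁻¹ * altSum (fun u : Fin (1 + m) → E =>
        θ (fun i => u (Fin.castAdd m i)) *
          castForm e b (fun j => u (Fin.natAdd 1 j))) u =
      ((Nat.factorial 1 : ℝ) * m'.factorial)⁻¹ * altSum (fun u : Fin (1 + m') → E =>
        θ (fun i => u (Fin.castAdd m' i)) * b (fun j => u (Fin.natAdd 1 j)))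
        (fun i => u (Fin.cast (by omega) i)) := by
    subst e; rfl
  exact key e _ _

theorem ext1_eq_wedge_one (θ η : E [⋀^Fin 1]→L[ℝ] ℝ) : ext1 θ η = wedge θ η := by
  ext v
  exact (wedge_eq_ext1 θ η v).symm

variable (E) in
/-- The product of the spaces of alternating forms of all degrees. -/
abbrev AltPi : Type _ := ∀ k : ℕ, E [⋀^Fin k]→L[ℝ] ℝ

/-- Interior product. -/
def inner1 (v : E) : AltPi E →ₗ[ℝ] AltPi E where
  toFun x k := (x (k + 1)).curryLeft v
  map_add' _ _ := rfl
  map_smul' _ _ := rfl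

/-- Exterior product with a covector. -/
def outer1 (θ : E [⋀^Fin 1]→L[ℝ] ℝ) : AltPi E →ₗ[ℝ] AltPi E where
  toFun x
    | 0 => 0
    | k + 1 => ext1 θ (x k)
  map_add' x y := by
    funext k
    cases k with
    | zero => exact (add_zero _).symm
    | succ k => exact map_add (ext1 θ) _ _
  map_smul' r x := by
    funext k
    cases k with
    | zero => exact (smul_zero r).symm
    | succ k => exact map_smul (ext1 θ) _ _

/-- Exterior product with a two-form. -/
def outer2 (w : E [⋀^Fin 2]→L[ℝ] ℝ) : AltPi E →ₗ[ℝ] AltPi E where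
  toFun x
    | 0 => 0
    | 1 => 0
    | k + 2 => lef w (x k)
  map_add' x y := by
    funext k
    match k with
    | 0 => exact (add_zero _).symm
    | 1 => exact (add_zero _).symm
    | k + 2 => exact map_add (lef w) _ _
  map_smul' r x := by
    funext k
    match k with
    | 0 => exact (smul_zero r).symm
    | 1 => exact (smul_zero r).symm
    | k + 2 => exact map_smul (lef w) _ _

/-- The degree operator. -/
def degreeOp : AltPi E →ₗ[ℝ] AltPi E where
  toFun x k := (k : ℝ) • x k
  map_add' _ _ := funext fun _ => smul_add _ _ _
  map_smul' r x := funext fun k => smul_comm (k : ℝ) r (x k)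

@[simp] theorem inner1_apply (v : E) (x : AltPi E) (k : ℕ) :
    inner1 v x k = (x (k + 1)).curryLeft v := rfl
@[simp] theorem outer1_zero (θ : E [⋀^Fin 1]→L[ℝ] ℝ) (x : AltPi E) : outer1 θ x 0 = 0 := rfl
@[simp] theorem outer1_succ (θ : E [⋀^Fin 1]→L[ℝ] ℝ) (x : AltPi E) (k : ℕ) :
    outer1 θ x (k + 1) = ext1 θ (x k) := rfl
@[simp] theorem outer2_zero (w : E [⋀^Fin 2]→L[ℝ] ℝ) (x : AltPi E) : outer2 w x 0 = 0 := rfl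
@[simp] theorem outer2_one (w : E [⋀^Fin 2]→L[ℝ] ℝ) (x : AltPi E) : outer2 w x 1 = 0 := rfl
@[simp] theorem outer2_add_two (w : E [⋀^Fin 2]→L[ℝ] ℝ) (x : AltPi E) (k : ℕ) :
    outer2 w x (k + 2) = lef w (x k) := rfl

theorem outer1_add_left (θ η : E [⋀^Fin 1]→L[ℝ] ℝ) (x : AltPi E) :
    outer1 (θ + η) x = outer1 θ x + outer1 η x := by
  funext k
  cases k with
  | zero => exact (add_zero _).symm
  | succ k => exact ext1_add_left _ _ _

theorem outer1_smul_left (r : ℝ) (θ : E [⋀^Fin 1]→L[ℝ] ℝ) (x : AltPi E) :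
    outer1 (r • θ) x = r • outer1 θ x := by
  funext k
  cases k with
  | zero => exact (smul_zero r).symm
  | succ k => exact ext1_smul_left _ _ _

/-- `outer1` as a bilinear map. -/
def outer1L (x : AltPi E) : (E [⋀^Fin 1]→L[ℝ] ℝ) →ₗ[ℝ] AltPi E where
  toFun θ := outer1 θ x
  map_add' _ _ := outer1_add_left _ _ _
  map_smul' _ _ := outer1_smul_left _ _ _

/-- `inner1` as a bilinear map. -/
def inner1L (x : AltPi E) : E →ₗ[ℝ] AltPi E where
  toFun v := inner1 v x
  map_add' u v := funext fun k => map_add (x (k + 1)).curryLeft u v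
  map_smul' r v := funext fun k => map_smul (x (k + 1)).curryLeft r v

/-- In the expansion of θ ∧ x the term where θ takes the first argument v gives θ(v) x, and the
others form -θ ∧ ι_v x. This relation and the Euler identity below are the source of all later
commutators. -/
theorem inner1_outer1 (v : E) (θ : E [⋀^Fin 1]→L[ℝ] ℝ) (x : AltPi E) :
    inner1 v (outer1 θ x) = θ ![v] • x - outer1 θ (inner1 v x) := by
  funext k
  ext u
  change ext1 θ (x k) (Matrix.vecCons v u) = θ ![v] * x k u - (outer1 θ (inner1 v x) k) u
  rw [ext1_apply, Fin.sum_univ_succ]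
  have h0 : Fin.removeNth 0 (Matrix.vecCons v u) = u := by ext; rfl
  rw [h0]
  simp only [Fin.val_zero, pow_zero, one_mul, Matrix.cons_val_zero, Matrix.cons_val_succ]
  rw [sub_eq_add_neg]
  congr 1
  cases k with
  | zero => simp
  | succ k =>
    rw [outer1_succ, ext1_apply, ← Finset.sum_neg_distrib]
    refine Finset.sum_congr rfl fun i _ => ?_
    have h1 : Fin.removeNth i.succ (Matrix.vecCons v u) = Matrix.vecCons v (i.removeNth u) := by
      ext j
      refine Fin.cases ?_ (fun j => ?_) j <;> simp [Fin.removeNth]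
    rw [h1, inner1_apply, curryLeft_apply_apply, Fin.val_succ, pow_succ]
    ring

/-- The covector `v ↦ b.repr v i`. -/
def coordForm {ι : Type*} (b : Module.Basis ι ℝ E) (i : ι) : E [⋀^Fin 1]→L[ℝ] ℝ :=
  ofSubsingleton ℝ E ℝ (0 : Fin 1) (LinearMap.toContinuousLinearMap (b.coord i))

theorem coordForm_apply {ι : Type*} (b : Module.Basis ι ℝ E) (i : ι) (v : E) :
    coordForm b i ![v] = b.repr v i := rfl

/-- Euler's identity, used to count degrees, to decompose two-forms, and to lift pointwise values to
global forms by induction on the degree. -/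
theorem sum_outer1_inner1 {ι : Type*} [Fintype ι] (b : Module.Basis ι ℝ E) (x : AltPi E) :
    ∑ i, outer1 (coordForm b i) (inner1 (b i) x) = degreeOp x := by
  funext k
  rw [Finset.sum_apply]
  cases k with
  | zero => simp [degreeOp]
  | succ k =>
    ext v
    simp only [outer1_succ, inner1_apply, ContinuousAlternatingMap.sum_apply, ext1_apply,
      coordForm_apply, curryLeft_apply_apply]
    rw [Finset.sum_comm]
    -- Each of the k + 1 argument slots contributes the form itself once: the basis expansion
    -- rebuilds v a, and the sign of moving it back to slot a cancels.
    have h (a : Fin (k + 1)) : ∑ i, (-1 : ℝ) ^ (a : ℕ) * (b.repr (v a) i *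
        x (k + 1) (Matrix.vecCons (b i) (a.removeNth v))) = x (k + 1) v := by
      have h1 : ∑ i, b.repr (v a) i * x (k + 1) (Matrix.vecCons (b i) (a.removeNth v)) =
          x (k + 1) (Matrix.vecCons (v a) (a.removeNth v)) := by
        conv_rhs => rw [← b.sum_repr (v a)]
        have := map_sum (x (k + 1)).curryLeft (fun i => b.repr (v a) i • b i) Finset.univ
        have := congrArg (fun f => f (a.removeNth v)) this
        simp only [curryLeft_apply_apply, ContinuousAlternatingMap.sum_apply, map_smul,
          ContinuousAlternatingMap.smul_apply, smul_eq_mul] at this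
        exact this.symm
      rw [← Finset.mul_sum, h1]
      have := (x (k + 1)).map_insertNth a (v a) (a.removeNth v)
      rw [Fin.insertNth_self_removeNth, zsmul_eq_mul] at this
      rw [this]
      push_cast
      rfl
    simp only [h]
    simp [degreeOp]

/-- Euler's identity in degree 2 gives 2w = Σ bⁱ ∧ ι_{b_i} w. Commutators with w ∧ · thereby reduce
to those with covectors. -/
theorem outer2_eq {ι : Type*} [Fintype ι] (b : Module.Basis ι ℝ E) (w : E [⋀^Fin 2]→L[ℝ] ℝ)
    (x : AltPi E) : outer2 w x =
      (1 / 2 : ℝ) • ∑ i, outer1 (coordForm b i) (outer1 (w.curryLeft (b i)) x) := by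
  have hw : w = (1 / 2 : ℝ) • ∑ i, wedge (coordForm b i) (w.curryLeft (b i)) := by
    have h := congrFun (sum_outer1_inner1 b (Pi.single 2 w)) 2
    rw [Finset.sum_apply] at h
    simp only [outer1_succ, inner1_apply, degreeOp, LinearMap.coe_mk, AddHom.coe_mk,
      Nat.reduceAdd, Pi.single_eq_same] at h
    have h2 (i : ι) : wedge (coordForm b i) (w.curryLeft (b i)) =
      ext1 (coordForm b i) (w.curryLeft (b i)) := (ext1_eq_wedge_one _ _).symm
    simp only [h2]
    rw [h]
    ext v
    simp
  funext k
  rw [Pi.smul_apply, Finset.sum_apply]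
  match k with
  | 0 => simp
  | 1 => simp
  | k + 2 =>
    ext v
    rw [outer2_add_two, lef_apply]
    have hlin (s : Finset ι) (f : ι → E [⋀^Fin 2]→L[ℝ] ℝ) :
        wedge (∑ i ∈ s, f i) (x k) = ∑ i ∈ s, wedge (f i) (x k) :=
      map_sum (((wedgeL E 2 k).flip (x k))) f s
    conv_lhs => rw [hw, wedge_smul_left, hlin]
    simp only [ContinuousAlternatingMap.smul_apply, ContinuousAlternatingMap.sum_apply,
      wedge_ext1_ext1]
    rfl

end Pointwise


/-! ### The dual contraction, its commutators with ω ∧ ·, and Lagrangian forms. -/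

section Symplectic

open ContinuousAlternatingMap (curryLeft_zero)

variable {E : Type*} [NormedAddCommGroup E] [NormedSpace ℝ E] [FiniteDimensional ℝ E] {k : ℕ}

variable (E) in
/-- The families of alternating forms concentrated in degree `j`. -/
def altDeg (j : ℤ) : Submodule ℝ (AltPi E) where
  carrier := {x | ∀ i : ℕ, (i : ℤ) ≠ j → x i = 0}
  add_mem' hx hy i hi := by rw [Pi.add_apply, hx i hi, hy i hi, add_zero]
  zero_mem' i _ := rfl
  smul_mem' r x hx i hi := by rw [Pi.smul_apply, hx i hi, smul_zero]

theorem outer1_mem {j : ℤ} {x : AltPi E} (hx : x ∈ altDeg E j) (θ : E [⋀^Fin 1]→L[ℝ] ℝ) :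
    outer1 θ x ∈ altDeg E (j + 1) := by
  intro i hi
  cases i with
  | zero => rfl
  | succ i =>
    rw [outer1_succ, hx i (by push_cast at hi; omega), map_zero]

theorem outer2_mem {j : ℤ} {x : AltPi E} (hx : x ∈ altDeg E j) (w : E [⋀^Fin 2]→L[ℝ] ℝ) :
    outer2 w x ∈ altDeg E (j + 2) := by
  intro i hi
  match i with
  | 0 => rfl
  | 1 => rfl
  | i + 2 => rw [outer2_add_two, hx i (by push_cast at hi; omega), map_zero]

theorem inner1_mem {j : ℤ} {x : AltPi E} (hx : x ∈ altDeg E j) (v : E) :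
    inner1 v x ∈ altDeg E (j - 1) := by
  intro i hi
  rw [inner1_apply, hx (i + 1) (by push_cast; omega), curryLeft_zero]
  rfl

theorem wedge_one_one_neg (θ η : E [⋀^Fin 1]→L[ℝ] ℝ) : wedge θ η = -wedge η θ := by
  ext v
  have h := wedge_one_comm θ η v
  rw [pow_one, neg_one_mul] at h
  exact h

theorem outer1_outer1 (θ η : E [⋀^Fin 1]→L[ℝ] ℝ) (x : AltPi E) :
    outer1 θ (outer1 η x) = -outer1 η (outer1 θ x) := by
  funext k
  match k with
  | 0 => exact neg_zero.symm
  | 1 =>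
    change ext1 θ 0 = -ext1 η 0
    rw [map_zero, map_zero, neg_zero]
  | k + 2 =>
    ext v
    change ext1 θ (ext1 η (x k)) v = -ext1 η (ext1 θ (x k)) v
    have h : wedge (-wedge η θ) (x k) = -wedge (wedge η θ) (x k) := by
      have hneg {m : ℕ} (a : E [⋀^Fin m]→L[ℝ] ℝ) : -a = (-1 : ℝ) • a := by ext; simp
      rw [hneg, wedge_smul_left, ← hneg]
    rw [← wedge_ext1_ext1, ← wedge_ext1_ext1, wedge_one_one_neg, h]
    rfl

theorem outer2_outer1 (w : E [⋀^Fin 2]→L[ℝ] ℝ) (θ : E [⋀^Fin 1]→L[ℝ] ℝ) (x : AltPi E) :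
    outer2 w (outer1 θ x) = outer1 θ (outer2 w x) := by
  rw [outer2_eq (Module.finBasis ℝ E), outer2_eq (Module.finBasis ℝ E), map_smul, map_sum]
  congr 1
  refine Finset.sum_congr rfl fun i _ => ?_
  rw [outer1_outer1 _ θ, map_neg, outer1_outer1 _ θ, neg_neg]

theorem outer2_pow_outer1 (w : E [⋀^Fin 2]→L[ℝ] ℝ) (r : ℕ) (θ : E [⋀^Fin 1]→L[ℝ] ℝ)
    (x : AltPi E) : (outer2 w ^ r) (outer1 θ x) = outer1 θ ((outer2 w ^ r) x) := by
  induction r with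
  | zero => rfl
  | succ r ih => rw [pow_succ', Module.End.mul_apply, ih, outer2_outer1, Module.End.mul_apply]

/-- Non-degeneracy of a two-form. -/
def IsNondeg (w : E [⋀^Fin 2]→L[ℝ] ℝ) : Prop := ∀ v, (∀ u, w ![v, u] = 0) → v = 0

/-- A two-form as a bilinear form. -/
def bilin (w : E [⋀^Fin 2]→L[ℝ] ℝ) : LinearMap.BilinForm ℝ E :=
  LinearMap.mk₂ ℝ (fun u v => w ![u, v])
    (fun u u' v => congrArg (fun f => f ![v]) (map_add w.curryLeft u u'))
    (fun r u v => congrArg (fun f => f ![v]) (map_smul w.curryLeft r u))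
    (fun u v v' => by
      have := (w.curryLeft u).map_update_add ![v] 0 v v'
      simpa [Function.update, vec_one_eq] using this)
    (fun r u v => by
      have := (w.curryLeft u).map_update_smul ![v] 0 r v
      simpa [Function.update, vec_one_eq] using this)

theorem bilin_apply (w : E [⋀^Fin 2]→L[ℝ] ℝ) (u v : E) : bilin w u v = w ![u, v] := rfl

theorem curryLeft_eq_bilin (w : E [⋀^Fin 2]→L[ℝ] ℝ) (u v : E) :
    w.curryLeft u ![v] = bilin w u v := rfl

theorem bilin_neg (w : E [⋀^Fin 2]→L[ℝ] ℝ) (u v : E) : bilin w u v = -bilin w v u := by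
  have h := w.map_swap ![v, u] (i := 0) (j := 1) (by decide)
  rw [bilin_apply, bilin_apply, ← show w.toAlternatingMap ![v, u] = w ![v, u] from rfl, ← h]
  change w _ = w _
  congr 1
  ext i; fin_cases i <;> rfl

variable {w : E [⋀^Fin 2]→L[ℝ] ℝ}

theorem IsNondeg.bilin (hw : IsNondeg w) : (bilin w).Nondegenerate :=
  ⟨fun v hv => hw v hv, fun v hv => hw v fun u => by
    rw [← bilin_apply, bilin_neg, hv u, neg_zero]⟩

open Classical in
/-- The basis dual to `b` with respect to a non-degenerate two-form. -/
def IsNondeg.dual (hw : IsNondeg w) {ι : Type*} [Fintype ι] (b : Module.Basis ι ℝ E) :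
    Module.Basis ι ℝ E :=
  LinearMap.BilinForm.dualBasis (LCS.bilin w) hw.bilin b

theorem IsNondeg.bilin_dual (hw : IsNondeg w) {ι : Type*} [Fintype ι] [DecidableEq ι]
    (b : Module.Basis ι ℝ E) (i j : ι) :
    LCS.bilin w (hw.dual b i) (b j) = if j = i then 1 else 0 := by
  refine Eq.trans (@LinearMap.BilinForm.apply_dualBasis_left _ _ _ _ _ _ (Classical.decEq ι) _ _
    hw.bilin b i j) ?_
  split_ifs <;> rfl

theorem IsNondeg.dual_repr (hw : IsNondeg w) {ι : Type*} [Fintype ι]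
    (b : Module.Basis ι ℝ E) (v : E) (i : ι) :
    (hw.dual b).repr v i = LCS.bilin w v (b i) := by
  classical exact LinearMap.BilinForm.dualBasis_repr_apply hw.bilin b v i

theorem IsNondeg.repr_eq (hw : IsNondeg w) {ι : Type*} [Fintype ι]
    (b : Module.Basis ι ℝ E) (v : E) (i : ι) :
    b.repr v i = LCS.bilin w (hw.dual b i) v := by
  classical
  conv_rhs => rw [← b.sum_repr v, map_sum]
  simp [hw.bilin_dual]

/-- The contraction with the bivector dual to a non-degenerate two-form. -/
def IsNondeg.contr (hw : IsNondeg w) : AltPi E →ₗ[ℝ] AltPi E :=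
  (1 / 2 : ℝ) • ∑ i, inner1 (Module.finBasis ℝ E i) ∘ₗ inner1 (hw.dual (Module.finBasis ℝ E) i)

theorem IsNondeg.contr_apply (hw : IsNondeg w) (x : AltPi E) : hw.contr x =
    (1 / 2 : ℝ) • ∑ i, inner1 (Module.finBasis ℝ E i)
      (inner1 (hw.dual (Module.finBasis ℝ E) i) x) := by
  simp [IsNondeg.contr]

theorem contr_mem (hw : IsNondeg w) {j : ℤ} {x : AltPi E} (hx : x ∈ altDeg E j) :
    hw.contr x ∈ altDeg E (j - 2) := by
  rw [hw.contr_apply]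
  refine Submodule.smul_mem _ _ (Submodule.sum_mem _ fun i _ => ?_)
  have := inner1_mem (inner1_mem hx (hw.dual (Module.finBasis ℝ E) i)) (Module.finBasis ℝ E i)
  rwa [show j - 2 = j - 1 - 1 by ring]

/-- In ½ Σ bⁱ ∧ ι_{b_i} w ∧ x the contraction can hit either covector. By skew-symmetry of w both
contributions equal ½ ι_v w ∧ x. -/
theorem inner1_outer2 (v : E) (w : E [⋀^Fin 2]→L[ℝ] ℝ) (x : AltPi E) :
    inner1 v (outer2 w x) = outer1 (w.curryLeft v) x + outer2 w (inner1 v x) := by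
  set b := Module.finBasis ℝ E
  have h1 : ∑ i, (b.repr v i) • w.curryLeft (b i) = w.curryLeft v := by
    conv_rhs => rw [← b.sum_repr v, map_sum]
    simp
  have h2 : ∑ i, (w.curryLeft (b i) ![v]) • coordForm b i = -w.curryLeft v := by
    ext u
    rw [vec_one_eq u]
    simp only [ContinuousAlternatingMap.sum_apply, ContinuousAlternatingMap.smul_apply, coordForm_apply,
      smul_eq_mul]
    rw [ContinuousAlternatingMap.neg_apply, curryLeft_eq_bilin, bilin_neg, neg_neg]
    conv_rhs => rw [← b.sum_repr (u 0), map_sum]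
    simp only [curryLeft_eq_bilin, map_smul, LinearMap.sum_apply, LinearMap.smul_apply,
      smul_eq_mul, mul_comm]
  have e1 : ∑ i, coordForm b i ![v] • outer1 (w.curryLeft (b i)) x = outer1 (w.curryLeft v) x := by
    have := congrArg (outer1L x) h1
    rw [map_sum] at this
    simp only [map_smul] at this
    exact this
  have e2 : ∑ i, w.curryLeft (b i) ![v] • outer1 (coordForm b i) x = -outer1 (w.curryLeft v) x := by
    have := congrArg (outer1L x) h2
    rw [map_sum, map_neg] at this
    simp only [map_smul] at this
    exact this
  rw [outer2_eq b, outer2_eq b, map_smul, map_sum]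
  have h3 (i) : inner1 v (outer1 (coordForm b i) (outer1 (w.curryLeft (b i)) x)) =
      coordForm b i ![v] • outer1 (w.curryLeft (b i)) x
        - w.curryLeft (b i) ![v] • outer1 (coordForm b i) x
        + outer1 (coordForm b i) (outer1 (w.curryLeft (b i)) (inner1 v x)) := by
    rw [inner1_outer1, inner1_outer1, map_sub, map_smul]
    abel
  simp only [h3, Finset.sum_add_distrib, Finset.sum_sub_distrib, e1, e2]
  module

/-- Used to keep forms primitive: if Λx = 0 and ι_a x = 0, then ι_a w ∧ x is again primitive. -/
theorem contr_outer1 (hw : IsNondeg w) (a : E) (x : AltPi E) :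
    hw.contr (outer1 (w.curryLeft a) x) = outer1 (w.curryLeft a) (hw.contr x) - inner1 a x := by
  set f := Module.finBasis ℝ E with hf
  set e := hw.dual f with he
  have h1 : ∑ i, w.curryLeft a ![e i] • f i = -a := by
    conv_rhs => rw [← f.sum_repr a, ← Finset.sum_neg_distrib]
    refine Finset.sum_congr rfl fun i _ => ?_
    rw [hw.repr_eq, curryLeft_eq_bilin, bilin_neg, neg_smul]
  have h2 : ∑ i, w.curryLeft a ![f i] • e i = a := by
    conv_rhs => rw [← e.sum_repr a]
    refine Finset.sum_congr rfl fun i _ => ?_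
    rw [he, hw.dual_repr, curryLeft_eq_bilin]
  have e1 : ∑ i, w.curryLeft a ![e i] • inner1 (f i) x = -inner1 a x := by
    have := congrArg (inner1L x) h1
    rw [map_sum, map_neg] at this
    simp only [map_smul] at this
    exact this
  have e2 : ∑ i, w.curryLeft a ![f i] • inner1 (e i) x = inner1 a x := by
    have := congrArg (inner1L x) h2
    rw [map_sum] at this
    simp only [map_smul] at this
    exact this
  have h3 (i) : inner1 (f i) (inner1 (e i) (outer1 (w.curryLeft a) x)) =
      w.curryLeft a ![e i] • inner1 (f i) x - w.curryLeft a ![f i] • inner1 (e i) x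
        + outer1 (w.curryLeft a) (inner1 (f i) (inner1 (e i) x)) := by
    rw [inner1_outer1, map_sub, map_smul, inner1_outer1]
    abel
  rw [hw.contr_apply, hw.contr_apply, ← hf, ← he]
  simp only [h3, Finset.sum_add_distrib, Finset.sum_sub_distrib, e1, e2, map_smul, map_sum]
  module

/-- Contracting with each pair of dual basis vectors leaves x minus one Euler term for each of the
two bases. Over the 2n pairs this sums to 2n x minus twice the degree, and Λ carries the factor ½.
-/
theorem contr_outer2 (hw : IsNondeg w) {n : ℕ} (hn : Module.finrank ℝ E = 2 * n) (x : AltPi E) :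
    hw.contr (outer2 w x) = outer2 w (hw.contr x) + ((n : ℝ) • x - degreeOp x) := by
  set f := Module.finBasis ℝ E with hf
  set e := hw.dual f with he
  -- The bases are dual under w, so contraction with w exchanges basis vectors and coordinate
  -- covectors, with opposite signs in the two directions.
  have h1 (i) : w.curryLeft (e i) = coordForm f i := by
    ext u
    rw [vec_one_eq u, coordForm_apply, curryLeft_eq_bilin, hw.repr_eq]
  have h2 (i) : w.curryLeft (f i) = -coordForm e i := by
    ext u
    rw [vec_one_eq u, ContinuousAlternatingMap.neg_apply, coordForm_apply, curryLeft_eq_bilin, he,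
      hw.dual_repr, bilin_neg]
  have h3 (i) : inner1 (f i) (inner1 (e i) (outer2 w x)) =
      x - outer1 (coordForm f i) (inner1 (f i) x) - outer1 (coordForm e i) (inner1 (e i) x)
        + outer2 w (inner1 (f i) (inner1 (e i) x)) := by
    have h4 := map_neg (outer1L (inner1 (e i) x)) (coordForm e i)
    change outer1 (-coordForm e i) (inner1 (e i) x) = -outer1 (coordForm e i) (inner1 (e i) x) at h4
    rw [inner1_outer2, map_add, inner1_outer1, inner1_outer2, h1, h2, h4, coordForm_apply,
      Module.Basis.repr_self, Finsupp.single_eq_same, one_smul]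
    abel
  rw [hw.contr_apply, hw.contr_apply, ← hf, ← he]
  simp only [h3, Finset.sum_add_distrib, Finset.sum_sub_distrib, sum_outer1_inner1, map_smul,
    map_sum, Finset.sum_const, Finset.card_univ, Fintype.card_fin, hn]
  rw [← Nat.cast_smul_eq_nsmul ℝ]
  push_cast
  module

theorem altDeg_eq_zero {j : ℤ} (hj : Module.finrank ℝ E < j) {x : AltPi E} (hx : x ∈ altDeg E j) :
    x = 0 := by
  funext i
  by_cases h : (i : ℤ) = j
  · ext v
    refine AlternatingMap.map_linearDependent (x i).toAlternatingMap v fun hv => ?_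
    have := hv.fintype_card_le_finrank
    rw [Fintype.card_fin] at this
    omega
  · exact hx i h

theorem IsNondeg.lefschetzPair (hw : IsNondeg w) {n : ℕ} (hn : Module.finrank ℝ E = 2 * n) :
    LefschetzPair n (altDeg E) (outer2 w) hw.contr where
  L_mem _ _ hx := outer2_mem hx w
  Λ_mem _ _ hx := contr_mem hw hx
  comm j x hx := by
    rw [contr_outer2 hw hn, sub_smul]
    congr 2
    funext i
    change (i : ℝ) • x i = (j : ℝ) • x i
    by_cases h : (i : ℤ) = j
    · rw [← h]; simp
    · rw [hx i h, smul_zero, smul_zero]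
  eq_zero_of_neg j hj x hx := funext fun i => hx i (by omega)
  eq_zero_of_gt j hj x hx := altDeg_eq_zero (by omega) hx

/-- A non-zero primitive form of degree `j`, annihilated by the contraction with all vectors
orthogonal to an isotropic subspace of dimension `j`. -/
def IsLagrangianForm (hw : IsNondeg w) (j : ℕ) (W : Submodule ℝ E) (x : AltPi E) : Prop :=
  Module.finrank ℝ W = j ∧ (∀ a ∈ W, ∀ b ∈ W, bilin w a b = 0) ∧ x ∈ altDeg E j ∧ x ≠ 0 ∧
    hw.contr x = 0 ∧ ∀ b, (∀ a ∈ W, bilin w a b = 0) → inner1 b x = 0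

/-- The isotropic subspace is enlarged by a vector v orthogonal to it, and the form is multiplied by
ι_v w. Starting from the constant 1, this produces products of covectors dual to isotropic vectors.
-/
theorem IsLagrangianForm.succ (hw : IsNondeg w) {n j : ℕ} (hn : Module.finrank ℝ E = 2 * n)
    (hj : j + 1 ≤ n) {W : Submodule ℝ E} {x : AltPi E} (h : IsLagrangianForm hw j W x) :
    ∃ (v : E) (W' : Submodule ℝ E), IsLagrangianForm hw (j + 1) W' (outer1 (w.curryLeft v) x) := by
  obtain ⟨h1, h2, h3, h4, h5, h6⟩ := h
  -- The orthogonal of W has dimension 2n - j, which exceeds j because j < n.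
  obtain ⟨v, hv, hvW⟩ : ∃ v ∈ (bilin w).orthogonal W, v ∉ W := by
    by_contra! hc
    have := Submodule.finrank_mono (show (bilin w).orthogonal W ≤ W from hc)
    rw [LinearMap.BilinForm.finrank_orthogonal hw.bilin, hn, h1] at this
    omega
  have hv' : ∀ a ∈ W, bilin w a v = 0 := fun a ha => hv a ha
  have hvv : bilin w v v = 0 := by
    have := bilin_neg w v v
    linarith
  have hmem : ∀ b, (∀ a ∈ W ⊔ Submodule.span ℝ {v}, bilin w a b = 0) →
      (∀ a ∈ W, bilin w a b = 0) ∧ bilin w v b = 0 := fun b hb =>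
    ⟨fun a ha => hb a (Submodule.mem_sup_left ha),
      hb v (Submodule.mem_sup_right (Submodule.mem_span_singleton_self v))⟩
  refine ⟨v, W ⊔ Submodule.span ℝ {v}, ?_, ?_, ?_, ?_, ?_, ?_⟩
  · have hv0 : v ≠ 0 := by
      rintro rfl
      exact hvW W.zero_mem
    have := Submodule.finrank_sup_add_finrank_inf_eq W (Submodule.span ℝ {v})
    rw [(Submodule.disjoint_span_singleton_of_notMem hvW).eq_bot, finrank_bot,
      finrank_span_singleton hv0, h1] at this
    omega
  · intro a ha b hb
    obtain ⟨a', ha', a'', ha'', rfl⟩ := Submodule.mem_sup.1 ha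
    obtain ⟨b', hb', b'', hb'', rfl⟩ := Submodule.mem_sup.1 hb
    obtain ⟨s, rfl⟩ := Submodule.mem_span_singleton.1 ha''
    obtain ⟨t, rfl⟩ := Submodule.mem_span_singleton.1 hb''
    have := bilin_neg w v b'
    rw [hv' b' hb', neg_zero] at this
    simp [h2 a' ha' b' hb', hv' a' ha', hvv, this]
  · exact_mod_cast outer1_mem h3 _
  -- The vector u representing φ is orthogonal to W but not to v, so ι_u of the new form is w(v, u)
  -- x ≠ 0.
  · obtain ⟨φ, hφ, hφW⟩ := Submodule.exists_le_ker_of_notMem hvW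
    set u := ((bilin w).toDual hw.bilin).symm φ with hu
    have hφu (a : E) : bilin w u a = φ a := LinearMap.BilinForm.apply_toDual_symm_apply _ _
    intro h0
    have h7 := inner1_outer1 u (w.curryLeft v) x
    rw [h0, _root_.map_zero, h6 u fun a ha => by
      rw [bilin_neg, hφu, LinearMap.mem_ker.1 (hφW ha), neg_zero], _root_.map_zero, sub_zero,
      curryLeft_eq_bilin, bilin_neg, hφu] at h7
    rcases smul_eq_zero.1 h7.symm with h | h
    · exact hφ (neg_eq_zero.1 h)
    · exact h4 h
  · rw [contr_outer1, h5, h6 v hv', _root_.map_zero, sub_zero]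
  · intro b hb
    obtain ⟨hb1, hb2⟩ := hmem b hb
    rw [inner1_outer1, h6 b hb1, curryLeft_eq_bilin, hb2, zero_smul, _root_.map_zero, sub_zero]

theorem exists_isLagrangianForm (hw : IsNondeg w) {n : ℕ} (hn : Module.finrank ℝ E = 2 * n) (j : ℕ)
    (hj : j ≤ n) : ∃ W x, IsLagrangianForm hw j W x := by
  induction j with
  | zero =>
    refine ⟨⊥, Pi.single 0 (ContinuousAlternatingMap.constOfIsEmpty ℝ E (Fin 0) (1 : ℝ)),
      finrank_bot ℝ E, ?_, ?_, ?_, ?_, ?_⟩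
    · rintro a ha b -
      rw [(Submodule.mem_bot ℝ).1 ha]
      simp
    · intro i hi
      exact Pi.single_eq_of_ne (by exact_mod_cast hi) _
    · intro h0
      have := congrArg (fun f : AltPi E => f 0 ![]) h0
      simp at this
    · rw [hw.contr_apply]
      have h (v : E) : inner1 v (Pi.single 0 (ContinuousAlternatingMap.constOfIsEmpty ℝ E (Fin 0)
          (1 : ℝ)) : AltPi E) = 0 := by
        funext i
        rw [inner1_apply, Pi.single_eq_of_ne (Nat.succ_ne_zero i), curryLeft_zero]
        rfl
      simp [h]
    · intro v _
      funext i
      rw [inner1_apply, Pi.single_eq_of_ne (Nat.succ_ne_zero i), curryLeft_zero]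
      rfl
  | succ j ih =>
    obtain ⟨W, x, h⟩ := ih (by omega)
    obtain ⟨v, W', h'⟩ := h.succ hw hn hj
    exact ⟨W', _, h'⟩

/-- The existence of a covector at which the symbol of the second order operator
`η ↦ d (L⁻¹ d η)` on forms of middle degree does not vanish. -/
theorem exists_symbol_ne_zero (hw : IsNondeg w) {n : ℕ} (hn : Module.finrank ℝ E = 2 * n) (i r : ℕ)
    (hir : i + 1 + r = n) : ∃ (θ : E [⋀^Fin 1]→L[ℝ] ℝ), ∃ γ ∈ altDeg E i, ∃ η ∈ altDeg E (i + 1),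
      outer1 θ γ ≠ 0 ∧ (outer2 w ^ r) (outer1 θ η) = (outer2 w ^ (r + 1)) γ := by
  have hP := hw.lefschetzPair hn
  obtain ⟨W, γ, h⟩ := exists_isLagrangianForm hw hn i (by omega)
  obtain ⟨v, W', h'⟩ := h.succ hw hn (by omega)
  -- With θ = ι_v w, the form θ ∧ γ is primitive of degree i + 1 = n - r, so L^{r+1} kills it.
  have h0 : (outer2 w ^ (r + 1)) (outer1 (w.curryLeft v) γ) = 0 := by
    refine hP.L_pow_eq_zero_of_primitive (j := (i : ℤ) + 1) ?_ h'.2.2.2.2.1 _ ?_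
    · exact_mod_cast h'.2.2.1
    · push_cast; omega
  obtain ⟨u, hu⟩ : ∃ u, w.curryLeft v ![u] ≠ 0 := by
    by_contra! hc
    refine h'.2.2.2.1 ?_
    have : w.curryLeft v = 0 := by
      ext a; rw [vec_one_eq a]; exact hc _
    rw [this]
    exact _root_.map_zero (outer1L γ)
  set c := w.curryLeft v ![u]
  set y := (outer2 w ^ (r + 1)) γ with hy
  have hy0 : outer1 (w.curryLeft v) y = 0 := by rw [hy, ← outer2_pow_outer1, h0]
  have hymem : y ∈ altDeg E (i + 2 * ((r + 1 : ℕ) : ℤ)) := hP.L_pow_mem (r + 1) h.2.2.1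
  have hzmem : c⁻¹ • inner1 u y ∈ altDeg E ((n : ℤ) + r) := by
    refine Submodule.smul_mem _ _ ?_
    convert inner1_mem hymem u using 2
    push_cast; omega
  -- Since θ ∧ y = 0 and θ(u) = c ≠ 0, one has y = θ ∧ (c⁻¹ ι_u y). The second factor has degree n +
  -- r, hence is L^r η for some η of degree n - r = i + 1.
  obtain ⟨η, hη, hLη⟩ := hP.exists_L_pow_eq hzmem r (by omega)
  refine ⟨w.curryLeft v, γ, h.2.2.1, η, ?_, h'.2.2.2.1, ?_⟩
  · convert hη using 2; omega
  · have h1 := inner1_outer1 u (w.curryLeft v) y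
    rw [hy0, _root_.map_zero, eq_comm, sub_eq_zero] at h1
    rw [outer2_pow_outer1, hLη, map_smul, ← h1, smul_smul, inv_mul_cancel₀ hu, one_smul]

end Symplectic


/-! ### Operators on global forms: functions, wedge products, exterior derivative. -/

section GlobalForms

open DirectSum

variable {E : Type*} [NormedAddCommGroup E] [NormedSpace ℝ E] [FiniteDimensional ℝ E]
  {M : Type*} [TopologicalSpace M] [ChartedSpace E M] [IsManifold 𝓘(ℝ, E) ∞ M] {k l m : ℕ}

/-- A smooth function, viewed as a form of degree zero. -/
def ofFun (f : C^∞⟮𝓘(ℝ, E), M; 𝓘(ℝ, ℝ), ℝ⟯) : Form E M 0 :=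
  ⟨fun x => ContinuousAlternatingMap.constOfIsEmpty ℝ (TangentSpace 𝓘(ℝ, E) x) (Fin 0) (f x),
    fun c => by
      have h : ContDiffOn ℝ ∞ (fun y => f ((chartAt E c).symm y)) (chartAt E c).target :=
        contMDiffOn_iff_contDiffOn.1
          (f.contMDiff.comp_contMDiffOn (contMDiffOn_chart_symm (I := 𝓘(ℝ, E))))
      exact (ContinuousAlternatingMap.constOfIsEmptyLIE ℝ E ℝ (Fin 0)).contDiff.comp_contDiffOn h⟩

/-- The product of a form with a smooth function. -/
def mulForm (f : C^∞⟮𝓘(ℝ, E), M; 𝓘(ℝ, ℝ), ℝ⟯) : Form E M k →ₗ[ℝ] Form E M k where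
  toFun α := ⟨fun x => f x • α.1 x, fun c => by
    have h : ContDiffOn ℝ ∞ (fun y => f ((chartAt E c).symm y)) (chartAt E c).target :=
      contMDiffOn_iff_contDiffOn.1
        (f.contMDiff.comp_contMDiffOn (contMDiffOn_chart_symm (I := 𝓘(ℝ, E))))
    exact h.smul (α.2 c)⟩
  map_add' α β := Subtype.ext (funext fun x => smul_add (f x) (α.1 x) (β.1 x))
  map_smul' r α := Subtype.ext (funext fun x => smul_comm (f x) r (α.1 x))

/-- The exterior product with a homogeneous form. -/
def wedgeOp (a : Form E M m) : TotalForm E M →ₗ[ℝ] TotalForm E M :=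
  DirectSum.toModule ℝ ℕ _ fun k => tot (m + k) ∘ₗ wedgeForm a

/-- The exterior derivative on `Ω^*(M)`. -/
def extDOp : TotalForm E M →ₗ[ℝ] TotalForm E M :=
  DirectSum.toModule ℝ ℕ _ fun k => tot (k + 1) ∘ₗ extD

/-- The product with a smooth function on `Ω^*(M)`. -/
def mulOp (f : C^∞⟮𝓘(ℝ, E), M; 𝓘(ℝ, ℝ), ℝ⟯) : TotalForm E M →ₗ[ℝ] TotalForm E M :=
  DirectSum.toModule ℝ ℕ _ fun k => tot k ∘ₗ mulForm f

@[simp] theorem wedgeOp_tot (a : Form E M m) (α : Form E M k) :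
    wedgeOp a (tot k α) = tot (m + k) (wedgeForm a α) := by
  simp [wedgeOp, tot]

@[simp] theorem extDOp_tot (α : Form E M k) : extDOp (tot k α) = tot (k + 1) (extD α) := by
  simp [extDOp, tot]

@[simp] theorem mulOp_tot (f : C^∞⟮𝓘(ℝ, E), M; 𝓘(ℝ, ℝ), ℝ⟯) (α : Form E M k) :
    mulOp f (tot k α) = tot k (mulForm f α) := by
  simp [mulOp, tot]

theorem twistedD_apply (θ : Form E M 1) (x : TotalForm E M) :
    twistedD θ x = extDOp x + wedgeOp θ x := by
  have h : twistedD θ = extDOp + wedgeOp θ := by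
    refine DirectSum.linearMap_ext ℝ fun k => LinearMap.ext fun α => ?_
    change twistedD θ (tot k α) = extDOp (tot k α) + wedgeOp θ (tot k α)
    rw [twistedD_tot, extDOp_tot, wedgeOp_tot]
  rw [h]; rfl

theorem wedgeOp_add (a b : Form E M m) (x : TotalForm E M) :
    wedgeOp (a + b) x = wedgeOp a x + wedgeOp b x := by
  have h : wedgeOp (a + b) = wedgeOp a + wedgeOp b := by
    refine DirectSum.linearMap_ext ℝ fun k => LinearMap.ext fun α => ?_
    change wedgeOp (a + b) (tot k α) = wedgeOp a (tot k α) + wedgeOp b (tot k α)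
    rw [wedgeOp_tot, wedgeOp_tot, wedgeOp_tot, wedgeForm_add_left, map_add]
  rw [h]; rfl

theorem wedgeOp_smul (r : ℝ) (a : Form E M m) (x : TotalForm E M) :
    wedgeOp (r • a) x = r • wedgeOp a x := by
  have h : wedgeOp (r • a) = r • wedgeOp a := by
    refine DirectSum.linearMap_ext ℝ fun k => LinearMap.ext fun α => ?_
    change wedgeOp (r • a) (tot k α) = r • wedgeOp a (tot k α)
    rw [wedgeOp_tot, wedgeOp_tot, wedgeForm_smul_left, map_smul]
  rw [h]; rfl

theorem wedgeOp_wedgeOp (a : Form E M m) (b : Form E M l) (x : TotalForm E M) :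
    wedgeOp a (wedgeOp b x) = wedgeOp (wedgeForm a b) x := by
  have h : wedgeOp a ∘ₗ wedgeOp b = wedgeOp (wedgeForm a b) := by
    refine DirectSum.linearMap_ext ℝ fun k => LinearMap.ext fun α => ?_
    change wedgeOp a (wedgeOp b (tot k α)) = wedgeOp (wedgeForm a b) (tot k α)
    rw [wedgeOp_tot, wedgeOp_tot, wedgeOp_tot, tot_wedge_assoc]
  rw [← h]; rfl

theorem extDOp_wedgeOp (a : Form E M m) (x : TotalForm E M) :
    extDOp (wedgeOp a x) = wedgeOp (extD a) x + (-1 : ℝ) ^ m • wedgeOp a (extDOp x) := by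
  have h : extDOp ∘ₗ wedgeOp a = wedgeOp (extD a) + (-1 : ℝ) ^ m • (wedgeOp a ∘ₗ extDOp) := by
    refine DirectSum.linearMap_ext ℝ fun k => LinearMap.ext fun α => ?_
    change extDOp (wedgeOp a (tot k α)) =
      wedgeOp (extD a) (tot k α) + (-1 : ℝ) ^ m • wedgeOp a (extDOp (tot k α))
    rw [wedgeOp_tot, wedgeOp_tot, extDOp_tot, extDOp_tot, wedgeOp_tot, tot_extD_wedge]
  exact congrArg (fun f => f x) h

/-- Lets products with functions be treated as wedge products with zero-forms, so that their Leibniz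
rule is a special case of the graded one. -/
theorem wedge_const_left {V : Type*} [NormedAddCommGroup V] [NormedSpace ℝ V] (r : ℝ)
    (a : V [⋀^Fin k]→L[ℝ] ℝ) (v : Fin k → V) :
    wedge (ContinuousAlternatingMap.constOfIsEmpty ℝ V (Fin 0) r) a
      (fun i => v (Fin.cast (zero_add k) i)) = r * a v := by
  rw [wedge_apply, altSum_cast]
  have h (σ : Equiv.Perm (Fin k)) :
        ((Equiv.Perm.sign σ : ℤ) : ℝ) * a (fun i => v (σ i)) = a v := by
    have := a.toAlternatingMap.map_perm v σ
    change a (fun i => v (σ i)) = Equiv.Perm.sign σ • a v at this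
    rw [this, Units.smul_def, zsmul_eq_mul, ← mul_assoc, ← Int.cast_mul, ← Units.val_mul,
      Int.units_mul_self]
    simp
  have h1 (i : Fin k) : Fin.cast (zero_add k) (Fin.natAdd 0 i) = i := by ext; simp
  simp only [ContinuousAlternatingMap.constOfIsEmpty_apply, h1]
  rw [altSum_const_mul]
  simp only [altSum, h]
  simp [Fintype.card_perm]
  field_simp

theorem wedgeOp_ofFun (f : C^∞⟮𝓘(ℝ, E), M; 𝓘(ℝ, ℝ), ℝ⟯) (x : TotalForm E M) :
    wedgeOp (ofFun f) x = mulOp f x := by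
  have h : wedgeOp (ofFun f) = mulOp f := by
    refine DirectSum.linearMap_ext ℝ fun k => LinearMap.ext fun α => ?_
    change wedgeOp (ofFun f) (tot k α) = mulOp f (tot k α)
    rw [wedgeOp_tot, mulOp_tot]
    symm
    refine tot_congr (zero_add k) _ _ fun x v => ?_
    exact (wedge_const_left (V := E) (f x) (α.1 x) v).symm
  rw [h]

/-- The differential of a smooth function. -/
def dFun (f : C^∞⟮𝓘(ℝ, E), M; 𝓘(ℝ, ℝ), ℝ⟯) : Form E M 1 := extD (ofFun f)

theorem extDOp_mulOp (f : C^∞⟮𝓘(ℝ, E), M; 𝓘(ℝ, ℝ), ℝ⟯) (x : TotalForm E M) :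
    extDOp (mulOp f x) = wedgeOp (dFun f) x + mulOp f (extDOp x) := by
  rw [← wedgeOp_ofFun, extDOp_wedgeOp, pow_zero, one_smul, wedgeOp_ofFun]
  rfl

theorem dFun_apply (f : C^∞⟮𝓘(ℝ, E), M; 𝓘(ℝ, ℝ), ℝ⟯) (x : M)
    (v : Fin 1 → TangentSpace 𝓘(ℝ, E) x) :
    (dFun f).1 x v = mfderiv 𝓘(ℝ, E) 𝓘(ℝ, ℝ) f x (v 0) := by
  have hx := mem_chart_target E x
  have hsymm : ContMDiffAt 𝓘(ℝ, E) 𝓘(ℝ, E) ∞ (chartAt E x).symm (chartAt E x x) :=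
    (contMDiffOn_chart_symm (I := 𝓘(ℝ, E))).contMDiffAt ((chartAt E x).open_target.mem_nhds hx)
  have h5 : (chartAt E x).symm (chartAt E x x) = x :=
    (chartAt E x).left_inv (mem_chart_source E x)
  have h1 : extDeriv (chartRep x (ofFun f).1) (chartAt E x x) =
      ContinuousAlternatingMap.ofSubsingleton ℝ E ℝ (0 : Fin 1)
        (fderiv ℝ (fun y => f ((chartAt E x).symm y)) (chartAt E x x)) :=
    extDeriv_constOfIsEmpty (fun y => f ((chartAt E x).symm y)) (chartAt E x x)
  have h6 : (show E →L[ℝ] ℝ from mfderiv 𝓘(ℝ, E) 𝓘(ℝ, ℝ) f ((chartAt E x).symm (chartAt E x x))) =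
      (show E →L[ℝ] ℝ from mfderiv 𝓘(ℝ, E) 𝓘(ℝ, ℝ) f x) :=
    congrArg (fun z => (show E →L[ℝ] ℝ from mfderiv 𝓘(ℝ, E) 𝓘(ℝ, ℝ) f z)) h5
  have h2 : fderiv ℝ (fun y => f ((chartAt E x).symm y)) (chartAt E x x) =
      (show E →L[ℝ] ℝ from mfderiv 𝓘(ℝ, E) 𝓘(ℝ, ℝ) f x).comp
        (show E →L[ℝ] E from mfderiv 𝓘(ℝ, E) 𝓘(ℝ, E) (chartAt E x).symm (chartAt E x x)) := by
    rw [← mfderiv_eq_fderiv, ← h6]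
    exact mfderiv_comp (I := 𝓘(ℝ, E)) (I' := 𝓘(ℝ, E)) (I'' := 𝓘(ℝ, ℝ)) (chartAt E x x)
      (g := f) (f := (chartAt E x).symm)
      (f.contMDiff.mdifferentiable (by simp) _) (hsymm.mdifferentiableAt (by simp))
  change extDeriv (chartRep x (ofFun f).1) (chartAt E x x) (fun i =>
      (show TangentSpace 𝓘(ℝ, E) x →L[ℝ] E from mfderiv 𝓘(ℝ, E) 𝓘(ℝ, E) (chartAt E x) x) (v i)) = _
  rw [h1, h2]
  exact congrArg _ (chart_symm_deriv x (mem_chart_source E x) (v 0))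

end GlobalForms


/-! ### Pointwise evaluation and homogeneous components of global forms. -/

section Evaluation

open DirectSum

variable {E : Type*} [NormedAddCommGroup E] [NormedSpace ℝ E] [FiniteDimensional ℝ E]
  {M : Type*} [TopologicalSpace M] [ChartedSpace E M] [IsManifold 𝓘(ℝ, E) ∞ M] {k l m : ℕ}

/-- The value of a form at a point, as an alternating form on the model space. -/
def valAt (α : Form E M k) (p : M) : E [⋀^Fin k]→L[ℝ] ℝ := α.1 p

/-- The value at a point of a form in `Ω^*(M)`. -/
def evalAt (p : M) : TotalForm E M →ₗ[ℝ] AltPi E where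
  toFun x k := valAt (x k) p
  map_add' _ _ := rfl
  map_smul' _ _ := rfl

theorem evalAt_apply (p : M) (x : TotalForm E M) (k : ℕ) : evalAt p x k = valAt (x k) p := rfl

/-- Identities between zeroth order operators are proved below by evaluating at each point and using
the algebra of `AltPi`. -/
theorem total_ext {x y : TotalForm E M} (h : ∀ p, evalAt p x = evalAt p y) : x = y :=
  DFinsupp.ext fun k => Subtype.ext (funext fun p => congrFun (h p) k)

theorem tot_apply_same (α : Form E M k) : (tot k α : TotalForm E M) k = α :=
  DFinsupp.single_eq_same (β := fun k => Form E M k)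

theorem tot_apply_ne (α : Form E M k) (h : l ≠ k) : (tot k α : TotalForm E M) l = 0 :=
  DFinsupp.single_eq_of_ne (β := fun k => Form E M k) h

theorem evalAt_tot (p : M) (α : Form E M k) :
    evalAt p (tot k α) = Pi.single k (valAt α p) := by
  funext l
  by_cases h : l = k
  · subst h
    rw [evalAt_apply, tot_apply_same, Pi.single_eq_same]
  · rw [evalAt_apply, tot_apply_ne α h, Pi.single_eq_of_ne h]
    rfl

theorem single_castForm (h : k = l) (a : E [⋀^Fin k]→L[ℝ] ℝ) :
    (Pi.single k a : AltPi E) = Pi.single l (castForm h a) := by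
  subst h; rfl

theorem outer1_single (θ : E [⋀^Fin 1]→L[ℝ] ℝ) (a : E [⋀^Fin k]→L[ℝ] ℝ) :
    outer1 θ (Pi.single k a) = Pi.single (k + 1) (ext1 θ a) := by
  funext l
  cases l with
  | zero => rw [outer1_zero, Pi.single_eq_of_ne (Nat.succ_ne_zero k).symm]
  | succ l =>
    rw [outer1_succ]
    by_cases h : l = k
    · subst h; rw [Pi.single_eq_same, Pi.single_eq_same]
    · rw [Pi.single_eq_of_ne h, Pi.single_eq_of_ne (by omega), map_zero]

theorem outer2_single (w : E [⋀^Fin 2]→L[ℝ] ℝ) (a : E [⋀^Fin k]→L[ℝ] ℝ) :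
    outer2 w (Pi.single k a) = Pi.single (k + 2) (lef w a) := by
  funext l
  match l with
  | 0 => rw [outer2_zero, Pi.single_eq_of_ne (by omega)]
  | 1 => rw [outer2_one, Pi.single_eq_of_ne (by omega)]
  | l + 2 =>
    rw [outer2_add_two]
    by_cases h : l = k
    · subst h; rw [Pi.single_eq_same, Pi.single_eq_same]
    · rw [Pi.single_eq_of_ne h, Pi.single_eq_of_ne (by omega), map_zero]

theorem evalAt_wedgeOp_one (p : M) (θ : Form E M 1) (x : TotalForm E M) :
    evalAt p (wedgeOp θ x) = outer1 (valAt θ p) (evalAt p x) := by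
  have h : evalAt p ∘ₗ wedgeOp θ = outer1 (valAt θ p) ∘ₗ evalAt p := by
    refine DirectSum.linearMap_ext ℝ fun k => LinearMap.ext fun α => ?_
    change evalAt p (wedgeOp θ (tot k α)) = outer1 (valAt θ p) (evalAt p (tot k α))
    rw [wedgeOp_tot, evalAt_tot, evalAt_tot, outer1_single, single_castForm (add_comm 1 k)]
    congr 1
    ext v
    rw [castForm_apply, ← wedge_eq_ext1]
    rfl
  exact congrArg (fun f => f x) h

theorem evalAt_wedgeOp_two (p : M) (ω₀ : Form E M 2) (x : TotalForm E M) :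
    evalAt p (wedgeOp ω₀ x) = outer2 (valAt ω₀ p) (evalAt p x) := by
  have h : evalAt p ∘ₗ wedgeOp ω₀ = outer2 (valAt ω₀ p) ∘ₗ evalAt p := by
    refine DirectSum.linearMap_ext ℝ fun k => LinearMap.ext fun α => ?_
    change evalAt p (wedgeOp ω₀ (tot k α)) = outer2 (valAt ω₀ p) (evalAt p (tot k α))
    rw [wedgeOp_tot, evalAt_tot, evalAt_tot, outer2_single, single_castForm (add_comm 2 k)]
    rfl
  exact congrArg (fun f => f x) h

theorem evalAt_mulOp (p : M) (f : C^∞⟮𝓘(ℝ, E), M; 𝓘(ℝ, ℝ), ℝ⟯) (x : TotalForm E M) :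
    evalAt p (mulOp f x) = f p • evalAt p x := by
  have h : evalAt p ∘ₗ mulOp f = f p • (evalAt p : TotalForm E M →ₗ[ℝ] AltPi E) := by
    refine DirectSum.linearMap_ext ℝ fun k => LinearMap.ext fun α => ?_
    change evalAt p (mulOp f (tot k α)) = f p • evalAt p (tot k α)
    rw [mulOp_tot, evalAt_tot, evalAt_tot]
    funext l
    by_cases h : l = k
    · subst h
      rw [Pi.smul_apply, Pi.single_eq_same, Pi.single_eq_same]
      rfl
    · rw [Pi.smul_apply, Pi.single_eq_of_ne h, Pi.single_eq_of_ne h, smul_zero]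
  exact congrArg (fun f => f x) h

theorem evalAt_wedgeOp_two_pow (p : M) (ω₀ : Form E M 2) (r : ℕ) (x : TotalForm E M) :
    evalAt p ((wedgeOp ω₀ ^ r) x) = (outer2 (valAt ω₀ p) ^ r) (evalAt p x) := by
  induction r with
  | zero => rfl
  | succ r ih =>
    rw [pow_succ', pow_succ', Module.End.mul_apply, Module.End.mul_apply, evalAt_wedgeOp_two, ih]

variable (E M) in
/-- The projection of `Ω^*(M)` to `Ω^j(M)`. -/
def degProj (j : ℤ) : TotalForm E M →ₗ[ℝ] TotalForm E M :=
  DirectSum.toModule ℝ ℕ _ fun k => if (k : ℤ) = j then tot k else 0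

theorem degProj_tot (j : ℤ) (α : Form E M k) :
    degProj E M j (tot k α) = if (k : ℤ) = j then tot k α else 0 := by
  by_cases h : (k : ℤ) = j <;> simp [degProj, tot, h]

theorem tot_mem {j : ℤ} (h : (k : ℤ) = j) (α : Form E M k) : tot k α ∈ degreePart E M j := by
  intro a ha
  exact tot_apply_ne α fun h' => ha (by rw [h', h])

theorem degProj_mem (j : ℤ) (x : TotalForm E M) : degProj E M j x ∈ degreePart E M j := by
  have h : (degreePart E M j).mkQ ∘ₗ degProj E M j = 0 := by
    refine DirectSum.linearMap_ext ℝ fun k => LinearMap.ext fun α => ?_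
    change (degreePart E M j).mkQ (degProj E M j (tot k α)) = 0
    rw [Submodule.mkQ_apply, Submodule.Quotient.mk_eq_zero, degProj_tot]
    split_ifs with h
    · exact tot_mem h α
    · exact zero_mem _
  exact (Submodule.Quotient.mk_eq_zero _).1 (congrArg (fun f => f x) h)

theorem eq_zero_or_eq_tot {j : ℤ} {x : TotalForm E M} (hx : x ∈ degreePart E M j) :
    x = 0 ∨ ∃ (i : ℕ) (α : Form E M i), (i : ℤ) = j ∧ x = tot i α := by
  by_cases h : ∃ i : ℕ, (i : ℤ) = j
  · obtain ⟨i, hi⟩ := h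
    refine Or.inr ⟨i, x i, hi, DFinsupp.ext fun a => ?_⟩
    by_cases ha : a = i
    · subst ha
      exact (tot_apply_same _).symm
    · rw [hx a (fun h => ha (by exact_mod_cast h.trans hi.symm))]
      exact (tot_apply_ne _ ha).symm
  · exact Or.inl (DFinsupp.ext fun a => hx a fun ha => h ⟨a, ha⟩)

theorem degProj_of_mem {j : ℤ} {x : TotalForm E M} (hx : x ∈ degreePart E M j) :
    degProj E M j x = x := by
  rcases eq_zero_or_eq_tot hx with rfl | ⟨i, α, hi, rfl⟩
  · exact map_zero _
  · rw [degProj_tot, if_pos hi]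

theorem degProj_wedgeOp (j : ℤ) (a : Form E M m) (x : TotalForm E M) :
    degProj E M (j + m) (wedgeOp a x) = wedgeOp a (degProj E M j x) := by
  have h : degProj E M (j + m) ∘ₗ wedgeOp a = wedgeOp a ∘ₗ degProj E M j := by
    refine DirectSum.linearMap_ext ℝ fun k => LinearMap.ext fun α => ?_
    change degProj E M (j + m) (wedgeOp a (tot k α)) = wedgeOp a (degProj E M j (tot k α))
    rw [wedgeOp_tot, degProj_tot, degProj_tot]
    by_cases h : (k : ℤ) = j
    · rw [if_pos h, if_pos (by push_cast; omega), wedgeOp_tot]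
    · rw [if_neg h, if_neg (by push_cast; omega), map_zero]
  exact congrArg (fun f => f x) h

theorem wedgeOp_mem {j : ℤ} (a : Form E M m) {x : TotalForm E M} (hx : x ∈ degreePart E M j) :
    wedgeOp a x ∈ degreePart E M (j + m) := by
  rw [← degProj_of_mem hx, ← degProj_wedgeOp]
  exact degProj_mem _ _

theorem mulOp_mem {j : ℤ} (f : C^∞⟮𝓘(ℝ, E), M; 𝓘(ℝ, ℝ), ℝ⟯) {x : TotalForm E M}
    (hx : x ∈ degreePart E M j) : mulOp f x ∈ degreePart E M j := by
  rw [← wedgeOp_ofFun]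
  simpa using wedgeOp_mem (ofFun f) hx

theorem evalAt_mem {j : ℤ} {x : TotalForm E M} (hx : x ∈ degreePart E M j) (p : M) :
    evalAt p x ∈ altDeg E j := fun i hi => by
  rw [evalAt_apply, hx i hi]
  rfl

theorem degProj_wedgeOp_two_pow (j : ℤ) (ω₀ : Form E M 2) (r : ℕ) (x : TotalForm E M) :
    degProj E M (j + 2 * r) ((wedgeOp ω₀ ^ r) x) = (wedgeOp ω₀ ^ r) (degProj E M j x) := by
  induction r with
  | zero => simp
  | succ r ih =>
    rw [pow_succ', Module.End.mul_apply, Module.End.mul_apply, ← ih, ← degProj_wedgeOp]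
    congr 2
    push_cast
    ring

theorem wedgeOp_two_pow_mem {j : ℤ} (ω₀ : Form E M 2) (r : ℕ) {x : TotalForm E M}
    (hx : x ∈ degreePart E M j) : (wedgeOp ω₀ ^ r) x ∈ degreePart E M (j + 2 * r) := by
  rw [← degProj_of_mem hx, ← degProj_wedgeOp_two_pow]
  exact degProj_mem _ _

theorem eq_zero_of_gt_finrank {j : ℤ} (hj : Module.finrank ℝ E < j) {x : TotalForm E M}
    (hx : x ∈ degreePart E M j) : x = 0 :=
  total_ext fun p => (altDeg_eq_zero hj (evalAt_mem hx p)).trans (map_zero _).symm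

theorem eq_zero_of_neg {j : ℤ} (hj : j < 0) {x : TotalForm E M} (hx : x ∈ degreePart E M j) :
    x = 0 := DFinsupp.ext fun i => hx i (by omega)

end Evaluation

/-! ### Smoothness of the inverse Lefschetz isomorphism. -/

section SmoothInverse

variable {E : Type*} [NormedAddCommGroup E] [NormedSpace ℝ E] [FiniteDimensional ℝ E] {j k : ℕ}

theorem lef_add_left (w w' : E [⋀^Fin 2]→L[ℝ] ℝ) (a : E [⋀^Fin k]→L[ℝ] ℝ) :
    lef (w + w') a = lef w a + lef w' a := by
  ext v; simp [lef_apply, wedge_add_left]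

theorem lef_smul_left (r : ℝ) (w : E [⋀^Fin 2]→L[ℝ] ℝ) (a : E [⋀^Fin k]→L[ℝ] ℝ) :
    lef (r • w) a = r • lef w a := by
  ext v; simp [lef_apply, wedge_smul_left]

theorem lef_comp (w : E [⋀^Fin 2]→L[ℝ] ℝ) (a : E [⋀^Fin k]→L[ℝ] ℝ) (g : E →L[ℝ] E) :
    (lef w a).compContinuousLinearMap g =
      lef (w.compContinuousLinearMap g) (a.compContinuousLinearMap g) := by
  ext v
  rw [lef_apply, ← wedge_comp]
  exact lef_apply _ _ _

variable (E k) in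
/-- `lef` as a continuous bilinear map. -/
def lefL : (E [⋀^Fin 2]→L[ℝ] ℝ) →L[ℝ] (E [⋀^Fin k]→L[ℝ] ℝ) →L[ℝ] (E [⋀^Fin (k + 2)]→L[ℝ] ℝ) :=
  (LinearMap.mk₂ ℝ (fun w a => lef w a) lef_add_left lef_smul_left (fun w => map_add (lef w))
    (fun r w => map_smul (lef w) r)).toContinuousBilinearMap

/-- The exterior product with the `r`-th power of a two-form. -/
def lefPow (w : E [⋀^Fin 2]→L[ℝ] ℝ) (j : ℕ) :
    (r : ℕ) → (E [⋀^Fin j]→L[ℝ] ℝ) →L[ℝ] (E [⋀^Fin (j + 2 * r)]→L[ℝ] ℝ)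
  | 0 => ContinuousLinearMap.id ℝ _
  | r + 1 => (lefL E (j + 2 * r) w).comp (lefPow w j r)

theorem lefPow_succ (w : E [⋀^Fin 2]→L[ℝ] ℝ) (j r : ℕ) (a : E [⋀^Fin j]→L[ℝ] ℝ) :
    lefPow w j (r + 1) a = lef w (lefPow w j r a) := rfl

theorem contDiff_lefPow (j r : ℕ) :
    ContDiff ℝ ∞ (fun w : E [⋀^Fin 2]→L[ℝ] ℝ => lefPow w j r) := by
  induction r with
  | zero => exact contDiff_const
  | succ r ih => exact (lefL E (j + 2 * r)).contDiff.clm_comp ih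

theorem lefPow_comp (w : E [⋀^Fin 2]→L[ℝ] ℝ) (r : ℕ) (a : E [⋀^Fin j]→L[ℝ] ℝ) (g : E →L[ℝ] E) :
    (lefPow w j r a).compContinuousLinearMap g =
      lefPow (w.compContinuousLinearMap g) j r (a.compContinuousLinearMap g) := by
  induction r with
  | zero => rfl
  | succ r ih => rw [lefPow_succ, lefPow_succ, ← ih, lef_comp]

theorem outer2_pow_single (w : E [⋀^Fin 2]→L[ℝ] ℝ) (r : ℕ) (a : E [⋀^Fin j]→L[ℝ] ℝ) :
    (outer2 w ^ r) (Pi.single j a) = Pi.single (j + 2 * r) (lefPow w j r a) := by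
  induction r with
  | zero => rfl
  | succ r ih => rw [pow_succ', Module.End.mul_apply, ih, outer2_single]; rfl

/-- Both halves of hard Lefschetz meet when j + r = n: injectivity from degree n - r and
surjectivity onto degree n + r. -/
theorem IsNondeg.lefPow_bijective {w : E [⋀^Fin 2]→L[ℝ] ℝ} (hw : IsNondeg w) {n : ℕ}
    (hn : Module.finrank ℝ E = 2 * n) {r : ℕ} (hr : j + r = n) :
    Function.Bijective (lefPow w j r) := by
  have hP := hw.lefschetzPair hn
  have hmem {i : ℕ} (a : E [⋀^Fin i]→L[ℝ] ℝ) : (Pi.single i a : AltPi E) ∈ altDeg E i :=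
    fun l hl => Pi.single_eq_of_ne (by exact_mod_cast hl) _
  constructor
  · refine (injective_iff_map_eq_zero _).2 fun a ha => ?_
    have := hP.eq_zero_of_L_pow_eq_zero (hmem a) r (by omega) (by
      rw [outer2_pow_single, ha, Pi.single_zero])
    have := congrFun this j
    rwa [Pi.single_eq_same] at this
  · intro b
    obtain ⟨y, hy, hLy⟩ := hP.exists_L_pow_eq (hmem b) r (by push_cast; omega)
    have hy' : y = Pi.single j (y j) := by
      funext l
      by_cases h : l = j
      · subst h; rw [Pi.single_eq_same]
      · rw [Pi.single_eq_of_ne h, hy l (by push_cast; omega)]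
    rw [hy', outer2_pow_single] at hLy
    refine ⟨y j, ?_⟩
    have := congrFun hLy (j + 2 * r)
    rwa [Pi.single_eq_same, Pi.single_eq_same] at this

theorem exists_equiv_of_bijective {V W : Type*} [NormedAddCommGroup V] [NormedSpace ℝ V]
    [FiniteDimensional ℝ V] [NormedAddCommGroup W] [NormedSpace ℝ W] [FiniteDimensional ℝ W]
    {f : V →L[ℝ] W} (hf : Function.Bijective f) : ∃ e : V ≃L[ℝ] W, (e : V →L[ℝ] W) = f :=
  ⟨(LinearEquiv.ofBijective (f : V →ₗ[ℝ] W) hf).toContinuousLinearEquiv, by ext; rfl⟩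

theorem isNondeg_comp {w : E [⋀^Fin 2]→L[ℝ] ℝ} (hw : IsNondeg w) {g : E →L[ℝ] E}
    (hg : Function.Surjective g) : IsNondeg (w.compContinuousLinearMap g) := by
  have hg' : Function.Injective g := LinearMap.injective_iff_surjective.2 hg
  intro v hv
  refine hg' ((hw (g v) fun u => ?_).trans (map_zero g).symm)
  obtain ⟨u, rfl⟩ := hg u
  rw [← hv u]
  change _ = w _
  congr 1
  ext i; fin_cases i <;> rfl

variable {M : Type*} [TopologicalSpace M] [ChartedSpace E M] [IsManifold 𝓘(ℝ, E) ∞ M]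

theorem chart_symm_deriv_surjective (c : M) {y : E} (hy : y ∈ (chartAt E c).target) :
    Function.Surjective (show E →L[ℝ] E from mfderiv 𝓘(ℝ, E) 𝓘(ℝ, E) (chartAt E c).symm y) := by
  intro v
  have hw := (chartAt E c).map_target hy
  have := chart_symm_deriv c hw v
  rw [(chartAt E c).right_inv hy] at this
  exact ⟨_, this⟩

/-- The inverse of the exterior product with a power of a non-degenerate two-form is smooth. -/
theorem exists_form_lefPow_eq (ω₀ : Form E M 2) (hω : ∀ x, IsNondeg (valAt ω₀ x)) {n : ℕ}
    (hn : Module.finrank ℝ E = 2 * n) {r : ℕ} (hr : j + r = n) (β : Form E M (j + 2 * r)) :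
    ∃ α : Form E M j, ∀ x, lefPow (valAt ω₀ x) j r (valAt α x) = valAt β x := by
  have key {w : E [⋀^Fin 2]→L[ℝ] ℝ} (hw : IsNondeg w) (a : E [⋀^Fin j]→L[ℝ] ℝ)
      (b : E [⋀^Fin (j + 2 * r)]→L[ℝ] ℝ) :
      (lefPow w j r).inverse b = a ↔ lefPow w j r a = b := by
    obtain ⟨e, he⟩ := exists_equiv_of_bijective (hw.lefPow_bijective hn hr)
    rw [← he, ContinuousLinearMap.inverse_equiv]
    exact e.symm_apply_eq.trans eq_comm
  let α₀ : ∀ x : M, E [⋀^Fin j]→L[ℝ] ℝ := fun x =>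
    (lefPow (valAt ω₀ x) j r).inverse (valAt β x)
  have hα₀ (x : M) : lefPow (valAt ω₀ x) j r (α₀ x) = valAt β x := (key (hω x) _ _).1 rfl
  -- Wedging with powers commutes with pullback, so in a chart the pointwise inverse is the inverse
  -- for the pulled-back two-form, which is still non-degenerate.
  have hrep (c : M) (y : E) (hy : y ∈ (chartAt E c).target) : chartRep c α₀ y =
      (lefPow (chartRep c ω₀.1 y) j r).inverse (chartRep c β.1 y) := by
    symm
    refine (key (isNondeg_comp (hω _) (chart_symm_deriv_surjective c hy)) _ _).2 ?_
    refine (lefPow_comp _ _ _ _).symm.trans ?_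
    exact congrArg (fun a : E [⋀^Fin (j + 2 * r)]→L[ℝ] ℝ => a.compContinuousLinearMap
      (show E →L[ℝ] E from mfderiv 𝓘(ℝ, E) 𝓘(ℝ, E) (chartAt E c).symm y))
      (hα₀ ((chartAt E c).symm y))
  refine ⟨⟨α₀, fun c => ?_⟩, hα₀⟩
  refine ContDiffOn.congr ?_ (hrep c)
  intro y hy
  have hbij : Function.Bijective (lefPow (chartRep c ω₀.1 y) j r) :=
    (isNondeg_comp (hω ((chartAt E c).symm y))
      (chart_symm_deriv_surjective c hy)).lefPow_bijective hn hr
  obtain ⟨e, he⟩ := exists_equiv_of_bijective hbij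
  have h1 : ContDiffWithinAt ℝ ∞ (fun y => lefPow (chartRep c ω₀.1 y) j r) (chartAt E c).target y :=
    ContDiffAt.comp_contDiffWithinAt (g := fun w : E [⋀^Fin 2]→L[ℝ] ℝ => lefPow w j r)
      (f := chartRep c ω₀.1) y (contDiff_lefPow j r).contDiffAt (ω₀.2 c y hy)
  -- Smoothness of α₀ rests on the smoothness of operator inversion at invertible operators.
  have h2 : ContDiffAt ℝ ∞ ContinuousLinearMap.inverse (lefPow (chartRep c ω₀.1 y) j r) := by
    rw [← he]
    exact contDiffAt_map_inverse e
  exact (h2.comp_contDiffWithinAt y h1).clm_apply (β.2 c y hy)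

end SmoothInverse

/-! ### Hard Lefschetz for smooth forms. -/

section GlobalLefschetz

variable {E : Type*} [NormedAddCommGroup E] [NormedSpace ℝ E] [FiniteDimensional ℝ E]
  {M : Type*} [TopologicalSpace M] [ChartedSpace E M] [IsManifold 𝓘(ℝ, E) ∞ M] {n : ℕ}

namespace LCSStructure

variable (S : LCSStructure E M)

theorem isNondeg (x : M) : IsNondeg (valAt S.form x) := S.nondegenerate x

theorem evalAt_L_pow (p : M) (r : ℕ) (x : TotalForm E M) :
    evalAt p ((S.L ^ r) x) = (outer2 (valAt S.form p) ^ r) (evalAt p x) :=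
  evalAt_wedgeOp_two_pow p S.form r x

theorem L_pow_mem (r : ℕ) {j : ℤ} {x : TotalForm E M} (hx : x ∈ degreePart E M j) :
    (S.L ^ r) x ∈ degreePart E M (j + 2 * r) := wedgeOp_two_pow_mem S.form r hx

theorem L_mem {j : ℤ} {x : TotalForm E M} (hx : x ∈ degreePart E M j) :
    S.L x ∈ degreePart E M (j + 2) := wedgeOp_mem S.form hx

theorem L_pow_succ (r : ℕ) (x : TotalForm E M) : (S.L ^ (r + 1)) x = (S.L ^ r) (S.L x) := by
  rw [pow_succ, Module.End.mul_apply]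

theorem eq_zero_of_L_pow (hn : Module.finrank ℝ E = 2 * n) {j : ℤ} {x : TotalForm E M}
    (hx : x ∈ degreePart E M j) (r : ℕ) (hr : j + r ≤ n) (h0 : (S.L ^ r) x = 0) : x = 0 :=
  total_ext fun p => by
    rw [map_zero]
    refine ((S.isNondeg p).lefschetzPair hn).eq_zero_of_L_pow_eq_zero (evalAt_mem hx p) r hr ?_
    rw [← evalAt_L_pow, h0, map_zero]

/-- The smooth isomorphism L^s from Ω^{n-s} to Ω^{n+s} with s = m - n gives a preimage under L^s; as
r ≤ s, applying L^{s-r} to it gives one under L^r. -/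
theorem exists_L_pow_eq (hn : Module.finrank ℝ E = 2 * n) {m : ℤ} {x : TotalForm E M}
    (hx : x ∈ degreePart E M m) (r : ℕ) (hr : r ≤ m - n) :
    ∃ y ∈ degreePart E M (m - 2 * r), (S.L ^ r) y = x := by
  by_cases hm : 2 * (n : ℤ) < m
  · exact ⟨0, zero_mem _, by
      rw [map_zero, eq_zero_of_gt_finrank (by omega) hx]⟩
  obtain ⟨s, hs⟩ : ∃ s : ℕ, (s : ℤ) = m - n := ⟨(m - n).toNat, by omega⟩
  obtain ⟨j, hj⟩ : ∃ j : ℕ, j + s = n := ⟨n - s, by omega⟩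
  have hm' : ((j + 2 * s : ℕ) : ℤ) = m := by push_cast; omega
  obtain ⟨y, hy, hLy⟩ : ∃ y ∈ degreePart E M j, (S.L ^ s) y = x := by
    rcases eq_zero_or_eq_tot hx with rfl | ⟨i, β, hi, rfl⟩
    · exact ⟨0, zero_mem _, map_zero _⟩
    · obtain rfl : i = j + 2 * s := by omega
      obtain ⟨α, hα⟩ := exists_form_lefPow_eq S.form S.isNondeg hn hj β
      refine ⟨tot j α, tot_mem rfl α, total_ext fun p => ?_⟩
      rw [evalAt_L_pow, evalAt_tot, evalAt_tot, outer2_pow_single]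
      exact congrArg _ (hα p)
  obtain ⟨t, ht⟩ : ∃ t, s = r + t := ⟨s - r, by omega⟩
  refine ⟨(S.L ^ t) y, ?_, ?_⟩
  · convert S.L_pow_mem t hy using 2
    omega
  · rw [← Module.End.mul_apply, ← pow_add, ← ht, hLy]

/-- L is homogeneous, so the component of the right degree of any preimage is again a preimage. -/
theorem exists_L_pow_eq_of_mem {j : ℤ} {r : ℕ} {x : TotalForm E M}
    (h : x ∈ LinearMap.range (S.L ^ r)) (hx : x ∈ degreePart E M (j + 2 * r)) :
    ∃ y ∈ degreePart E M j, (S.L ^ r) y = x := by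
  obtain ⟨y, rfl⟩ := h
  refine ⟨degProj E M j y, degProj_mem _ _, ?_⟩
  rw [← degProj_of_mem hx]
  exact (degProj_wedgeOp_two_pow j S.form r y).symm

end LCSStructure

end GlobalLefschetz


/-! ### Naturality of the spectral sequence in maps of filtered complexes. -/

section FilteredMap

open CategoryTheory

universe u

variable {K : Type u} [AddCommGroup K] [Module ℝ K]

theorem comp_squares {𝒞 : Type*} [Category 𝒞] {A₁ A₂ A₃ A₄ B₁ B₂ B₃ B₄ : 𝒞} {f₁ : A₁ ⟶ B₁}
    {f₂ : A₂ ⟶ B₂} {f₃ : A₃ ⟶ B₃} {f₄ : A₄ ⟶ B₄} {a₁ : A₁ ⟶ A₂} {a₂ : A₂ ⟶ A₃} {a₃ : A₃ ⟶ A₄}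
    {b₁ : B₁ ⟶ B₂} {b₂ : B₂ ⟶ B₃} {b₃ : B₃ ⟶ B₄} (h1 : f₁ ≫ b₁ = a₁ ≫ f₂)
    (h2 : f₂ ≫ b₂ = a₂ ≫ f₃) (h3 : f₃ ≫ b₃ = a₃ ≫ f₄) :
    f₁ ≫ b₁ ≫ b₂ ≫ b₃ = (a₁ ≫ a₂ ≫ a₃) ≫ f₄ := by
  rw [reassoc_of% h1, reassoc_of% h2, h3]
  simp only [Category.assoc]

namespace FilteredComplex

/-- A morphism of filtered complexes. -/
structure Map (C C' : FilteredComplex K) where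
  toLin : K →ₗ[ℝ] K
  map_d : ∀ x, toLin (C.d x) = C'.d (toLin x)
  map_deg : ∀ j, ∀ x ∈ C.deg j, toLin x ∈ C'.deg j
  map_F : ∀ p, ∀ x ∈ C.F p, toLin x ∈ C'.F p

namespace Map

variable {C C' : FilteredComplex K} (φ : Map C C') {r p q p' q' : ℤ}

theorem mem_Z (x : K) (hx : x ∈ C.Z r p q) : φ.toLin x ∈ C'.Z r p q := by
  obtain ⟨h1, h2, h3⟩ := FilteredComplex.mem_Z.1 hx
  exact FilteredComplex.mem_Z.2 ⟨φ.map_F _ _ h1, φ.map_deg _ _ h2, φ.map_d x ▸ φ.map_F _ _ h3⟩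

theorem mem_B (x : K) (hx : x ∈ C.B r p q) : φ.toLin x ∈ C'.B r p q := by
  obtain ⟨h1, h2, y, hy1, hy2, rfl⟩ := FilteredComplex.mem_B.1 hx
  exact FilteredComplex.mem_B.2 ⟨φ.map_F _ _ h1, φ.map_deg _ _ h2, φ.toLin y, φ.map_F _ _ hy1,
    φ.map_deg _ _ hy2, (φ.map_d y).symm⟩

theorem mem_sup (x : K) (hx : x ∈ C.Z (r - 1) (p + 1) (q - 1) ⊔ C.B (r - 1) p q) :
    φ.toLin x ∈ C'.Z (r - 1) (p + 1) (q - 1) ⊔ C'.B (r - 1) p q := by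
  obtain ⟨z, hz, b, hb, rfl⟩ := Submodule.mem_sup.1 hx
  rw [map_add]
  exact Submodule.add_mem_sup (φ.mem_Z z hz) (φ.mem_B b hb)

/-- The map induced on `E_r^{p,q}`. -/
def mapE (r p q : ℤ) : C.E r p q →ₗ[ℝ] C'.E r p q :=
  Submodule.mapQ _ _ (φ.toLin.restrict (fun x hx => φ.mem_Z x hx)) fun x hx => φ.mem_sup x.1 hx

theorem mapE_cls (x : C.Z r p q) :
    φ.mapE r p q (C.cls r p q x) = C'.cls r p q ⟨φ.toLin x, φ.mem_Z x.1 x.2⟩ := rfl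

theorem mapE_dE (hp : p' = p + r) (hq : q' = q + 1 - r) (x : C.E r p q) :
    φ.mapE r p' q' (C.dE hp hq x) = C'.dE hp hq (φ.mapE r p q x) := by
  obtain ⟨x, rfl⟩ := C.cls_surjective _ _ _ x
  rw [dE_cls, mapE_cls, mapE_cls, dE_cls]
  congr 1
  exact Subtype.ext (φ.map_d x.1)

/-- The map induced on the `r`-th page. -/
def mapPage (r : ℤ) : C.page r ⟶ C'.page r where
  f pq := ModuleCat.ofHom (φ.mapE r pq.1 pq.2)
  comm' pq pq' h := by
    have hp : pq'.1 = pq.1 + r := by rw [← h]; rfl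
    have hq : pq'.2 = pq.2 + 1 - r := by
      rw [← h]
      change pq.2 + (1 - r) = _
      omega
    rw [page_d _ _ _ _ hp hq, page_d _ _ _ _ hp hq]
    ext x
    exact (φ.mapE_dE hp hq x).symm

variable {p₀ q₀ p₂ q₂ : ℤ}

/-- The map induced on the homology of the `r`-th page. -/
def mapKer (hp' : p₂ = p + r) (hq' : q₂ = q + 1 - r) :
    (C.dE hp' hq').ker →ₗ[ℝ] (C'.dE hp' hq').ker :=
  (φ.mapE r p q).restrict fun x hx => by
    rw [LinearMap.mem_ker] at hx ⊢
    rw [← φ.mapE_dE, hx, map_zero]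

theorem range_le (hp : p = p₀ + r) (hq : q = q₀ + 1 - r) (hp' : p₂ = p + r)
    (hq' : q₂ = q + 1 - r) :
    LinearMap.range ((C.dE hp hq).codRestrict (C.dE hp' hq').ker
      fun x => C.dE_dE hp hq hp' hq' x) ≤
    (LinearMap.range ((C'.dE hp hq).codRestrict (C'.dE hp' hq').ker
      fun x => C'.dE_dE hp hq hp' hq' x)).comap (φ.mapKer hp' hq') := by
  rintro _ ⟨x, rfl⟩
  exact ⟨φ.mapE r p₀ q₀ x, Subtype.ext (φ.mapE_dE hp hq x).symm⟩

/-- The map induced on the homology of the `r`-th page. -/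
def mapHomology (hp : p = p₀ + r) (hq : q = q₀ + 1 - r) (hp' : p₂ = p + r)
    (hq' : q₂ = q + 1 - r) :
    ((C.dE hp' hq').ker ⧸ LinearMap.range ((C.dE hp hq).codRestrict (C.dE hp' hq').ker
      fun x => C.dE_dE hp hq hp' hq' x)) →ₗ[ℝ]
    ((C'.dE hp' hq').ker ⧸ LinearMap.range ((C'.dE hp hq).codRestrict (C'.dE hp' hq').ker
      fun x => C'.dE_dE hp hq hp' hq' x)) :=
  Submodule.mapQ _ _ (φ.mapKer hp' hq') (φ.range_le hp hq hp' hq')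

theorem homologyEquiv_mapE (hp : p = p₀ + r) (hq : q = q₀ + 1 - r) (hp' : p₂ = p + r)
    (hq' : q₂ = q + 1 - r) (x : C.E (r + 1) p q) :
    C'.homologyEquiv hp hq hp' hq' (φ.mapE (r + 1) p q x) =
      φ.mapHomology hp hq hp' hq' (C.homologyEquiv hp hq hp' hq' x) := by
  obtain ⟨x, rfl⟩ := C.cls_surjective _ _ _ x
  rfl

variable (C) in
/-- The short complex `E_r^{p-r,q+r-1} → E_r^{p,q} → E_r^{p+r,q-r+1}`. -/
def pageSC (hp : p = p₀ + r) (hq : q = q₀ + 1 - r) (hp' : p₂ = p + r) (hq' : q₂ = q + 1 - r) :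
    ShortComplex (ModuleCat.{u} ℝ) :=
  ShortComplex.moduleCatMk (C.dE hp hq) (C.dE hp' hq')
    (LinearMap.ext fun x => C.dE_dE hp hq hp' hq' x)

/-- The map induced on the short complexes `E_r^{p-r,q+r-1} → E_r^{p,q} → E_r^{p+r,q-r+1}`. -/
def mapSC (hp : p = p₀ + r) (hq : q = q₀ + 1 - r) (hp' : p₂ = p + r) (hq' : q₂ = q + 1 - r) :
    pageSC C hp hq hp' hq' ⟶ pageSC C' hp hq hp' hq' where
  τ₁ := ModuleCat.ofHom (φ.mapE r p₀ q₀)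
  τ₂ := ModuleCat.ofHom (φ.mapE r p q)
  τ₃ := ModuleCat.ofHom (φ.mapE r p₂ q₂)
  comm₁₂ := ModuleCat.hom_ext (LinearMap.ext fun x => (φ.mapE_dE hp hq x).symm)
  comm₂₃ := ModuleCat.hom_ext (LinearMap.ext fun x => (φ.mapE_dE hp' hq' x).symm)

theorem mapSC_homology (hp : p = p₀ + r) (hq : q = q₀ + 1 - r) (hp' : p₂ = p + r)
    (hq' : q₂ = q + 1 - r) :
    ShortComplex.homologyMap (φ.mapSC hp hq hp' hq') ≫
        (pageSC C' hp hq hp' hq').moduleCatHomologyIso.hom =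
      (pageSC C hp hq hp' hq').moduleCatHomologyIso.hom ≫
        ModuleCat.ofHom (φ.mapHomology hp hq hp' hq') := by
  let γ : ShortComplex.LeftHomologyMapData (φ.mapSC hp hq hp' hq')
      (pageSC C hp hq hp' hq').moduleCatLeftHomologyData
      (pageSC C' hp hq hp' hq').moduleCatLeftHomologyData :=
    { φK := ModuleCat.ofHom (φ.mapKer hp' hq')
      φH := ModuleCat.ofHom (φ.mapHomology hp hq hp' hq')
      commi := rfl
      commf' := ModuleCat.hom_ext (LinearMap.ext fun x => Subtype.ext (φ.mapE_dE hp hq x))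
      commπ := rfl }
  exact γ.homologyMap_comm

variable (C) in
/-- The identification of the short complexes of the `r`-th page. -/
def pageScIso (r : ℤ) (pq i k : ℤ × ℤ) (hp : pq.1 = i.1 + r) (hq : pq.2 = i.2 + 1 - r)
    (hp' : k.1 = pq.1 + r) (hq' : k.2 = pq.2 + 1 - r)
    (hi : (ComplexShape.up' ((r, 1 - r) : ℤ × ℤ)).prev pq = i)
    (hk : (ComplexShape.up' ((r, 1 - r) : ℤ × ℤ)).next pq = k) :
    (C.page r).sc pq ≅ pageSC C hp hq hp' hq' :=
  (C.page r).isoSc' i pq k hi hk ≪≫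
    ShortComplex.isoMk (Iso.refl _) (Iso.refl _) (Iso.refl _)
      (by
        change 𝟙 _ ≫ ModuleCat.ofHom (C.dE hp hq) = (C.page r).d i pq ≫ 𝟙 _
        rw [C.page_d r i pq hp hq]
        exact (Category.id_comp _).trans (Category.comp_id _).symm)
      (by
        change 𝟙 _ ≫ ModuleCat.ofHom (C.dE hp' hq') = (C.page r).d pq k ≫ 𝟙 _
        rw [C.page_d r pq k hp' hq']
        exact (Category.id_comp _).trans (Category.comp_id _).symm)

theorem pageScIso_comm (r : ℤ) (pq i k : ℤ × ℤ) (hp : pq.1 = i.1 + r) (hq : pq.2 = i.2 + 1 - r)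
    (hp' : k.1 = pq.1 + r) (hq' : k.2 = pq.2 + 1 - r)
    (hi : (ComplexShape.up' ((r, 1 - r) : ℤ × ℤ)).prev pq = i)
    (hk : (ComplexShape.up' ((r, 1 - r) : ℤ × ℤ)).next pq = k) :
    (HomologicalComplex.shortComplexFunctor (ModuleCat.{u} ℝ) _ pq).map (φ.mapPage r) ≫
        (pageScIso C' r pq i k hp hq hp' hq' hi hk).hom =
      (pageScIso C r pq i k hp hq hp' hq' hi hk).hom ≫ φ.mapSC hp hq hp' hq' := by
  have h := (HomologicalComplex.natIsoSc' (ModuleCat.{u} ℝ) _ i pq k hi hk).hom.naturality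
    (φ.mapPage r)
  unfold pageScIso
  rw [Iso.trans_hom, Iso.trans_hom]
  refine ((Category.assoc _ _ _).symm.trans (eq_whisker h _)).trans ?_
  rw [Category.assoc, Category.assoc]
  refine whisker_eq _ ?_
  refine ShortComplex.hom_ext _ _ ?_ ?_ ?_ <;>
  exact (Category.comp_id _).trans (Category.id_comp _).symm

/-- The identification of H(E_r) with E_{r+1} is a composite of three isomorphisms, and naturality
is checked for each of them. -/
theorem mapPage_comm (r : ℤ) (pq : ℤ × ℤ) :
    HomologicalComplex.homologyMap (φ.mapPage r) pq ≫ (C'.pageIso r pq).hom =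
      (C.pageIso r pq).hom ≫ (φ.mapPage (r + 1)).f pq := by
  let i : ℤ × ℤ := (pq.1 - r, pq.2 - 1 + r)
  let k : ℤ × ℤ := (pq.1 + r, pq.2 + 1 - r)
  have hp : pq.1 = i.1 + r := (sub_add_cancel pq.1 r).symm
  have hq : pq.2 = i.2 + 1 - r := by change pq.2 = pq.2 - 1 + r + 1 - r; omega
  have hi : (ComplexShape.up' ((r, 1 - r) : ℤ × ℤ)).prev pq = i :=
    ComplexShape.prev_eq' _ (Prod.ext hp.symm (by change i.2 + (1 - r) = pq.2; omega))
  have hk : (ComplexShape.up' ((r, 1 - r) : ℤ × ℤ)).next pq = k :=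
    ComplexShape.next_eq' _ (Prod.ext rfl (by change pq.2 + (1 - r) = pq.2 + 1 - r; omega))
  have e (D : FilteredComplex K) : (D.pageIso r pq).hom =
      ShortComplex.homologyMap (pageScIso D r pq i k hp hq rfl rfl hi hk).hom ≫
        (pageSC D hp hq (p₂ := k.1) (q₂ := k.2) rfl rfl).moduleCatHomologyIso.hom ≫
        ModuleCat.ofHom (D.homologyEquiv hp hq (p₂ := k.1) (q₂ := k.2) rfl rfl).symm.toLinearMap :=
    rfl
  have h1 : HomologicalComplex.homologyMap (φ.mapPage r) pq ≫
      ShortComplex.homologyMap (pageScIso C' r pq i k hp hq rfl rfl hi hk).hom =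
      ShortComplex.homologyMap (pageScIso C r pq i k hp hq rfl rfl hi hk).hom ≫
        ShortComplex.homologyMap (φ.mapSC hp hq (p₂ := k.1) (q₂ := k.2) rfl rfl) := by
    rw [← ShortComplex.homologyMap_comp, ← φ.pageScIso_comm, ShortComplex.homologyMap_comp]
    rfl
  have h2 : ModuleCat.ofHom (φ.mapHomology hp hq (p₂ := k.1) (q₂ := k.2) rfl rfl) ≫
      ModuleCat.ofHom (C'.homologyEquiv hp hq (p₂ := k.1) (q₂ := k.2) rfl rfl).symm.toLinearMap =
      ModuleCat.ofHom (C.homologyEquiv hp hq (p₂ := k.1) (q₂ := k.2) rfl rfl).symm.toLinearMap ≫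
      (φ.mapPage (r + 1)).f pq := by
    refine ModuleCat.hom_ext (LinearMap.ext fun x => ?_)
    obtain ⟨x, rfl⟩ := (C.homologyEquiv hp hq (p₂ := k.1) (q₂ := k.2) rfl rfl).surjective x
    change (C'.homologyEquiv hp hq (p₂ := k.1) (q₂ := k.2) rfl rfl).symm
      (φ.mapHomology hp hq rfl rfl _) = φ.mapE (r + 1) pq.1 pq.2
        ((C.homologyEquiv hp hq (p₂ := k.1) (q₂ := k.2) rfl rfl).symm _)
    rw [LinearEquiv.symm_apply_apply, LinearEquiv.symm_apply_eq, homologyEquiv_mapE]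
  rw [e C, e C']
  exact comp_squares h1 (φ.mapSC_homology hp hq (p₂ := k.1) (q₂ := k.2) rfl rfl) h2

/-- The map induced on spectral sequences. -/
def mapSS : C.spectralSequence ⟶ C'.spectralSequence where
  hom r _ := φ.mapPage r
  comm r r' pq hrr' hr := by
    -- With r' replaced by r + 1 the transport between equal pages is the identity.
    subst hrr'
    change HomologicalComplex.homologyMap (φ.mapPage r) pq ≫ (C'.pageIso r pq).hom ≫ 𝟙 _ =
      ((C.pageIso r pq).hom ≫ 𝟙 _) ≫ (φ.mapPage (r + 1)).f pq
    rw [Category.comp_id]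
    erw [Category.comp_id]
    exact φ.mapPage_comm r pq

end Map

/-- An isomorphism of filtered complexes induces an isomorphism of spectral sequences. -/
def spectralSequenceIso {C C' : FilteredComplex K} (φ : Map C C') (ψ : Map C' C)
    (h1 : ∀ x, ψ.toLin (φ.toLin x) = x) (h2 : ∀ x, φ.toLin (ψ.toLin x) = x) :
    C.spectralSequence ≅ C'.spectralSequence where
  hom := φ.mapSS
  inv := ψ.mapSS
  hom_inv_id := by
    refine SpectralSequence.hom_ext fun r _ => HomologicalComplex.hom_ext _ _ fun pq => ?_
    refine ModuleCat.hom_ext (LinearMap.ext fun x => ?_)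
    obtain ⟨x, rfl⟩ := C.cls_surjective _ _ _ x
    exact congrArg (C.cls r pq.1 pq.2) (Subtype.ext (h1 x.1))
  inv_hom_id := by
    refine SpectralSequence.hom_ext fun r _ => HomologicalComplex.hom_ext _ _ fun pq => ?_
    refine ModuleCat.hom_ext (LinearMap.ext fun x => ?_)
    obtain ⟨x, rfl⟩ := C'.cls_surjective _ _ _ x
    exact congrArg (C'.cls r pq.1 pq.2) (Subtype.ext (h2 x.1))

end FilteredComplex

end FilteredMap


theorem eq_of_add_neg_one_smul {K : Type*} [AddCommGroup K] [Module ℝ K] {u v : K}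
    (h : u + (-1 : ℝ) • v = 0) : u = v := by
  rw [neg_one_smul] at h
  exact sub_eq_zero.1 ((sub_eq_add_neg u v).trans h)

/-! ### Conformally equivalent structures. -/

section Conformal

variable {E : Type*} [NormedAddCommGroup E] [NormedSpace ℝ E] [FiniteDimensional ℝ E]
  {M : Type*} [TopologicalSpace M] [ChartedSpace E M] [IsManifold 𝓘(ℝ, E) ∞ M] {n : ℕ}

theorem form_ext {k : ℕ} {α β : Form E M k} (h : ∀ p, valAt α p = valAt β p) : α = β :=
  Subtype.ext (funext h)

theorem tot_injective {k : ℕ} {α β : Form E M k}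
    (h : (tot k α : TotalForm E M) = tot k β) : α = β := by
  rw [← tot_apply_same α, h, tot_apply_same]

variable (E M) in
/-- The constant function `1`, in degree zero. -/
def unit : TotalForm E M := tot 0 (ofFun (ContMDiffMap.const 1))

theorem ext1_const (θ : E [⋀^Fin 1]→L[ℝ] ℝ) :
    ext1 θ (ContinuousAlternatingMap.constOfIsEmpty ℝ E (Fin 0) (1 : ℝ)) = θ := by
  ext v
  rw [ext1_apply, vec_one_eq v]
  simp

theorem wedgeOp_unit (θ : Form E M 1) : wedgeOp θ (unit E M) = tot 1 θ := by
  refine total_ext fun p => ?_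
  rw [evalAt_wedgeOp_one, unit, evalAt_tot, evalAt_tot, outer1_single]
  exact congrArg (Pi.single 1) (ext1_const (valAt θ p))

theorem wedgeOp_one_one (θ η : Form E M 1) (x : TotalForm E M) :
    wedgeOp θ (wedgeOp η x) = -wedgeOp η (wedgeOp θ x) := by
  refine total_ext fun p => ?_
  rw [map_neg]
  simp only [evalAt_wedgeOp_one]
  exact outer1_outer1 _ _ _

theorem mulOp_wedgeOp (f : C^∞⟮𝓘(ℝ, E), M; 𝓘(ℝ, ℝ), ℝ⟯) (θ : Form E M 1)
    (x : TotalForm E M) : mulOp f (wedgeOp θ x) = wedgeOp θ (mulOp f x) := by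
  refine total_ext fun p => ?_
  rw [evalAt_mulOp, evalAt_wedgeOp_one, evalAt_wedgeOp_one, evalAt_mulOp, map_smul]

theorem outer2_smul_left (r : ℝ) (w : E [⋀^Fin 2]→L[ℝ] ℝ) : outer2 (r • w) = r • outer2 w := by
  refine LinearMap.ext fun x => funext fun k => ?_
  match k with
  | 0 => exact (smul_zero r).symm
  | 1 => exact (smul_zero r).symm
  | k + 2 => exact lef_smul_left r w (x k)

/-- The function `e^{cf}`. -/
def expFun (c : ℝ) (f : C^∞⟮𝓘(ℝ, E), M; 𝓘(ℝ, ℝ), ℝ⟯) : C^∞⟮𝓘(ℝ, E), M; 𝓘(ℝ, ℝ), ℝ⟯ :=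
  ⟨fun x => Real.exp (c * f x), by
    have h : ContDiff ℝ ∞ fun t : ℝ => Real.exp (c * t) := by fun_prop
    exact h.contMDiff.comp f.contMDiff⟩

theorem expFun_apply (c : ℝ) (f : C^∞⟮𝓘(ℝ, E), M; 𝓘(ℝ, ℝ), ℝ⟯) (x : M) :
    expFun c f x = Real.exp (c * f x) := rfl

theorem valAt_dFun_comp (f g : C^∞⟮𝓘(ℝ, E), M; 𝓘(ℝ, ℝ), ℝ⟯) {h : ℝ → ℝ} {p : M} {h' : ℝ}
    (hg : ∀ x, g x = h (f x)) (hh : HasDerivAt h h' (f p)) :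
    valAt (dFun g) p = h' • valAt (dFun f) p := by
  ext v
  have hf : HasMFDerivAt 𝓘(ℝ, E) 𝓘(ℝ, ℝ) f p (mfderiv 𝓘(ℝ, E) 𝓘(ℝ, ℝ) f p) :=
    (f.contMDiff.mdifferentiable (by simp) p).hasMFDerivAt
  have h1 := hh.hasFDerivAt.hasMFDerivAt.comp p hf
  have h2 : (g : M → ℝ) = h ∘ f := funext hg
  rw [← h2] at h1
  refine (dFun_apply g p v).trans ?_
  rw [h1.mfderiv]
  refine Eq.trans ?_ (congrArg (h' * ·) (dFun_apply f p v)).symm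
  exact mul_comm _ _

theorem valAt_dFun_expFun (c : ℝ) (f : C^∞⟮𝓘(ℝ, E), M; 𝓘(ℝ, ℝ), ℝ⟯) (p : M) :
    valAt (dFun (expFun c f)) p = (c * Real.exp (c * f p)) • valAt (dFun f) p := by
  refine valAt_dFun_comp f _ (h := fun t => Real.exp (c * t)) (fun _ => rfl) ?_
  have := ((hasDerivAt_id (f p)).const_mul c).exp
  simpa [mul_comm] using this

theorem valAt_dFun_neg (f : C^∞⟮𝓘(ℝ, E), M; 𝓘(ℝ, ℝ), ℝ⟯) (p : M) :
    valAt (dFun (-f)) p = -valAt (dFun f) p := by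
  rw [valAt_dFun_comp f (-f) (h := fun t => -t) (fun _ => rfl) (hasDerivAt_id (f p)).neg]
  ext v
  simp

theorem wedgeOp_dFun_expFun (c : ℝ) (f : C^∞⟮𝓘(ℝ, E), M; 𝓘(ℝ, ℝ), ℝ⟯) (x : TotalForm E M) :
    wedgeOp (dFun (expFun c f)) x = c • mulOp (expFun c f) (wedgeOp (dFun f) x) := by
  refine total_ext fun p => ?_
  rw [evalAt_wedgeOp_one, map_smul, evalAt_mulOp, evalAt_wedgeOp_one, valAt_dFun_expFun,
    outer1_smul_left, mul_smul, expFun_apply]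

namespace LCSStructure

variable (S S' : LCSStructure E M)

theorem dk_apply (k : ℤ) (x : TotalForm E M) :
    S.dk k x = extDOp x + (k : ℝ) • wedgeOp S.lee x := by
  rw [← wedgeOp_smul]
  exact twistedD_apply _ x

theorem wedgeOp_L (θ : Form E M 1) (x : TotalForm E M) :
    wedgeOp θ (S.L x) = S.L (wedgeOp θ x) := by
  refine total_ext fun p => ?_
  have h1 := S.evalAt_L_pow p 1
  simp only [pow_one] at h1
  rw [h1, evalAt_wedgeOp_one, h1, evalAt_wedgeOp_one, outer2_outer1]

/-- Applied to the constant 1 the hypothesis reads Lη = 0. L is injective on one-forms for n ≥ 2,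
and there are none for n = 0; for n = 1 it fails since Lη is then a three-form on a surface. -/
theorem eq_zero_of_wedgeOp_L (hn : Module.finrank ℝ E = 2 * n) (hn1 : n ≠ 1) {η : Form E M 1}
    (h : ∀ x, wedgeOp η (S.L x) = 0) : η = 0 := by
  refine tot_injective ?_
  have h1 := h (unit E M)
  rw [wedgeOp_L, wedgeOp_unit] at h1
  rw [map_zero]
  rcases Nat.eq_zero_or_pos n with rfl | hn0
  · exact eq_zero_of_gt_finrank (by rw [hn]; norm_num) (tot_mem (j := 1) rfl η)
  · exact S.eq_zero_of_L_pow hn (tot_mem (j := 1) rfl η) 1 (by push_cast; omega)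
      (by rwa [pow_one])

variable {S S'}

theorem L_eq_of_conformal {f : C^∞⟮𝓘(ℝ, E), M; 𝓘(ℝ, ℝ), ℝ⟯} {ε : ℝ}
    (hω : ∀ p, valAt S'.form p = (ε * Real.exp (f p)) • valAt S.form p) (x : TotalForm E M) :
    S'.L x = ε • mulOp (expFun 1 f) (S.L x) := by
  refine total_ext fun p => ?_
  have h1 := S.evalAt_L_pow p 1
  have h2 := S'.evalAt_L_pow p 1
  simp only [pow_one] at h1 h2
  rw [map_smul, evalAt_mulOp, h1, h2, hω, outer2_smul_left, expFun_apply, one_mul, smul_smul]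
  rfl

/-- Substituting L' = ε e^f L into d'_1 L' = L' d and subtracting d_1 L = L d leaves ε e^f (θ' + df
- θ) ∧ Lx = 0 for all x. -/
theorem lee_eq_of_conformal (hn : Module.finrank ℝ E = 2 * n) (hn1 : n ≠ 1)
    {f : C^∞⟮𝓘(ℝ, E), M; 𝓘(ℝ, ℝ), ℝ⟯} {ε : ℝ} (hε : ε ≠ 0)
    (hω : ∀ p, valAt S'.form p = (ε * Real.exp (f p)) • valAt S.form p) :
    S.lee = S'.lee + dFun f := by
  have h : (S'.lee + dFun f) + (-1 : ℝ) • S.lee = 0 := by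
    refine S.eq_zero_of_wedgeOp_L hn hn1 fun x => ?_
    have h1 := S.dk_L 0 x
    have h2 := S'.dk_L 0 x
    rw [zero_add, dk_apply, dk_apply, Int.cast_one, one_smul, Int.cast_zero, zero_smul, add_zero]
      at h1 h2
    rw [L_eq_of_conformal hω, L_eq_of_conformal hω, map_smul, map_smul, extDOp_mulOp,
      wedgeOp_dFun_expFun, one_smul, ← h1, map_add, ← mulOp_wedgeOp] at h2
    refine total_ext fun p => ?_
    have h3 := congrArg (evalAt p) h2
    simp only [map_smul, map_add, evalAt_mulOp] at h3
    rw [wedgeOp_add, wedgeOp_add, wedgeOp_smul, map_add, map_add, map_smul, map_zero]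
    have h4 : (ε * expFun 1 f p) • (evalAt p (wedgeOp S'.lee (S.L x)) +
        evalAt p (wedgeOp (dFun f) (S.L x)) + (-1 : ℝ) • evalAt p (wedgeOp S.lee (S.L x))) = 0 := by
      rw [mul_smul]
      linear_combination (norm := module) h3
    exact (smul_eq_zero.1 h4).resolve_left (mul_ne_zero hε (Real.exp_pos _).ne')
  refine form_ext fun p => ?_
  have h5 := congrArg (fun α : Form E M 1 => valAt α p) h
  have h6 : valAt (S'.lee + dFun f) p + (-1 : ℝ) • valAt S.lee p = 0 := h5
  ext v
  have h7 := congrArg (fun a : E [⋀^Fin 1]→L[ℝ] ℝ => a v) h6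
  simp at h7
  linarith

/-- Conformally equivalent structures: multiplication by `e^{kf}` is a map of filtered
complexes. -/
def conformalMap {f : C^∞⟮𝓘(ℝ, E), M; 𝓘(ℝ, ℝ), ℝ⟯} {ε : ℝ} (hε : ε ≠ 0)
    (hω : ∀ p, valAt S'.form p = (ε * Real.exp (f p)) • valAt S.form p)
    (hθ : S.lee = S'.lee + dFun f) (k : ℤ) :
    FilteredComplex.Map (S.filteredComplex k) (S'.filteredComplex k) where
  toLin := mulOp (expFun k f)
  map_d x := by
    change mulOp (expFun k f) (S.dk k x) = S'.dk k (mulOp (expFun k f) x)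
    rw [dk_apply, dk_apply, extDOp_mulOp, wedgeOp_dFun_expFun, ← mulOp_wedgeOp, hθ,
      wedgeOp_add, smul_add, map_add, map_add, map_smul, map_smul]
    abel
  map_deg j x hx := mulOp_mem _ hx
  map_F p := by
    rintro _ ⟨x, rfl⟩
    -- L'^p = ε^p e^{pf} L^p, so the factor e^{kf} is split as e^{pf} e^{(k-p)f}.
    refine ⟨(ε ^ p.toNat)⁻¹ • mulOp (expFun (k - p.toNat) f) x, total_ext fun q => ?_⟩
    rw [map_smul, map_smul, evalAt_mulOp, evalAt_L_pow, evalAt_L_pow, evalAt_mulOp, hω,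
      outer2_smul_left, smul_pow, map_smul, LinearMap.smul_apply, smul_smul, smul_smul]
    congr 1
    rw [expFun_apply, expFun_apply, mul_pow, ← Real.exp_nat_mul, sub_mul, Real.exp_sub]
    have := Real.exp_pos (p.toNat * f q)
    field_simp

theorem nonempty_iso_of_conformal {f : C^∞⟮𝓘(ℝ, E), M; 𝓘(ℝ, ℝ), ℝ⟯} {ε : ℝ} (hε : ε ≠ 0)
    (hω : ∀ p, valAt S'.form p = (ε * Real.exp (f p)) • valAt S.form p)
    (hθ : S.lee = S'.lee + dFun f) (k : ℤ) :
    Nonempty (S.spectralSequence k ≅ S'.spectralSequence k) := by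
  -- The situation is symmetric under f ↦ -f, ε ↦ ε⁻¹, which provides the inverse map of filtered
  -- complexes.
  have hω' (p : M) : valAt S.form p = (ε⁻¹ * Real.exp ((-f) p)) • valAt S'.form p := by
    rw [hω, smul_smul]
    have h : ε⁻¹ * Real.exp ((-f) p) * (ε * Real.exp (f p)) = 1 := by
      rw [show (-f) p = -(f p) from rfl, Real.exp_neg]
      field_simp
    rw [h, one_smul]
  have hθ' : S'.lee = S.lee + dFun (-f) := by
    refine form_ext fun p => ?_
    have h1 : valAt (S.lee + dFun (-f)) p = valAt S.lee p + valAt (dFun (-f)) p := rfl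
    have h2 : valAt S.lee p = valAt S'.lee p + valAt (dFun f) p := by rw [hθ]; rfl
    rw [h1, h2, valAt_dFun_neg, add_neg_cancel_right]
  have hinv (f : C^∞⟮𝓘(ℝ, E), M; 𝓘(ℝ, ℝ), ℝ⟯) (x : TotalForm E M) :
      mulOp (expFun k (-f)) (mulOp (expFun k f) x) = x := by
    refine total_ext fun p => ?_
    rw [evalAt_mulOp, evalAt_mulOp, smul_smul, expFun_apply, expFun_apply, ← Real.exp_add,
      show (-f) p = -(f p) from rfl, mul_neg, neg_add_cancel, Real.exp_zero, one_smul]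
  refine ⟨FilteredComplex.spectralSequenceIso (conformalMap hε hω hθ k)
    (conformalMap (inv_ne_zero hε) hω' hθ' k) (hinv f) fun x => ?_⟩
  have := hinv (-f) x
  rwa [neg_neg] at this

end LCSStructure

end Conformal


/-! ### Cohomologous structures: the terms E_1 outside the range q = n, 0 ≤ p < n. -/

theorem FilteredComplex.mem_den_one {K : Type*} [AddCommGroup K] [Module ℝ K]
    {C : FilteredComplex K} {p q : ℤ} {x : K} :
    x ∈ C.Z (1 - 1) (p + 1) (q - 1) ⊔ C.B (1 - 1) p q ↔ ∃ y ∈ C.F (p + 1), y ∈ C.deg (p + q) ∧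
      ∃ z ∈ C.F p, z ∈ C.deg (p + q - 1) ∧ x = y + C.d z := by
  have hpq : p + 1 + (q - 1) = p + q := by omega
  constructor
  · intro h
    obtain ⟨y, hy, b, hb, rfl⟩ := Submodule.mem_sup.1 h
    obtain ⟨h1, h2, -⟩ := FilteredComplex.mem_Z.1 hy
    obtain ⟨-, -, z, h3, h4, rfl⟩ := FilteredComplex.mem_B.1 hb
    exact ⟨y, h1, hpq ▸ h2, z, by simpa using h3, h4, rfl⟩
  · rintro ⟨y, h1, h2, z, h3, h4, rfl⟩
    refine Submodule.add_mem_sup (FilteredComplex.mem_Z.2 ⟨h1, hpq ▸ h2, ?_⟩)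
      (FilteredComplex.mem_B.2 ⟨C.d_F _ _ h3, ?_, z, by simpa using h3, h4, rfl⟩)
    · simpa using C.d_F _ _ h1
    · have := C.d_deg _ _ h4
      rwa [sub_add_cancel] at this

theorem FilteredComplex.nonempty_equiv_of_subsingleton {K : Type*} [AddCommGroup K] [Module ℝ K]
    {C C' : FilteredComplex K} {p q : ℤ}
    (h : ∀ x ∈ C.Z 1 p q, x ∈ C.Z (1 - 1) (p + 1) (q - 1) ⊔ C.B (1 - 1) p q)
    (h' : ∀ x ∈ C'.Z 1 p q, x ∈ C'.Z (1 - 1) (p + 1) (q - 1) ⊔ C'.B (1 - 1) p q) :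
    Nonempty (C.E 1 p q ≃ₗ[ℝ] C'.E 1 p q) := by
  have key (C : FilteredComplex K)
      (h : ∀ x ∈ C.Z 1 p q, x ∈ C.Z (1 - 1) (p + 1) (q - 1) ⊔ C.B (1 - 1) p q) (x : C.E 1 p q) :
      x = 0 := by
    obtain ⟨x, rfl⟩ := C.cls_surjective _ _ _ x
    exact (C.cls_eq_zero x).2 (h x.1 x.2)
  exact ⟨{ toFun := 0
           invFun := 0
           map_add' := fun _ _ => (add_zero _).symm
           map_smul' := fun _ _ => (smul_zero _).symm
           left_inv := fun x => (key C h x).symm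
           right_inv := fun x => (key C' h' x).symm }⟩

/-- An equivalence of the quotients of two submodules of `K` from inverse maps. -/
theorem nonempty_quotient_equiv {K : Type*} [AddCommGroup K] [Module ℝ K] {N N' D D' : Submodule ℝ K}
    (T T' : K →ₗ[ℝ] K) (h1 : ∀ x, T' (T x) = x) (h2 : ∀ x, T (T' x) = x)
    (hN : ∀ x ∈ N, T x ∈ N') (hN' : ∀ x ∈ N', T' x ∈ N) (hD : ∀ x ∈ N, x ∈ D → T x ∈ D')
    (hD' : ∀ x ∈ N', x ∈ D' → T' x ∈ D) :
    Nonempty ((N ⧸ D.submoduleOf N) ≃ₗ[ℝ] (N' ⧸ D'.submoduleOf N')) := by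
  let e : N ≃ₗ[ℝ] N' :=
    { T.restrict hN with
      invFun := T'.restrict hN'
      left_inv := fun x => Subtype.ext (h1 x)
      right_inv := fun x => Subtype.ext (h2 x) }
  refine ⟨Submodule.Quotient.equiv _ _ e ?_⟩
  ext y
  constructor
  · rintro ⟨x, hx, rfl⟩
    exact hD x.1 x.2 hx
  · intro hy
    refine ⟨e.symm y, hD' y.1 y.2 hy, e.apply_symm_apply y⟩

theorem FilteredComplex.nonempty_equiv_of_le {K : Type*} [AddCommGroup K] [Module ℝ K]
    {C C' : FilteredComplex K} {p q : ℤ} (h1 : C.Z 1 p q = C'.Z 1 p q)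
    (h2 : ∀ x ∈ C.Z 1 p q, x ∈ C.Z (1 - 1) (p + 1) (q - 1) ⊔ C.B (1 - 1) p q ↔
      x ∈ C'.Z (1 - 1) (p + 1) (q - 1) ⊔ C'.B (1 - 1) p q) :
    Nonempty (C.E 1 p q ≃ₗ[ℝ] C'.E 1 p q) :=
  nonempty_quotient_equiv LinearMap.id LinearMap.id (fun _ => rfl) (fun _ => rfl)
    (fun _ hx => h1 ▸ hx) (fun _ hx => h1 ▸ hx) (fun x hx h => (h2 x hx).1 h)
    (fun x hx h => (h2 x (h1 ▸ hx)).2 h)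

section Cohomologous

variable {E : Type*} [NormedAddCommGroup E] [NormedSpace ℝ E] [FiniteDimensional ℝ E]
  {M : Type*} [TopologicalSpace M] [ChartedSpace E M] [IsManifold 𝓘(ℝ, E) ∞ M] {n : ℕ}

theorem degreePart_congr {i j : ℤ} (h : i = j) {x : TotalForm E M} (hx : x ∈ degreePart E M i) :
    x ∈ degreePart E M j := h ▸ hx

namespace LCSStructure

variable (S : LCSStructure E M) {S' : LCSStructure E M} {k q : ℤ} {P : ℕ}

theorem mem_Z_one {x : TotalForm E M} : x ∈ (S.filteredComplex k).Z 1 P q ↔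
    x ∈ LinearMap.range (S.L ^ P) ∧ x ∈ degreePart E M (P + q) ∧
      S.dk k x ∈ LinearMap.range (S.L ^ (P + 1)) :=
  FilteredComplex.mem_Z

/-- The denominator of E_1 is F^{P+1} + d_k F^P in the given degree; L^P is pulled out through d_k
L^P = L^P d_{k-P}. -/
theorem mem_den_one {x : TotalForm E M} :
    x ∈ (S.filteredComplex k).Z (1 - 1) (P + 1) (q - 1) ⊔ (S.filteredComplex k).B (1 - 1) P q ↔
    ∃ b ∈ degreePart E M (q - P - 2), ∃ c ∈ degreePart E M (q - P - 1),
      x = (S.L ^ P) (S.L b + S.dk (k - P) c) := by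
  rw [FilteredComplex.mem_den_one]
  have h (c : TotalForm E M) : (S.L ^ P) (S.dk (k - P) c) = S.dk k ((S.L ^ P) c) := by
    rw [← dk_L_pow, sub_add_cancel]
  constructor
  · rintro ⟨y, hy, hy', z, hz, hz', rfl⟩
    obtain ⟨b, hb, rfl⟩ := S.exists_L_pow_eq_of_mem (j := q - P - 2) (r := P + 1) hy
      (degreePart_congr (by push_cast; ring) hy')
    obtain ⟨c, hc, rfl⟩ := S.exists_L_pow_eq_of_mem (j := q - P - 1) (r := P) hz
      (degreePart_congr (by ring) hz')
    exact ⟨b, hb, c, hc, by rw [map_add, h, L_pow_succ]; rfl⟩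
  · rintro ⟨b, hb, c, hc, rfl⟩
    refine ⟨(S.L ^ (P + 1)) b, ⟨b, rfl⟩, ?_, (S.L ^ P) c, ⟨c, rfl⟩, ?_, ?_⟩
    · exact degreePart_congr (by push_cast; ring) (S.L_pow_mem (P + 1) hb)
    · exact degreePart_congr (by ring) (S.L_pow_mem P hc)
    · rw [map_add, h, L_pow_succ]; rfl

/-- The pairs `(α, β)` with `d_m α = L β`, where `α` is of degree `j`. -/
def primPairs (m j : ℤ) : Submodule ℝ (TotalForm E M × TotalForm E M) where
  carrier := {x | x.1 ∈ degreePart E M j ∧ x.2 ∈ degreePart E M (j - 1) ∧ S.dk m x.1 = S.L x.2}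
  add_mem' hx hy := ⟨add_mem hx.1 hy.1, add_mem hx.2.1 hy.2.1, by
    rw [Prod.fst_add, Prod.snd_add, map_add, map_add, hx.2.2, hy.2.2]⟩
  zero_mem' := ⟨zero_mem _, zero_mem _, by
    rw [Prod.fst_zero, Prod.snd_zero, map_zero, map_zero]⟩
  smul_mem' r x hx := ⟨Submodule.smul_mem _ r hx.1, Submodule.smul_mem _ r hx.2.1, by
    rw [Prod.smul_fst, Prod.smul_snd, map_smul, map_smul, hx.2.2]⟩

/-- The pairs `(α, β)` with `α = L b + d_m c`. -/
def trivialPairs (m j : ℤ) : Submodule ℝ (TotalForm E M × TotalForm E M) :=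
  ((degreePart E M (j - 2)).map S.L ⊔ (degreePart E M (j - 1)).map (S.dk m)).comap
    (LinearMap.fst ℝ _ _)

variable {S} in
theorem mem_trivialPairs {m j : ℤ} {x : TotalForm E M × TotalForm E M} :
    x ∈ S.trivialPairs m j ↔ ∃ b ∈ degreePart E M (j - 2), ∃ c ∈ degreePart E M (j - 1),
      x.1 = S.L b + S.dk m c := by
  constructor
  · intro h
    obtain ⟨_, ⟨b, hb, rfl⟩, _, ⟨c, hc, rfl⟩, h⟩ := Submodule.mem_sup.1 h
    exact ⟨b, hb, c, hc, h.symm⟩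
  · rintro ⟨b, hb, c, hc, h⟩
    exact Submodule.mem_sup.2 ⟨_, ⟨b, hb, rfl⟩, _, ⟨c, hc, rfl⟩, h.symm⟩

theorem L_dk (m : ℤ) (x : TotalForm E M) : S.L (S.dk (m - 1) x) = S.dk m (S.L x) := by
  rw [← dk_L, sub_add_cancel]

theorem eq_of_L_eq (hn : Module.finrank ℝ E = 2 * n) {j : ℤ} {x y : TotalForm E M}
    (hx : x ∈ degreePart E M j) (hy : y ∈ degreePart E M j) (r : ℕ) (hr : j + r ≤ n)
    (h : (S.L ^ r) x = (S.L ^ r) y) : x = y := by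
  refine eq_of_add_neg_one_smul (S.eq_zero_of_L_pow hn (add_mem hx (Submodule.smul_mem _ _ hy)) r hr ?_)
  rw [map_add, map_smul, h]
  exact neg_one_smul_cancel _

/-- The description of `E_1^{p,q}` for `p ≥ 0`, `q < n`. -/
theorem nonempty_E_one_equiv (hn : Module.finrank ℝ E = 2 * n) (hq : q < n) :
    Nonempty ((S.primPairs (k - P) (q - P) ⧸
      (S.trivialPairs (k - P) (q - P)).submoduleOf (S.primPairs (k - P) (q - P))) ≃ₗ[ℝ]
      (S.filteredComplex k).E 1 P q) := by
  have h (c : TotalForm E M) : S.dk k ((S.L ^ P) c) = (S.L ^ P) (S.dk (k - P) c) := by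
    rw [← dk_L_pow, sub_add_cancel]
  let f₀ : TotalForm E M × TotalForm E M →ₗ[ℝ] TotalForm E M := (S.L ^ P) ∘ₗ LinearMap.fst ℝ _ _
  have hf₀ : ∀ x ∈ S.primPairs (k - P) (q - P), f₀ x ∈ (S.filteredComplex k).Z 1 P q := by
    rintro ⟨α, β⟩ ⟨h1, h2, h3⟩
    refine S.mem_Z_one.2 ⟨⟨α, rfl⟩, ?_, ⟨β, ?_⟩⟩
    · exact degreePart_congr (by ring) (S.L_pow_mem P h1)
    · exact (S.L_pow_succ P β).trans ((congrArg _ h3.symm).trans (h α).symm)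
  let f := (S.filteredComplex k).cls 1 P q ∘ₗ f₀.restrict hf₀
  have hf : Function.Surjective f := by
    intro e
    obtain ⟨⟨x, hx⟩, rfl⟩ := (S.filteredComplex k).cls_surjective _ _ _ e
    obtain ⟨h1, h2, h3⟩ := S.mem_Z_one.1 hx
    obtain ⟨α, hα, rfl⟩ := S.exists_L_pow_eq_of_mem (j := q - P) (r := P) h1
      (degreePart_congr (by ring) h2)
    obtain ⟨β, hβ, hβ'⟩ := S.exists_L_pow_eq_of_mem (j := q - P - 1) (r := P + 1) h3
      -- Here L^P d_{k-P} α = L^{P+1} β. Cancelling L^P in degree q - P + 1 needs exactly q + 1 ≤ n,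
      -- which is where q < n enters.
      (by convert S.dk_degree k _ _ h2 using 2; push_cast; ring)
    rw [h, L_pow_succ] at hβ'
    have h4 := S.eq_of_L_eq hn (j := q - P + 1)
      (by convert S.L_mem hβ using 2; ring) (S.dk_degree _ _ _ hα) P (by omega) hβ'
    exact ⟨⟨(α, β), hα, hβ, h4.symm⟩, rfl⟩
  have hker : LinearMap.ker f = (S.trivialPairs (k - P) (q - P)).submoduleOf
      (S.primPairs (k - P) (q - P)) := by
    ext ⟨⟨α, β⟩, hα, hβ, h3⟩
    refine ((S.filteredComplex k).cls_eq_zero _).trans (S.mem_den_one.trans ?_)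
    refine Iff.trans ?_ mem_trivialPairs.symm
    refine exists_congr fun b => and_congr_right fun hb => exists_congr fun c =>
      and_congr_right fun hc => ⟨fun h4 => ?_, fun h4 => congrArg _ h4⟩
    refine S.eq_of_L_eq hn hα (add_mem ?_ ?_) P (by omega) h4
    · convert S.L_mem hb using 2; ring
    · convert S.dk_degree _ _ _ hc using 2; ring
  exact ⟨(Submodule.quotEquivOfEq _ _ hker.symm).trans (f.quotKerEquivOfSurjective hf)⟩

section

variable {S} {ρ : Form E M 1}

theorem wedgeOp_twisted (θ : Form E M 1) (x : TotalForm E M) :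
    wedgeOp (extD ρ + wedgeForm θ ρ) x =
      extDOp (wedgeOp ρ x) + wedgeOp ρ (extDOp x) + wedgeOp θ (wedgeOp ρ x) := by
  have h := extDOp_wedgeOp ρ x
  rw [wedgeOp_add, ← wedgeOp_wedgeOp, h, pow_one, neg_one_smul, neg_add_cancel_right]

/-- In d_m(ρ ∧ x) + ρ ∧ d_{m-1} x the terms ρ ∧ dx cancel and the twists leave m - (m - 1) = 1 copy
of θ ∧ ρ ∧ x. So L and L' are chain homotopic from d_{m-1} to d_m, for every m. -/
theorem L_eq_of_cohomologous (h : S'.form = S.form + (extD ρ + wedgeForm S.lee ρ)) (m : ℤ)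
    (x : TotalForm E M) :
    S'.L x = S.L x + (S.dk m (wedgeOp ρ x) + wedgeOp ρ (S.dk (m - 1) x)) := by
  have h1 : S'.L x = S.L x + wedgeOp (extD ρ + wedgeForm S.lee ρ) x := by
    change wedgeOp S'.form x = wedgeOp S.form x + _
    rw [← wedgeOp_add, ← h]
  rw [h1, wedgeOp_twisted, dk_apply, dk_apply, map_add, map_smul, wedgeOp_one_one ρ S.lee]
  push_cast
  module

/-- By the homotopy formula L' also satisfies d_1 L' = L' d_0 with the Lee form θ. Comparison with
the same relation for θ' gives (θ' - θ) ∧ L'x = 0. -/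
theorem lee_eq_of_cohomologous (hn : Module.finrank ℝ E = 2 * n) (hn1 : n ≠ 1)
    (h : S'.form = S.form + (extD ρ + wedgeForm S.lee ρ)) : S'.lee = S.lee := by
  have h0 : S'.lee + (-1 : ℝ) • S.lee = 0 := by
    refine S'.eq_zero_of_wedgeOp_L hn hn1 fun x => ?_
    have h1 : S'.dk 1 (S'.L x) = S'.L (S'.dk 0 x) := S'.dk_L 0 x
    have h2 : S.dk 1 (S.L x) = S.L (S.dk 0 x) := S.dk_L 0 x
    have h3 : S'.dk 0 x = S.dk 0 x := by
      rw [dk_apply, dk_apply, Int.cast_zero, zero_smul, zero_smul]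
    have h4 : S'.L (S.dk 0 x) = S.L (S.dk 0 x) + S.dk 1 (wedgeOp ρ (S.dk 0 x)) := by
      rw [L_eq_of_cohomologous h 1, sub_self, dk_dk, map_zero, add_zero]
    have h5 : S.dk 1 (S'.L x) = S'.L (S.dk 0 x) := by
      rw [L_eq_of_cohomologous h 1, map_add, map_add, dk_dk, zero_add, h2, sub_self, ← h4]
    have h6 : S'.dk 1 (S'.L x) = S.dk 1 (S'.L x) := by rw [h1, h3, h5]
    rw [dk_apply, dk_apply, Int.cast_one, one_smul, one_smul] at h6
    rw [wedgeOp_add, wedgeOp_smul, add_left_cancel h6]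
    exact neg_one_smul_cancel _
  refine form_ext fun p => ?_
  have h6 : valAt S'.lee p + (-1 : ℝ) • valAt S.lee p = 0 :=
    congrArg (fun α : Form E M 1 => valAt α p) h0
  ext v
  have h7 := congrArg (fun a : E [⋀^Fin 1]→L[ℝ] ℝ => a v) h6
  simp at h7
  linarith

theorem dk_eq_of_lee_eq (hθ : S'.lee = S.lee) (m : ℤ) : S'.dk m = S.dk m := by
  unfold dk; rw [hθ]

/-- L dβ = d Lβ = d²α = 0, and L is injective on degree j. -/
theorem dk_eq_zero_of_primPairs (hn : Module.finrank ℝ E = 2 * n) {m j : ℤ} (hj : j + 1 ≤ n)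
    {x : TotalForm E M × TotalForm E M} (hx : x ∈ S.primPairs m j) : S.dk (m - 1) x.2 = 0 := by
  obtain ⟨h1, h2, h3⟩ := hx
  refine S.eq_zero_of_L_pow hn (j := j) ?_ 1 (by exact_mod_cast hj) ?_
  · have := S.dk_degree (m - 1) _ _ h2
    rwa [sub_add_cancel] at this
  · rw [pow_one, L_dk, ← h3, dk_dk]

/-- Because dβ = 0, the homotopy formula reduces to L'β = Lβ + d(ρ ∧ β) = d(α + ρ ∧ β). Recording β
beside α makes this correction visibly linear. -/
theorem add_mem_primPairs (hn : Module.finrank ℝ E = 2 * n)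
    (h : S'.form = S.form + (extD ρ + wedgeForm S.lee ρ)) (hθ : S'.lee = S.lee) {m j : ℤ}
    (hj : j + 1 ≤ n) {x : TotalForm E M × TotalForm E M} (hx : x ∈ S.primPairs m j) :
    (x.1 + wedgeOp ρ x.2, x.2) ∈ S'.primPairs m j := by
  have h0 := dk_eq_zero_of_primPairs hn hj hx
  obtain ⟨h1, h2, h3⟩ := hx
  refine ⟨add_mem h1 ?_, h2, ?_⟩
  · convert wedgeOp_mem ρ h2 using 2
    push_cast; ring
  · change S'.dk m (x.1 + wedgeOp ρ x.2) = S'.L x.2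
    rw [dk_eq_of_lee_eq hθ, map_add, h3, L_eq_of_cohomologous h m, h0, map_zero, add_zero]

/-- From α = Lb + dc injectivity of L gives β = db, and the homotopy formula for b turns Lb + ρ ∧ db
into L'b - d(ρ ∧ b). Hence c is replaced by c - ρ ∧ b. -/
theorem add_mem_trivialPairs (hn : Module.finrank ℝ E = 2 * n)
    (h : S'.form = S.form + (extD ρ + wedgeForm S.lee ρ)) (hθ : S'.lee = S.lee) {m j : ℤ}
    (hj : j + 1 ≤ n) {x : TotalForm E M × TotalForm E M} (hx : x ∈ S.primPairs m j)
    (hx' : x ∈ S.trivialPairs m j) :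
    (x.1 + wedgeOp ρ x.2, x.2) ∈ S'.trivialPairs m j := by
  obtain ⟨h1, h2, h3⟩ := hx
  obtain ⟨b, hb, c, hc, h4⟩ := mem_trivialPairs.1 hx'
  have h5 : x.2 = S.dk (m - 1) b := by
    refine S.eq_of_L_eq hn h2 ?_ 1 (by push_cast; omega) ?_
    · convert S.dk_degree (m - 1) _ _ hb using 2
      ring
    · rw [pow_one, L_dk, ← h3, h4, map_add, dk_dk, add_zero]
  refine mem_trivialPairs.2 ⟨b, hb, c + (-1 : ℝ) • wedgeOp ρ b,
    add_mem hc (Submodule.smul_mem _ _ ?_), ?_⟩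
  · convert wedgeOp_mem ρ hb using 2
    push_cast; ring
  · change x.1 + wedgeOp ρ x.2 = _
    rw [h4, h5, dk_eq_of_lee_eq hθ, L_eq_of_cohomologous h m, map_add, map_smul]
    module

theorem form_eq_of_cohomologous (h : S'.form = S.form + (extD ρ + wedgeForm S.lee ρ))
    (hθ : S'.lee = S.lee) :
    S.form = S'.form + (extD ((-1 : ℝ) • ρ) + wedgeForm S'.lee ((-1 : ℝ) • ρ)) := by
  rw [hθ, map_smul, map_smul, h]
  refine form_ext fun p => ?_
  ext v
  have h1 : valAt (S.form + (extD ρ + wedgeForm S.lee ρ) +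
      ((-1 : ℝ) • extD ρ + (-1 : ℝ) • wedgeForm S.lee ρ)) p v = valAt S.form p v +
      (valAt (extD ρ) p v + valAt (wedgeForm S.lee ρ) p v) +
      (-1 * valAt (extD ρ) p v + -1 * valAt (wedgeForm S.lee ρ) p v) := rfl
  rw [h1]
  ring

/-- The map `(α, β) ↦ (α + ρ ∧ β, β)`. -/
def shear (ρ : Form E M 1) :
    TotalForm E M × TotalForm E M →ₗ[ℝ] TotalForm E M × TotalForm E M :=
  (LinearMap.fst ℝ _ _ + wedgeOp ρ ∘ₗ LinearMap.snd ℝ _ _).prod (LinearMap.snd ℝ _ _)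

theorem shear_shear (ρ : Form E M 1) (x : TotalForm E M × TotalForm E M) :
    shear ((-1 : ℝ) • ρ) (shear ρ x) = x := by
  refine Prod.ext ?_ rfl
  change x.1 + wedgeOp ρ x.2 + wedgeOp ((-1 : ℝ) • ρ) x.2 = x.1
  rw [wedgeOp_smul, add_assoc, neg_one_smul_cancel, add_zero]

/-- The case `p ≥ 0`, `q < n`. -/
theorem nonempty_E_one_equiv_of_lt (hn : Module.finrank ℝ E = 2 * n)
    (h : S'.form = S.form + (extD ρ + wedgeForm S.lee ρ)) (hθ : S'.lee = S.lee) (hq : q < n) :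
    Nonempty ((S.filteredComplex k).E 1 P q ≃ₗ[ℝ] (S'.filteredComplex k).E 1 P q) := by
  obtain ⟨e⟩ := S.nonempty_E_one_equiv (k := k) (P := P) hn hq
  obtain ⟨e'⟩ := S'.nonempty_E_one_equiv (k := k) (P := P) hn hq
  have h' := form_eq_of_cohomologous h hθ
  have hj : q - P + 1 ≤ n := by omega
  have hρ : (-1 : ℝ) • ((-1 : ℝ) • ρ) = ρ := by
    refine form_ext fun p => ?_
    ext v
    have h1 : valAt ((-1 : ℝ) • ((-1 : ℝ) • ρ)) p v = -1 * (-1 * valAt ρ p v) := rfl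
    rw [h1]
    ring
  obtain ⟨e₀⟩ := nonempty_quotient_equiv (shear ρ) (shear ((-1 : ℝ) • ρ)) (shear_shear ρ)
    (fun x => by
      have := shear_shear ((-1 : ℝ) • ρ) x
      rwa [hρ] at this)
    (fun x hx => add_mem_primPairs hn h hθ hj hx)
    (fun x hx => add_mem_primPairs hn h' hθ.symm hj hx)
    (fun x hx hx' => add_mem_trivialPairs hn h hθ hj hx hx')
    (fun x hx hx' => add_mem_trivialPairs hn h' hθ.symm hj hx hx')
  exact ⟨(e.symm.trans e₀).trans e'⟩

/-- The case `p < 0`. -/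
theorem nonempty_E_one_equiv_of_neg {p : ℤ} (hp : p < 0) :
    Nonempty ((S.filteredComplex k).E 1 p q ≃ₗ[ℝ] (S'.filteredComplex k).E 1 p q) := by
  have key (S : LCSStructure E M) (x : TotalForm E M) (hx : x ∈ (S.filteredComplex k).Z 1 p q) :
      x ∈ (S.filteredComplex k).Z (1 - 1) (p + 1) (q - 1) ⊔ (S.filteredComplex k).B (1 - 1) p q := by
    refine FilteredComplex.mem_den_one.2 ⟨x, ?_, (FilteredComplex.mem_Z.1 hx).2.1, 0, zero_mem _,
      zero_mem _, by rw [map_zero, add_zero]⟩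
    -- For p < 0 the exponent `(p + 1).toNat` is still 0, so F^{p+1} is everything and E_1 vanishes.
    change x ∈ LinearMap.range (S.L ^ (p + 1).toNat)
    rw [Int.toNat_eq_zero.2 (by omega)]
    exact ⟨x, rfl⟩
  exact FilteredComplex.nonempty_equiv_of_subsingleton (key S) (key S')

/-- The case `p ≥ 0`, `q > n`. -/
theorem nonempty_E_one_equiv_of_gt (hn : Module.finrank ℝ E = 2 * n) (hq : n < q) :
    Nonempty ((S.filteredComplex k).E 1 P q ≃ₗ[ℝ] (S'.filteredComplex k).E 1 P q) := by
  have key (S : LCSStructure E M) (x : TotalForm E M) (hx : x ∈ (S.filteredComplex k).Z 1 P q) :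
      x ∈ (S.filteredComplex k).Z (1 - 1) (P + 1) (q - 1) ⊔ (S.filteredComplex k).B (1 - 1) P q := by
    have hx' := (FilteredComplex.mem_Z.1 hx).2.1
    refine FilteredComplex.mem_den_one.2 ⟨x, ?_, hx', 0, zero_mem _,
      zero_mem _, by rw [map_zero, add_zero]⟩
    -- In degree P + q with q ≥ n + 1, every form is divisible by L^{P+1}, so F^P = F^{P+1} there.
    obtain ⟨y, -, hy⟩ := S.exists_L_pow_eq hn hx' (P + 1) (by push_cast; omega)
    exact ⟨y, hy⟩
  exact FilteredComplex.nonempty_equiv_of_subsingleton (key S) (key S')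

/-- The case `q = n ≤ p`. -/
theorem nonempty_E_one_equiv_of_ge (hn : Module.finrank ℝ E = 2 * n) (hP : n ≤ P) :
    Nonempty ((S.filteredComplex k).E 1 P n ≃ₗ[ℝ] (S'.filteredComplex k).E 1 P n) := by
  have hZ (S : LCSStructure E M) (x : TotalForm E M) :
      x ∈ (S.filteredComplex k).Z 1 P n ↔ x ∈ degreePart E M (P + n) := by
    refine ⟨fun hx => (S.mem_Z_one.1 hx).2.1, fun hx => S.mem_Z_one.2 ⟨?_, hx, ?_⟩⟩
    · obtain ⟨y, -, hy⟩ := S.exists_L_pow_eq hn hx P (by omega)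
      exact ⟨y, hy⟩
    · rw [eq_zero_of_gt_finrank (by rw [hn]; push_cast; omega) (S.dk_degree k _ _ hx)]
      exact zero_mem _
  have hD (S : LCSStructure E M) (x : TotalForm E M) :
      x ∈ (S.filteredComplex k).Z (1 - 1) (P + 1) (n - 1) ⊔ (S.filteredComplex k).B (1 - 1) P n ↔
        x = 0 := by
    refine ⟨fun hx => ?_, fun hx => hx ▸ zero_mem _⟩
    obtain ⟨b, hb, c, hc, rfl⟩ := S.mem_den_one.1 hx
    -- The forms b and c would have degrees n - P - 2 and n - P - 1, both negative.
    rw [eq_zero_of_neg (by omega) hb, eq_zero_of_neg (by omega) hc, map_zero, map_zero, add_zero,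
      map_zero]
  refine FilteredComplex.nonempty_equiv_of_le ?_ fun x _ => (hD S x).trans (hD S' x).symm
  ext x
  exact (hZ S x).trans (hZ S' x).symm

end

end LCSStructure

end Cohomologous


/-! ### Independence of exponentials, global extension of local data, and the cardinality of Ω^*(M).
-/

/-- Exponentials with distinct rates are linearly independent as germs at zero. -/
theorem eq_zero_of_sum_exp_eventually {s : Finset ℝ} {c : ℝ → ℝ}
    (h : ∀ᶠ x in nhds (0 : ℝ), ∑ t ∈ s, c t * Real.exp (t * x) = 0) : ∀ t ∈ s, c t = 0 := by
  have han : AnalyticOnNhd ℝ (fun x : ℝ => ∑ t ∈ s, c t * Real.exp (t * x)) Set.univ := by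
    intro x _
    fun_prop
  have h1 := han.eqOn_zero_of_preconnected_of_eventuallyEq_zero isPreconnected_univ
    (Set.mem_univ 0) h
  -- By analyticity the relation holds on all of ℝ. The exponentials are distinct characters of (ℝ,
  -- +), so Dedekind's independence of characters applies.
  let e (t : ℝ) : Multiplicative ℝ →* ℝ :=
    { toFun := fun x => Real.exp (t * x.toAdd)
      map_one' := by simp
      map_mul' := fun x y => by simp [mul_add, Real.exp_add] }
  have he : Function.Injective e := fun t t' htt' => by
    have := congrArg (fun f : Multiplicative ℝ →* ℝ => f (Multiplicative.ofAdd 1)) htt'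
    simpa [e] using this
  have h2 := (linearIndependent_monoidHom (Multiplicative ℝ) ℝ).comp e he
  refine linearIndependent_iff'.1 h2 s c (funext fun x => ?_)
  simpa [e] using h1 (Set.mem_univ x.toAdd)

section Local

variable {E : Type*} [NormedAddCommGroup E] [NormedSpace ℝ E] [FiniteDimensional ℝ E]
  {M : Type*} [TopologicalSpace M] [ChartedSpace E M] [IsManifold 𝓘(ℝ, E) ∞ M] {k : ℕ}

theorem eventually_valAt_ne_zero {α : Form E M k} {p : M} (h : valAt α p ≠ 0) :
    ∀ᶠ x in nhds p, valAt α x ≠ 0 := by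
  have h0 : chartRep p α.1 (chartAt E p p) ≠ 0 := by
    intro h0
    refine h (ContinuousAlternatingMap.ext fun v => (apply_eq_chartRep α.1 p v).trans ?_)
    rw [h0]
    rfl
  have h1 : ContinuousAt (chartRep p α.1) (chartAt E p p) :=
    (α.2 p).continuousOn.continuousAt ((chartAt E p).open_target.mem_nhds (mem_chart_target E p))
  have h2 : ContinuousAt (chartAt E p) p := (chartAt E p).continuousAt (mem_chart_source E p)
  filter_upwards [h2.eventually (h1.eventually_ne h0),
    (chartAt E p).open_source.mem_nhds (mem_chart_source E p)] with x hx hx' hx0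
  refine hx (ContinuousAlternatingMap.ext fun v => ?_)
  change valAt α ((chartAt E p).symm (chartAt E p x)) _ = 0
  rw [(chartAt E p).left_inv hx', hx0]
  rfl

theorem eventually_evalAt_ne_zero {x : TotalForm E M} {p : M} (h : evalAt p x ≠ 0) :
    ∀ᶠ y in nhds p, evalAt y x ≠ 0 := by
  obtain ⟨k, hk⟩ := Function.ne_iff.1 h
  filter_upwards [eventually_valAt_ne_zero (α := x k) (p := p) hk] with y hy hy0
  exact hy (congrFun hy0 k)

theorem eq_zero_of_denseRange {ι : Type*} {u : ι → M} (hu : DenseRange u) {x : TotalForm E M}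
    (h : ∀ i, evalAt (u i) x = 0) : x = 0 := by
  refine total_ext fun p => ?_
  rw [map_zero]
  by_contra hp
  obtain ⟨s, hs, hso, hps⟩ := eventually_nhds_iff.1 (eventually_evalAt_ne_zero hp)
  obtain ⟨i, hi⟩ := hu.exists_mem_open hso ⟨p, hps⟩
  exact hs _ hi (h i)

-- By continuity a form is determined by its coordinates on a countable dense set. This embeds
-- Ω^*(M) in a countable power of ℝ, whose cardinality is the continuum.
open Cardinal in
theorem lift_mk_totalForm_le [SecondCountableTopology M] [Nonempty M] :
    Cardinal.lift.{0} #(TotalForm E M) ≤ Cardinal.lift (#ℝ) := by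
  let d (k : ℕ) : ℕ := Module.finrank ℝ (E [⋀^Fin k]→L[ℝ] ℝ)
  let f : TotalForm E M → (ℕ × (Σ k, Fin (d k))) → ℝ := fun x i =>
    (Module.finBasis ℝ (E [⋀^Fin i.2.1]→L[ℝ] ℝ)).repr
      (evalAt (TopologicalSpace.denseSeq M i.1) x i.2.1) i.2.2
  have hf : Function.Injective f := by
    intro x y hxy
    refine eq_of_add_neg_one_smul (eq_zero_of_denseRange (TopologicalSpace.denseRange_denseSeq M) fun i => ?_)
    have h1 : evalAt (TopologicalSpace.denseSeq M i) x = evalAt (TopologicalSpace.denseSeq M i) y := by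
      funext k
      refine (Module.finBasis ℝ (E [⋀^Fin k]→L[ℝ] ℝ)).repr.injective (Finsupp.ext fun j => ?_)
      exact congrFun hxy (i, ⟨k, j⟩)
    rw [map_add, map_smul, h1]
    module
  have h2 : #((ℕ × (Σ k, Fin (d k))) → ℝ) ≤ #ℝ := by
    rw [Cardinal.mk_arrow, Cardinal.lift_id, Cardinal.lift_id, Cardinal.mk_real]
    calc 𝔠 ^ #(ℕ × (Σ k, Fin (d k))) ≤ 𝔠 ^ ℵ₀ :=
          Cardinal.power_le_power_left Cardinal.continuum_ne_zero Cardinal.mk_le_aleph0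
      _ = 𝔠 := Cardinal.continuum_power_aleph0
  exact (Cardinal.lift_mk_le_lift_mk_of_injective hf).trans (Cardinal.lift_le.2 h2)

/-- Every linear germ at a point extends to a smooth function. -/
theorem exists_linear_germ [T2Space M] (p : M) (φ : E →L[ℝ] ℝ) :
    ∃ f : C^∞⟮𝓘(ℝ, E), M; 𝓘(ℝ, ℝ), ℝ⟯, ∀ᶠ x in nhds p, f x = φ (chartAt E p x - chartAt E p p) := by
  obtain ⟨b⟩ : Nonempty (SmoothBumpFunction 𝓘(ℝ, E) p) := inferInstance
  have h1 : ContMDiffOn 𝓘(ℝ, E) 𝓘(ℝ, ℝ) ∞ (fun x => φ (chartAt E p x - chartAt E p p))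
      (chartAt E p).source := by
    have h2 : ContDiff ℝ ∞ fun y : E => φ (y - chartAt E p p) := by fun_prop
    exact h2.contMDiff.comp_contMDiffOn contMDiffOn_chart
  refine ⟨⟨fun x => b x • φ (chartAt E p x - chartAt E p p), b.contMDiff_smul h1⟩, ?_⟩
  filter_upwards [b.eventuallyEq_one] with x hx
  exact (congrArg (· * φ (chartAt E p x - chartAt E p p)) hx).trans (one_mul _)

theorem valAt_dFun_of_germ {p : M} {φ : E →L[ℝ] ℝ} {f : C^∞⟮𝓘(ℝ, E), M; 𝓘(ℝ, ℝ), ℝ⟯}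
    (h : ∀ᶠ x in nhds p, f x = φ (chartAt E p x - chartAt E p p)) (v : Fin 1 → E) :
    valAt (dFun f) p v =
      φ ((show E →L[ℝ] E from mfderiv 𝓘(ℝ, E) 𝓘(ℝ, E) (chartAt E p) p) (v 0)) := by
  have h1 : ContMDiffAt 𝓘(ℝ, E) 𝓘(ℝ, E) ∞ (chartAt E p) p :=
    contMDiffOn_chart.contMDiffAt ((chartAt E p).open_source.mem_nhds (mem_chart_source E p))
  have h2 : HasFDerivAt (fun y : E => φ (y - chartAt E p p)) φ (chartAt E p p) :=
    φ.hasFDerivAt.comp _ ((hasFDerivAt_id _).sub_const _)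
  have h3 := (h2.hasMFDerivAt.comp p (h1.mdifferentiableAt (by simp)).hasMFDerivAt).congr_of_eventuallyEq h
  refine (dFun_apply f p v).trans ?_
  rw [h3.mfderiv]
  rfl

theorem exists_dFun_eq [T2Space M] (p : M) (θ : E [⋀^Fin 1]→L[ℝ] ℝ) :
    ∃ φ : E →L[ℝ] ℝ, ∀ f : C^∞⟮𝓘(ℝ, E), M; 𝓘(ℝ, ℝ), ℝ⟯,
      (∀ᶠ x in nhds p, f x = φ (chartAt E p x - chartAt E p p)) → valAt (dFun f) p = θ := by
  refine ⟨((ContinuousAlternatingMap.ofSubsingleton ℝ E ℝ (0 : Fin 1)).symm θ).comp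
    (show E →L[ℝ] E from mfderiv 𝓘(ℝ, E) 𝓘(ℝ, E) (chartAt E p).symm (chartAt E p p)),
    fun f hf => ContinuousAlternatingMap.ext fun v => ?_⟩
  rw [valAt_dFun_of_germ hf]
  have h1 := chart_symm_deriv p (mem_chart_source E p) (v 0)
  conv_rhs => rw [vec_one_eq v]
  refine Eq.trans ?_ (congrArg (fun u : E => θ ![u]) h1)
  change θ (Function.const _ _) = _
  congr 1
  ext i
  rw [Subsingleton.elim i 0]
  rfl

/-- Euler's identity writes X as (j + 1)⁻¹ Σ bⁱ ∧ ι_{b_i} X. The covectors lift to differentials of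
functions, and the contractions lift by induction on the degree. -/
theorem exists_evalAt_eq [T2Space M] (p : M) {j : ℕ} {X : AltPi E} (hX : X ∈ altDeg E j) :
    ∃ x ∈ degreePart E M j, evalAt p x = X := by
  induction j generalizing X with
  | zero =>
    refine ⟨X 0 0 • unit E M, Submodule.smul_mem _ _ (tot_mem rfl _), ?_⟩
    rw [map_smul, unit, evalAt_tot]
    funext k
    by_cases hk : k = 0
    · subst hk
      rw [Pi.smul_apply, Pi.single_eq_same]
      ext v
      rw [Subsingleton.elim v 0]
      exact mul_one _
    · rw [Pi.smul_apply, Pi.single_eq_of_ne hk, smul_zero, hX k (by exact_mod_cast hk)]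
  | succ j ih =>
    let b := Module.finBasis ℝ E
    have h1 (i) : inner1 (b i) X ∈ altDeg E j := by
      have := inner1_mem hX (b i)
      rwa [show ((j + 1 : ℕ) : ℤ) - 1 = j by push_cast; ring] at this
    choose x hx hx' using fun i => ih (h1 i)
    choose φ hφ using fun i => exists_dFun_eq (M := M) p (coordForm b i)
    choose f hf using fun i => exists_linear_germ (M := M) p (φ i)
    refine ⟨((j + 1 : ℕ) : ℝ)⁻¹ • ∑ i, wedgeOp (dFun (f i)) (x i), Submodule.smul_mem _ _
      (Submodule.sum_mem _ fun i _ => ?_), ?_⟩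
    · exact degreePart_congr (by push_cast; ring) (wedgeOp_mem (dFun (f i)) (hx i))
    · rw [map_smul, map_sum]
      simp only [evalAt_wedgeOp_one, hφ _ _ (hf _), hx']
      rw [sum_outer1_inner1]
      funext i
      change (((j + 1 : ℕ) : ℝ)⁻¹) • ((i : ℝ) • X i) = X i
      by_cases hi : i = j + 1
      · subst hi
        rw [smul_smul, inv_mul_cancel₀ (by positivity), one_smul]
      · rw [hX i (by exact_mod_cast hi), smul_zero, smul_zero]

end Local


/-! ### Cohomologous structures: the dimension of E_1^{p,n} for 0 ≤ p < n. -/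

section Rank

variable {E : Type*} [NormedAddCommGroup E] [NormedSpace ℝ E] [FiniteDimensional ℝ E]
  {M : Type*} [TopologicalSpace M] [ChartedSpace E M] [IsManifold 𝓘(ℝ, E) ∞ M] {n : ℕ}

theorem mulOp_wedgeOp_two_pow (f : C^∞⟮𝓘(ℝ, E), M; 𝓘(ℝ, ℝ), ℝ⟯) (ω₀ : Form E M 2) (r : ℕ)
    (x : TotalForm E M) : (wedgeOp ω₀ ^ r) (mulOp f x) = mulOp f ((wedgeOp ω₀ ^ r) x) := by
  refine total_ext fun p => ?_
  rw [evalAt_mulOp, evalAt_wedgeOp_two_pow, evalAt_wedgeOp_two_pow, evalAt_mulOp, map_smul]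

/-- There are a function `l` with a prescribed differential at `p`, a curve `y` in its zero set through
`p`, and a function `μ` which is a coordinate along this curve. -/
theorem exists_transverse_germs [T2Space M] (hn : 1 < Module.finrank ℝ E) (p : M)
    {θ : E [⋀^Fin 1]→L[ℝ] ℝ} : ∃ (l μ : C^∞⟮𝓘(ℝ, E), M; 𝓘(ℝ, ℝ), ℝ⟯) (y : ℝ → M),
      valAt (dFun l) p = θ ∧ Filter.Tendsto y (nhds 0) (nhds p) ∧
      ∀ᶠ s in nhds (0 : ℝ), l (y s) = 0 ∧ μ (y s) = s := by
  obtain ⟨φ, hφ⟩ := exists_dFun_eq (M := M) p θ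
  obtain ⟨l, hl⟩ := exists_linear_germ (M := M) p φ
  -- The curve is the straight line in the chart in a direction u on which φ vanishes. A norming
  -- functional of u, divided by ‖u‖, takes the value 1 at u and so gives the coordinate μ.
  obtain ⟨u, hu, hu0⟩ : ∃ u ∈ LinearMap.ker (φ : E →ₗ[ℝ] ℝ), u ≠ 0 := by
    refine Submodule.exists_mem_ne_zero_of_ne_bot fun h => ?_
    have := LinearMap.finrank_le_finrank_of_injective (LinearMap.ker_eq_bot.1 h)
    rw [Module.finrank_self] at this
    omega
  have hu1 : ‖u‖ ≠ 0 := norm_ne_zero_iff.2 hu0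
  obtain ⟨ψ₀, -, hψ₀⟩ := exists_dual_vector ℝ u hu1
  obtain ⟨μ, hμ⟩ := exists_linear_germ (M := M) p (‖u‖⁻¹ • ψ₀)
  have hc : Filter.Tendsto (fun s : ℝ => chartAt E p p + s • u) (nhds 0) (nhds (chartAt E p p)) := by
    have : Continuous fun s : ℝ => chartAt E p p + s • u := by fun_prop
    simpa using this.tendsto 0
  have hs : Filter.Tendsto (fun s : ℝ => (chartAt E p).symm (chartAt E p p + s • u)) (nhds 0)
      (nhds p) := by
    have h1 := (chartAt E p).continuousAt_symm (mem_chart_target E p)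
    have h2 := h1.tendsto.comp hc
    rwa [(chartAt E p).left_inv (mem_chart_source E p)] at h2
  refine ⟨l, μ, _, hφ l hl, hs, ?_⟩
  filter_upwards [hs.eventually hl, hs.eventually hμ,
    hc.eventually ((chartAt E p).open_target.mem_nhds (mem_chart_target E p))] with s h1 h2 h3
  have h4 := (chartAt E p).right_inv h3
  rw [h4, add_sub_cancel_left, map_smul] at h1 h2
  refine ⟨h1.trans ?_, h2.trans ?_⟩
  · rw [show φ u = 0 from hu, smul_zero]
  · rw [smul_apply, hψ₀]
    simp [hu1]

namespace LCSStructure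

variable (S : LCSStructure E M)

theorem dk_mulOp (m : ℤ) (f : C^∞⟮𝓘(ℝ, E), M; 𝓘(ℝ, ℝ), ℝ⟯) (x : TotalForm E M) :
    S.dk m (mulOp f x) = wedgeOp (dFun f) x + mulOp f (S.dk m x) := by
  rw [dk_apply, dk_apply, extDOp_mulOp, map_add, map_smul, mulOp_wedgeOp]
  abel

theorem L_pow_mulOp (f : C^∞⟮𝓘(ℝ, E), M; 𝓘(ℝ, ℝ), ℝ⟯) (r : ℕ) (x : TotalForm E M) :
    (S.L ^ r) (mulOp f x) = mulOp f ((S.L ^ r) x) := mulOp_wedgeOp_two_pow f S.form r x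

/-- The pairs `(α, β)` with `L^r d_m α = L^{r+1} β`, where `β` is of degree `i`. -/
def powPairs (m : ℤ) (i r : ℕ) : Submodule ℝ (TotalForm E M × TotalForm E M) :=
  ((degreePart E M (i + 1)).prod (degreePart E M i)) ⊓
    LinearMap.eqLocus (((S.L ^ r) ∘ₗ S.dk m) ∘ₗ LinearMap.fst ℝ _ _)
      ((S.L ^ (r + 1)) ∘ₗ LinearMap.snd ℝ _ _)

variable {S} in
theorem mem_powPairs {m : ℤ} {i r : ℕ} {x : TotalForm E M × TotalForm E M} :
    x ∈ S.powPairs m i r ↔ (x.1 ∈ degreePart E M (i + 1) ∧ x.2 ∈ degreePart E M i) ∧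
      (S.L ^ r) (S.dk m x.1) = (S.L ^ (r + 1)) x.2 := Iff.rfl

/-- A family of solutions of `L^P d_m α = L^{P+1} β` with independent `d_{m-1} β` gives a linearly
independent family in `E_1^{P,n}`. -/
theorem exists_linearIndependent_E_one (hn : Module.finrank ℝ E = 2 * n) {k : ℤ} {i P : ℕ}
    (hi : i + 1 + P = n) {ι : Type*} (x : ι → S.powPairs (k - P) i P)
    (hx : LinearIndependent ℝ fun t => S.dk (k - P - 1) (x t).1.2) :
    ∃ v : ι → (S.filteredComplex k).E 1 P n, LinearIndependent ℝ v := by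
  have h (c : TotalForm E M) : S.dk k ((S.L ^ P) c) = (S.L ^ P) (S.dk (k - P) c) := by
    rw [← dk_L_pow, sub_add_cancel]
  let f₀ : TotalForm E M × TotalForm E M →ₗ[ℝ] TotalForm E M := (S.L ^ P) ∘ₗ LinearMap.fst ℝ _ _
  have hf₀ : ∀ x ∈ S.powPairs (k - P) i P, f₀ x ∈ (S.filteredComplex k).Z 1 P n := by
    rintro ⟨α, β⟩ ⟨⟨h1, -⟩, h3⟩
    exact S.mem_Z_one.2 ⟨⟨α, rfl⟩, degreePart_congr (by omega) (S.L_pow_mem P h1),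
      β, h3.symm.trans (h α).symm⟩
  let f := (S.filteredComplex k).cls 1 P n ∘ₗ f₀.restrict hf₀
  let g : S.powPairs (k - P) i P →ₗ[ℝ] TotalForm E M :=
    (S.dk (k - P - 1) ∘ₗ LinearMap.snd ℝ _ _) ∘ₗ (S.powPairs (k - P) i P).subtype
  -- The operator α ↦ dβ descends to E_1: if α = Lb + dc then β = db by injectivity of L^{P+1} in
  -- degree i, and so dβ = 0.
  have hker : LinearMap.ker f ≤ LinearMap.ker g := by
    rintro ⟨⟨α, β⟩, hαβ⟩ h0
    obtain ⟨⟨hα, hβ⟩, h3⟩ := mem_powPairs.1 hαβ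
    obtain ⟨b, hb, c, hc, h4⟩ := S.mem_den_one.1 (((S.filteredComplex k).cls_eq_zero _).1 h0)
    have h5 : α = S.L b + S.dk (k - P) c := by
      refine S.eq_of_L_eq hn hα (add_mem ?_ ?_) P (by omega) h4
      · exact degreePart_congr (by omega) (S.L_mem hb)
      · exact degreePart_congr (by omega) (S.dk_degree _ _ _ hc)
    have h6 : β = S.dk (k - P - 1) b := by
      refine S.eq_of_L_eq hn hβ (degreePart_congr (by omega) (S.dk_degree _ _ _ hb))
        (P + 1) (by push_cast; omega) (h3.symm.trans ?_)
      change (S.L ^ P) (S.dk (k - P) α) = _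
      rw [h5, map_add, dk_dk, add_zero, L_pow_succ, L_dk]
    change S.dk (k - P - 1) β = 0
    rw [h6, dk_dk]
  refine ⟨fun t => f (x t), linearIndependent_iff'.2 fun s c hc => ?_⟩
  refine linearIndependent_iff'.1 hx s c ?_
  have h1 : f (∑ t ∈ s, c t • x t) = 0 := by simpa using hc
  have h2 : g (∑ t ∈ s, c t • x t) = 0 := hker h1
  simpa [g] using h2

/-- The test forms are α_t = l² e^{tμ} η. One factor l survives in β_t = l γ_t, so on {l = 0} the
form dβ_t = dl ∧ γ_t = 2 e^{tμ} dl ∧ γ sees only the symbol. -/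
theorem exists_linearIndependent_real [T2Space M] [Nonempty M] (hn : Module.finrank ℝ E = 2 * n)
    {k : ℤ} {P : ℕ} (hP : P < n) :
    ∃ v : ℝ → (S.filteredComplex k).E 1 P n, LinearIndependent ℝ v := by
  obtain ⟨i, hi⟩ : ∃ i, i + 1 + P = n := ⟨n - 1 - P, by omega⟩
  obtain ⟨p⟩ := ‹Nonempty M›
  obtain ⟨θ, γ₀, hγ₀, η₀, hη₀, hne, heq⟩ := exists_symbol_ne_zero (S.isNondeg p) hn i P hi
  obtain ⟨l, μ, y, hl, hy, hly⟩ := exists_transverse_germs (M := M) (by omega) p (θ := θ)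
  obtain ⟨η, hη, hηp⟩ := exists_evalAt_eq p (j := i + 1) (by exact_mod_cast hη₀)
  -- L^P x has degree i + 2 + 2P = n + (P + 1), exactly where division by L^{P+1} becomes possible.
  have hdiv (x : TotalForm E M) (hx : x ∈ degreePart E M (i + 2)) :
      ∃ z ∈ degreePart E M i, (S.L ^ (P + 1)) z = (S.L ^ P) x := by
    obtain ⟨z, hz, hz'⟩ := S.exists_L_pow_eq hn (S.L_pow_mem P hx) (P + 1) (by push_cast; omega)
    exact ⟨z, degreePart_congr (by push_cast; omega) hz, hz'⟩
  have hη' (f : C^∞⟮𝓘(ℝ, E), M; 𝓘(ℝ, ℝ), ℝ⟯) : wedgeOp (dFun f) η ∈ degreePart E M (i + 2) :=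
    degreePart_congr (by push_cast; omega) (wedgeOp_mem (dFun f) hη)
  obtain ⟨γ, hγ, hγ'⟩ := hdiv _ (hη' l)
  -- L^{P+1} is injective in degree i = n - (P + 1), so the value of γ at p is the one prescribed by
  -- the symbol.
  have hγp : evalAt p γ = γ₀ := by
    have h1 := congrArg (evalAt p) hγ'
    rw [evalAt_L_pow, evalAt_L_pow, evalAt_wedgeOp_one, hl, hηp, heq] at h1
    refine eq_of_add_neg_one_smul (((S.isNondeg p).lefschetzPair hn).eq_zero_of_L_pow_eq_zero
      (add_mem (evalAt_mem hγ p) (Submodule.smul_mem _ _ hγ₀)) (P + 1) (by push_cast; omega) ?_)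
    rw [map_add, map_smul, h1]
    module
  -- L^{P+1} δ_t is L^P d_{k-P}(e^{tμ} η), the part of L^P dα_t that carries the factor l². It
  -- contributes nothing to dβ_t on {l = 0}.
  choose δ hδ hδ' using fun t : ℝ => hdiv
    (wedgeOp (dFun (expFun t μ)) η + mulOp (expFun t μ) (S.dk (k - P) η))
    (add_mem (hη' _) (mulOp_mem _ (degreePart_congr (by push_cast; omega) (S.dk_degree _ _ _ hη))))
  let α (t : ℝ) : TotalForm E M := mulOp l (mulOp l (mulOp (expFun t μ) η))
  let γt (t : ℝ) : TotalForm E M := (2 : ℝ) • mulOp (expFun t μ) γ + mulOp l (δ t)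
  have hmem (t : ℝ) : (α t, mulOp l (γt t)) ∈ S.powPairs (k - P) i P := by
    refine mem_powPairs.2 ⟨⟨?_, ?_⟩, ?_⟩
    · exact degreePart_congr (by push_cast; omega) (mulOp_mem _ (mulOp_mem _ (mulOp_mem _ hη)))
    · exact mulOp_mem _ (add_mem (Submodule.smul_mem _ _ (mulOp_mem _ hγ)) (mulOp_mem _ (hδ t)))
    · simp only [α, γt]
      rw [dk_mulOp, dk_mulOp, dk_mulOp, L_pow_mulOp, map_add (S.L ^ (P + 1)), map_smul (S.L ^ (P + 1)),
        L_pow_mulOp, L_pow_mulOp, hγ', hδ', ← mulOp_wedgeOp, ← mulOp_wedgeOp, map_add (S.L ^ P),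
        L_pow_mulOp, L_pow_mulOp, L_pow_mulOp, map_add (S.L ^ P), L_pow_mulOp, L_pow_mulOp, map_add (mulOp l)]
      simp only [map_add, map_smul]
      module
  refine S.exists_linearIndependent_E_one hn hi (fun t => ⟨_, hmem t⟩) ?_
  refine linearIndependent_iff'.2 fun s c hc => eq_zero_of_sum_exp_eventually ?_
  have hne' : evalAt p (wedgeOp (dFun l) γ) ≠ 0 := by
    rwa [evalAt_wedgeOp_one, hl, hγp]
  -- Along the curve μ(y(r)) = r and dl ∧ γ ≠ 0 for small r, so a linear relation among the dβ_t
  -- becomes one among the functions e^{tr}.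
  filter_upwards [hly, hy.eventually (eventually_evalAt_ne_zero hne')] with r hr hr'
  have h1 := congrArg (evalAt (y r)) hc
  rw [map_sum, map_zero] at h1
  have h2 (t : ℝ) : evalAt (y r) (S.dk (k - P - 1) (mulOp l (γt t))) =
      (2 * Real.exp (t * r)) • evalAt (y r) (wedgeOp (dFun l) γ) := by
    rw [dk_mulOp, map_add, evalAt_mulOp, hr.1, zero_smul, add_zero, evalAt_wedgeOp_one]
    simp only [γt]
    rw [map_add, map_smul, evalAt_mulOp, evalAt_mulOp, hr.1, zero_smul, add_zero, map_smul, map_smul,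
      evalAt_wedgeOp_one, smul_smul, expFun_apply, hr.2]
  simp only [map_smul, h2, smul_smul] at h1
  rw [← Finset.sum_smul] at h1
  have h3 := (smul_eq_zero.1 h1).resolve_right hr'
  have h4 : ∑ t ∈ s, c t * (2 * Real.exp (t * r)) = 2 * ∑ t ∈ s, c t * Real.exp (t * r) := by
    rw [Finset.mul_sum]
    exact Finset.sum_congr rfl fun t _ => by ring
  rw [h4] at h3
  linarith

-- The rank is at most the cardinality of Ω^*(M) and at least that of the independent family indexed
-- by ℝ. Thus it depends on neither ω nor θ.
open Cardinal in
theorem lift_rank_E_one [T2Space M] [SecondCountableTopology M] [Nonempty M]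
    (hn : Module.finrank ℝ E = 2 * n) {k : ℤ} {P : ℕ} (hP : P < n) :
    Cardinal.lift.{0} (Module.rank ℝ ((S.filteredComplex k).E 1 P n)) = Cardinal.lift (#ℝ) := by
  refine le_antisymm ?_ ?_
  · refine le_trans ?_ (lift_mk_totalForm_le (E := E) (M := M))
    rw [Cardinal.lift_le]
    refine (rank_le_card ℝ _).trans ((Cardinal.mk_le_of_surjective
      ((S.filteredComplex k).cls_surjective 1 P n)).trans
      (Cardinal.mk_le_of_injective Subtype.val_injective))
  · obtain ⟨v, hv⟩ := S.exists_linearIndependent_real (k := k) hn hP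
    exact hv.cardinal_lift_le_rank

/-- The case `0 ≤ p < q = n`. -/
theorem nonempty_E_one_equiv_of_eq [T2Space M] [SecondCountableTopology M]
    (S' : LCSStructure E M) (hn : Module.finrank ℝ E = 2 * n) {k : ℤ} {P : ℕ} (hP : P < n) :
    Nonempty ((S.filteredComplex k).E 1 P n ≃ₗ[ℝ] (S'.filteredComplex k).E 1 P n) := by
  rcases isEmpty_or_nonempty M with hM | hM
  · have key (S : LCSStructure E M) (x : TotalForm E M) (_ : x ∈ (S.filteredComplex k).Z 1 P n) :
        x ∈ (S.filteredComplex k).Z (1 - 1) (P + 1) (n - 1) ⊔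
          (S.filteredComplex k).B (1 - 1) P n := by
      rw [show x = 0 from total_ext fun p => (hM.false p).elim]
      exact zero_mem _
    exact FilteredComplex.nonempty_equiv_of_subsingleton (key S) (key S')
  · have hfree (S : LCSStructure E M) : Module.Free ℝ ((S.filteredComplex k).E 1 P n) :=
      Module.Free.of_divisionRing ℝ _
    have := hfree S
    have := hfree S'
    refine nonempty_linearEquiv_of_rank_eq ?_
    have := (S.lift_rank_E_one (k := k) hn hP).trans (S'.lift_rank_E_one (k := k) hn hP).symm
    exact Cardinal.lift_injective this

/-- Structures whose forms differ by `d_θ ρ` have isomorphic `E_1`-terms. -/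
theorem nonempty_E_one_equiv_of_cohomologous [T2Space M] [SecondCountableTopology M]
    {S' : LCSStructure E M} {ρ : Form E M 1} (hn : Module.finrank ℝ E = 2 * n)
    (h : S'.form = S.form + (extD ρ + wedgeForm S.lee ρ)) (hθ : S'.lee = S.lee) (k p q : ℤ) :
    Nonempty ((S.filteredComplex k).E 1 p q ≃ₗ[ℝ] (S'.filteredComplex k).E 1 p q) := by
  rcases lt_or_ge p 0 with hp | hp
  · exact nonempty_E_one_equiv_of_neg hp
  obtain ⟨P, rfl⟩ := Int.eq_ofNat_of_zero_le hp
  rcases lt_trichotomy q n with hq | rfl | hq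
  · exact nonempty_E_one_equiv_of_lt hn h hθ hq
  · rcases lt_or_ge P n with hP | hP
    · exact S.nonempty_E_one_equiv_of_eq S' hn hP
    · exact nonempty_E_one_equiv_of_ge hn hP
  · exact nonempty_E_one_equiv_of_gt hn hq

end LCSStructure

end Rank

end LCS

end

/-! ### Assembly of the two statements. -/

theorem theorem4p7 {n : ℕ} {M : Type*} [TopologicalSpace M] [T2Space M]
    [SecondCountableTopology M] [ChartedSpace (EuclideanSpace ℝ (Fin (2 * n))) M]
    [IsManifold (𝓡 (2 * n)) ∞ M]
    (S S' : LCS.LCSStructure (EuclideanSpace ℝ (Fin (2 * n))) M) :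
    -- conformally equivalent l.c.s. forms have isomorphic spectral sequences
    (∀ f : C^∞⟮𝓡 (2 * n), M; 𝓘(ℝ, ℝ), ℝ⟯,
      ((∀ x, S'.form.1 x = Real.exp (f x) • S.form.1 x) ∨
        (∀ x, S'.form.1 x = -(Real.exp (f x) • S.form.1 x))) →
      (n = 1 → ∀ x v,
        S.lee.1 x v - S'.lee.1 x v = mfderiv (𝓡 (2 * n)) 𝓘(ℝ, ℝ) f x (v 0)) →
      ∀ k : ℤ, Nonempty (S.spectralSequence k ≅ S'.spectralSequence k)) ∧
    -- cohomologous l.c.s. forms have isomorphic `E_1`-terms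
    (∀ ρ : LCS.Form (EuclideanSpace ℝ (Fin (2 * n))) M 1,
      S'.form = S.form + (LCS.extD ρ + LCS.wedgeForm S.lee ρ) →
      (n = 1 → S'.lee = S.lee) →
      ∀ k p q : ℤ, Nonempty (((S.spectralSequence k).page 1).X (p, q) ≅
        ((S'.spectralSequence k).page 1).X (p, q))) := by
  have hn : Module.finrank ℝ (EuclideanSpace ℝ (Fin (2 * n))) = 2 * n := finrank_euclideanSpace_fin
  refine ⟨fun f hf hθ k => ?_, fun ρ hρ hθ k p q => ?_⟩
  -- The two signs of the conformal factor are treated together, with ε = 1 or ε = -1.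
  · obtain ⟨ε, hε, hω⟩ : ∃ ε : ℝ, ε ≠ 0 ∧
        ∀ p, LCS.valAt S'.form p = (ε * Real.exp (f p)) • LCS.valAt S.form p := by
      rcases hf with hf | hf
      · exact ⟨1, one_ne_zero, fun p => (hf p).trans (by rw [one_mul]; rfl)⟩
      · refine ⟨-1, by norm_num, fun p => (hf p).trans ?_⟩
        refine ContinuousAlternatingMap.ext fun v => ?_
        change -(Real.exp (f p) * LCS.valAt S.form p v) = -1 * Real.exp (f p) * LCS.valAt S.form p v
        ring
    refine LCS.LCSStructure.nonempty_iso_of_conformal hε hω ?_ k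
    by_cases hn1 : n = 1
    · refine LCS.form_ext fun p => ContinuousAlternatingMap.ext fun v => ?_
      have h1 : S.lee.1 p v - S'.lee.1 p v = (LCS.dFun f).1 p v :=
        (hθ hn1 p v).trans (LCS.dFun_apply f p v).symm
      exact sub_eq_iff_eq_add'.1 h1
    · exact LCS.LCSStructure.lee_eq_of_conformal hn hn1 hε hω
  · have hθ' : S'.lee = S.lee := by
      by_cases hn1 : n = 1
      · exact hθ hn1
      · exact LCS.LCSStructure.lee_eq_of_cohomologous hn hn1 hρ
    obtain ⟨e⟩ := S.nonempty_E_one_equiv_of_cohomologous hn hρ hθ' k p q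
    exact ⟨e.toModuleIso⟩
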